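/- Let $[n]=\{1,\dots,n\}$. The *arcs* of a partition $P$ of $[n]$ are the pairs $(i,j)$, $i<j$, of consecutive elements of a block of $P$; they determine $P$. Two arcs $(i_1,j_1),(i_2,j_2)$ form a *2-crossing* if $i_1<i_2<j_1<j_2$, and $\mathrm{Cr}_2(P)$ is the number of 2-crossings of $P$. For $S,T\subseteq[n]$ with $|S|=|T|$ let $P_n(S,T)$ be the set of partitions of $[n]$ whose set of minimal block elements is $S$ and whose set of maximal block elements is $T$. *The statistic $\mathrm{pmaj}$.* Label the arcs of $P$ by $1,2,\dots,k$ in decreasing order of left-hand endpoints, and let $r_1>\dots>r_k$ be the right-hand endpoints. Put $\sigma(r_1)=(a)$, where $a$ is the label of the arc ending at $r_1$; obtain $\sigma(r_{t+1})$ from $\sigma(r_t)$ by deleting the labels of all arcs whose left-hand endpoint $l$ satisfies $r_{t+1}\le l<r_t$ and then writing in front the label of the arc ending at $r_{t+1}$. Then $\mathrm{pmaj}(P)=\sum_t \mathrm{des}(\sigma(r_t))$, where $\mathrm{des}$ counts descents. *The map $\varphi$ on matchings.* A matching is a finite set of arcs $(i,j)$, $i<j$, on linearly ordered vertices, every vertex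 belonging to exactly one arc. Put $\varphi(\emptyset)=\emptyset$. For a nonempty matching $M$ with last vertex $v$ and arc $(i,v)$ let $N=\varphi(M\setminus\{(i,v)\})$. An arc $(a,b)\ne(i,v)$ is *large* if $a<i$ and *small* if $a>i$. Let $\mathcal R$ be the set of right-hand endpoints $j>i$ of $N$; let $e_L$ be the large arc of $N$ with the biggest right-hand endpoint $e_L^r$ in $\mathcal R$, and $e_S=(e_S^l,e_S^r)$ the small arc of $N$ with the smallest left-hand endpoint that crosses $e_L$. If both exist, put $\mathcal R_1=\{j\in\mathcal R:e_S^l<j\le e_S^r\}$ and $\mathcal R_2=\{j\in\mathcal R:j<e_S^l\}$; if only $e_L$ exists, $\mathcal R_1=\emptyset$ and $\mathcal R_2=\{j\in\mathcal R: j\le e_L^r\}$; if $e_L$ does not exist, $\mathcal R_1=\mathcal R_2=\emptyset$. Change $N$ as follows, $(i_s,j_s)$ always denoting the current arc ending at $j_s$. (I) If $\mathcal R_1\neq\emptyset$, start with $j_1=e_S^r$ and let $j_2$ run through the other elements of $\mathcal R_1$ from right to left. If $(i_2,j_2)$ is large, replace $(i_1,j_1),(i_2,j_2)$ by $(i_1,j_2),(i_2,j_1)$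 and set $j_1:=j_2$. If $(i_2,j_2)$ is small and there is no right-hand endpoint between $i_1$ and $i_2$, only set $j_1:=j_2$. If it is small, there is such a right-hand endpoint and $i_1<i_2$, do nothing. If it is small, there is such a right-hand endpoint and $i_2<i_1$, let $j_3>j_1$ be smallest such that $(i_3,j_3)$ is large, replace $(i_1,j_1),(i_2,j_2),(i_3,j_3)$ by $(i_1,j_2),(i_2,j_3),(i_3,j_1)$ and set $j_1:=j_2$. (II) Then, if $\mathcal R_2\ne\emptyset$, let $t_0=\max\mathcal R_2$. If the arc $(i_0,t_0)$ is small, let $(i_1,t_1)$ be the large arc with smallest $t_1>t_0$ and replace these two arcs by $(i_0,t_1),(i_1,t_0)$. Start with $j_1=t_0$ and let $j_2$ run through the other elements of $\mathcal R_2$ from right to left: if $(i_2,j_2)$ is small, replace $(i_1,j_1),(i_2,j_2)$ by $(i_1,j_2),(i_2,j_1)$; in all cases set $j_1:=j_2$. Finally $\varphi(M)$ is the result together with the arc $(i,v)$. *The map $\varphi$ on partitions.* Given $P$, replace every arc $(x,y)$ by $(x^1,y^0)$, where the vertices are ordered by $1^0<1^1<2^0<2^1<\cdots$, apply $\varphi$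 to the resulting matching, and identify $x^0$ and $x^1$ with $x$ again; $\varphi(P)$ is the partition of $[n]$ with the arcs so obtained. **Theorem.** Let $S,T\subseteq[n]$ with $|S|=|T|$. The map $\varphi$ is well defined (the arcs produced from $M\in P_n(S,T)$ are exactly the arcs of the partition $\varphi(M)$), it is a bijection from $P_n(S,T)$ to itself, and $$\mathrm{pmaj}(M)=\mathrm{Cr}_2(\varphi(M))\qquad\text{for all } M\in P_n(S,T).$$ Consequently, for every $k$, the number of $M\in P_n(S,T)$ with $\mathrm{pmaj}(M)=k$ equals the number of $M\in P_n(S,T)$ with $\mathrm{Cr}_2(M)=k$. -/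

import Mathlib

namespace MatchingFoata

/-! ### Arcs

An arc is a pair `(i, j)` with `i < j`; `i` is its left-hand and `j` its right-hand endpoint.
In the arc sets below every vertex is the left-hand endpoint of at most one arc and the right-hand
endpoint of at most one arc. -/

/-- The set of right-hand endpoints of the arcs in `A`. -/
def rightEnds (A : Finset (ℕ × ℕ)) : Finset ℕ := A.image Prod.snd

/-- The left-hand endpoint of the (unique) arc of `A` whose right-hand endpoint is `j`. -/
def leftOf (A : Finset (ℕ × ℕ)) (j : ℕ) : ℕ := (A.filter fun e => e.2 = j).sup Prod.fst

/-- The arcs `e` and `f` form a 2-crossing, `e` being the one that starts first. -/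
def Crosses (e f : ℕ × ℕ) : Prop := e.1 < f.1 ∧ f.1 < e.2 ∧ e.2 < f.2

instance (e f : ℕ × ℕ) : Decidable (Crosses e f) := by unfold Crosses; infer_instance

/-- The number of 2-crossings of an arc set. -/
def arcCr2 (A : Finset (ℕ × ℕ)) : ℕ := ((A ×ˢ A).filter fun p => Crosses p.1 p.2).card

/-! ### The p-major index of an arc set -/

/-- The label of an arc: arcs are labelled `1, 2, …, k` by decreasing left-hand endpoints. -/
def label (A : Finset (ℕ × ℕ)) (e : ℕ × ℕ) : ℕ := (A.filter fun f => e.1 ≤ f.1).card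

/-- The label of the arc of `A` whose right-hand endpoint is `r`. -/
def labelAt (A : Finset (ℕ × ℕ)) (r : ℕ) : ℕ := label A (leftOf A r, r)

/-- The number of descents of a word. -/
def des : List ℕ → ℕ
  | a :: b :: l => (if b < a then 1 else 0) + des (b :: l)
  | _ => 0

/-- Given a right-hand endpoint `r` with `σ(r) = s` and the list of the right-hand endpoints to the
left of `r`, in decreasing order, the list of their sequences `σ`. To pass from `r` to the next
right-hand endpoint `r'`, the labels of the arcs whose left-hand endpoint is in `[r', r)` are
deleted (an arc that starts at `r'` counts as starting to the right of the arc ending at `r'`), and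
then the label of the arc ending at `r'` is put in front. -/
def sigmaFrom (A : Finset (ℕ × ℕ)) : ℕ → List ℕ → List ℕ → List (List ℕ)
  | _, _, [] => []
  | r, s, r' :: rest =>
    let s' := labelAt A r' ::
      s.filter fun a => ¬ ∃ e ∈ A, label A e = a ∧ r' ≤ e.1 ∧ e.1 < r
    s' :: sigmaFrom A r' s' rest

/-- The list `σ(r₁), σ(r₂), …, σ(rₖ)`, where `r₁ > r₂ > ⋯ > rₖ` are the right-hand endpoints. -/
def sigmas (A : Finset (ℕ × ℕ)) : List (List ℕ) :=
  match (rightEnds A).sort (· ≥ ·) with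
  | [] => []
  | r :: rest => [labelAt A r] :: sigmaFrom A r [labelAt A r] rest

/-- The p-major index of an arc set. -/
def arcPmaj (A : Finset (ℕ × ℕ)) : ℕ := ((sigmas A).map des).sum

/-! ### The regions determined by the last arc

Here `N` is a matching and `i` is the left-hand endpoint of an arc `(i, v)`, not in `N`, with `v`
to the right of all vertices of `N`. An arc `e` of `N` is large if `e.1 < i` and small if
`i < e.1`. -/

/-- The set `𝓡` of right-hand endpoints of `N` to the right of `i`. -/
def region (i : ℕ) (N : Finset (ℕ × ℕ)) : Finset ℕ := (rightEnds N).filter fun j => i < j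

/-- `e` is the critical large arc: the large arc with the biggest right-hand endpoint in `𝓡`. -/
def IsCriticalLarge (i : ℕ) (N : Finset (ℕ × ℕ)) (e : ℕ × ℕ) : Prop :=
  e ∈ N ∧ e.1 < i ∧ e.2 ∈ region i N ∧ ∀ f ∈ N, f.1 < i → f.2 ∈ region i N → f.2 ≤ e.2

instance (i : ℕ) (N : Finset (ℕ × ℕ)) (e : ℕ × ℕ) : Decidable (IsCriticalLarge i N e) := by
  unfold IsCriticalLarge; infer_instance

/-- `s` is the critical small arc: the small arc with the smallest left-hand endpoint among those
that cross the critical large arc. -/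
def IsCriticalSmall (i : ℕ) (N : Finset (ℕ × ℕ)) (s : ℕ × ℕ) : Prop :=
  ∃ e ∈ N, IsCriticalLarge i N e ∧ s ∈ N ∧ i < s.1 ∧ Crosses e s ∧
    ∀ f ∈ N, i < f.1 → Crosses e f → s.1 ≤ f.1

instance (i : ℕ) (N : Finset (ℕ × ℕ)) (s : ℕ × ℕ) : Decidable (IsCriticalSmall i N s) := by
  unfold IsCriticalSmall; infer_instance

/-- The set `𝓡₁(N)`; it is empty when there is no critical small arc. -/
def region1 (i : ℕ) (N : Finset (ℕ × ℕ)) : Finset ℕ :=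
  (region i N).filter fun j => ∃ s ∈ N, IsCriticalSmall i N s ∧ s.1 < j ∧ j ≤ s.2

/-- The set `𝓡₂(N)`; it is empty when there is no critical large arc. -/
def region2 (i : ℕ) (N : Finset (ℕ × ℕ)) : Finset ℕ :=
  (region i N).filter fun j =>
    (∃ s ∈ N, IsCriticalSmall i N s ∧ j < s.1) ∨
    ((¬ ∃ s ∈ N, IsCriticalSmall i N s) ∧ ∃ e ∈ N, IsCriticalLarge i N e ∧ j ≤ e.2)

/-! ### The two algorithms -/

/-- Replace the arcs `(i₁, j₁), (i₂, j₂)` of `A` by `(i₁, j₂), (i₂, j₁)`. -/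
def swapArcs (A : Finset (ℕ × ℕ)) (j₁ j₂ : ℕ) : Finset (ℕ × ℕ) :=
  (A \ {(leftOf A j₁, j₁), (leftOf A j₂, j₂)}) ∪ {(leftOf A j₁, j₂), (leftOf A j₂, j₁)}

/-- Replace the arcs `(i₁, j₁), (i₂, j₂), (i₃, j₃)` of `A` by `(i₁, j₂), (i₂, j₃), (i₃, j₁)`. -/
def rotateArcs (A : Finset (ℕ × ℕ)) (j₁ j₂ j₃ : ℕ) : Finset (ℕ × ℕ) :=
  (A \ {(leftOf A j₁, j₁), (leftOf A j₂, j₂), (leftOf A j₃, j₃)}) ∪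
    {(leftOf A j₁, j₂), (leftOf A j₂, j₃), (leftOf A j₃, j₁)}

/-- The right-hand endpoints greater than `j` of large arcs of `A`. -/
def largeEndsAfter (i : ℕ) (A : Finset (ℕ × ℕ)) (j : ℕ) : Finset ℕ :=
  (A.filter fun e => e.1 < i ∧ j < e.2).image Prod.snd

/-- One round of Algorithm I. The state is the current matching with the position of the first
pointer; `j₂` is the position of the second pointer. The cases are, in this order: `(i₂, j₂)` is
large; it is small and no right-hand endpoint is between `i₁` and `i₂`; there is one and `i₁ < i₂`;
there is one and `i₂ < i₁`. In the last case a large arc to the right of `j₁` always exists; the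
final `else` is never reached. -/
def stepI (i : ℕ) (st : Finset (ℕ × ℕ) × ℕ) (j₂ : ℕ) : Finset (ℕ × ℕ) × ℕ :=
  let A := st.1
  let j₁ := st.2
  let i₁ := leftOf A j₁
  let i₂ := leftOf A j₂
  if i₂ < i then (swapArcs A j₁ j₂, j₂)
  else if ¬ ∃ r ∈ rightEnds A, min i₁ i₂ < r ∧ r < max i₁ i₂ then (A, j₂)
  else if i₁ < i₂ then (A, j₁)
  else if h : (largeEndsAfter i A j₁).Nonempty then
    (rotateArcs A j₁ j₂ ((largeEndsAfter i A j₁).min' h), j₂)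
  else (A, j₁)

/-- Algorithm I on the set `R₁`: the first pointer starts at the largest element of `R₁` (which is
the right-hand endpoint of the critical small arc), the second runs through the other elements
from right to left. -/
def algorithmI (i : ℕ) (R₁ : Finset ℕ) (A : Finset (ℕ × ℕ)) : Finset (ℕ × ℕ) :=
  match R₁.sort (· ≥ ·) with
  | [] => A
  | p :: rest => (rest.foldl (stepI i) (A, p)).1

/-- The pre-processing (borrowing) step of Algorithm II at the vertex `t₀`. -/
def borrow (i : ℕ) (A : Finset (ℕ × ℕ)) (t₀ : ℕ) : Finset (ℕ × ℕ) :=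
  if i < leftOf A t₀ then
    if h : (largeEndsAfter i A t₀).Nonempty then swapArcs A t₀ ((largeEndsAfter i A t₀).min' h)
    else A
  else A

/-- One round of Algorithm II. -/
def stepII (i : ℕ) (st : Finset (ℕ × ℕ) × ℕ) (j₂ : ℕ) : Finset (ℕ × ℕ) × ℕ :=
  if leftOf st.1 j₂ < i then (st.1, j₂) else (swapArcs st.1 st.2 j₂, j₂)

/-- Algorithm II on the set `R₂`, with its pre-processing. -/
def algorithmII (i : ℕ) (R₂ : Finset ℕ) (A : Finset (ℕ × ℕ)) : Finset (ℕ × ℕ) :=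
  match R₂.sort (· ≥ ·) with
  | [] => A
  | t₀ :: rest => (rest.foldl (stepII i) (borrow i A t₀, t₀)).1

/-- The map `φ` on matchings (arc sets in which no vertex is used twice), by induction on the
number of arcs: the arc `(i, v)` ending at the last vertex `v` is removed, `φ` is applied to the
remaining matching, the two algorithms are run on the result `N`, with the regions of `N`, and the
arc `(i, v)` is put back. -/
def phi (M : Finset (ℕ × ℕ)) : Finset (ℕ × ℕ) :=
  if h : (rightEnds M).Nonempty then
    let v := (rightEnds M).max' h
    let i := leftOf M v
    let N := phi (M.filter fun e => e.2 ≠ v)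
    insert (i, v) (algorithmII i (region2 i N) (algorithmI i (region1 i N) N))
  else ∅
termination_by M.card
decreasing_by
  obtain ⟨e, he, hev⟩ := Finset.mem_image.1 ((rightEnds M).max'_mem h)
  exact Finset.card_lt_card (Finset.filter_ssubset.2 ⟨e, he, by simpa using hev⟩)

/-! ### Partitions of `[n] = {1, …, n}` -/

/-- The arcs of the standard representation: pairs of consecutive elements of a block. -/
def arcs {n : ℕ} (P : Finpartition (Finset.Icc 1 n)) : Finset (ℕ × ℕ) :=
  (Finset.Icc 1 n ×ˢ Finset.Icc 1 n).filter fun e =>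
    e.1 < e.2 ∧ ∃ B ∈ P.parts, e.1 ∈ B ∧ e.2 ∈ B ∧ ∀ c ∈ B, ¬ (e.1 < c ∧ c < e.2)

/-- The number of 2-crossings of a partition. -/
def Cr2 {n : ℕ} (P : Finpartition (Finset.Icc 1 n)) : ℕ := arcCr2 (arcs P)

/-- The p-major index of a partition. -/
def pmaj {n : ℕ} (P : Finpartition (Finset.Icc 1 n)) : ℕ := arcPmaj (arcs P)

/-- The set of minimal block elements. -/
def minElems {n : ℕ} (P : Finpartition (Finset.Icc 1 n)) : Finset ℕ :=
  (Finset.Icc 1 n).filter fun x => ∃ B ∈ P.parts, x ∈ B ∧ ∀ y ∈ B, x ≤ y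

/-- The set of maximal block elements. -/
def maxElems {n : ℕ} (P : Finpartition (Finset.Icc 1 n)) : Finset ℕ :=
  (Finset.Icc 1 n).filter fun x => ∃ B ∈ P.parts, x ∈ B ∧ ∀ y ∈ B, y ≤ x

/-- The set `P_n(S, T)` of partitions of `[n]` with minimal block elements `S` and maximal block
elements `T`. -/
def partitionsWith (n : ℕ) (S T : Finset ℕ) : Finset (Finpartition (Finset.Icc 1 n)) :=
  Finset.univ.filter fun P => minElems P = S ∧ maxElems P = T

/-- The passage from the arcs of a partition to a matching: a vertex `x` becomes `x⁰ = 2x` as a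
right-hand endpoint and `x¹ = 2x + 1` as a left-hand endpoint. -/
def splitArcs (A : Finset (ℕ × ℕ)) : Finset (ℕ × ℕ) := A.image fun e => (2 * e.1 + 1, 2 * e.2)

/-- The reverse passage: `x⁰ = 2x` and `x¹ = 2x + 1` are identified with `x`. -/
def mergeArcs (A : Finset (ℕ × ℕ)) : Finset (ℕ × ℕ) := A.image fun e => (e.1 / 2, e.2 / 2)

open Classical in
/-- The partition of `[n]` whose blocks are the connected components of the graph with arc set
`A`. -/
noncomputable def ofArcs (n : ℕ) (A : Finset (ℕ × ℕ)) : Finpartition (Finset.Icc 1 n) :=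
  Finpartition.ofSetSetoid (Relation.EqvGen.setoid fun a b => (a, b) ∈ A) (Finset.Icc 1 n)

/-- The arc set of the image of a partition under the generalized Foata map. -/
def foataArcs {n : ℕ} (P : Finpartition (Finset.Icc 1 n)) : Finset (ℕ × ℕ) :=
  mergeArcs (phi (splitArcs (arcs P)))

/-- The generalized Foata map `φ` on partitions of `[n]`. -/
noncomputable def foataMap {n : ℕ} (P : Finpartition (Finset.Icc 1 n)) :
    Finpartition (Finset.Icc 1 n) :=
  ofArcs n (foataArcs P)

end MatchingFoata

/-!
Record a matching as a function `f` on its set `R` of right-hand endpoints, arc by arc `(f p, p)`.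
Exchanging the right-hand endpoints of two arcs composes `f` with a transposition, and it changes
the number of crossings by exactly one when no third arc separates the two.

Remove the last arc `(i, v)`. Adding it back creates one crossing for every large arc ending after
`i`, but raises the major index by the number of right-hand endpoints in the second region, because
these are the right-hand endpoints after `i` that do not pass any exposed left-hand endpoint after
`i` (one whose arc is nested in no other arc). The algorithm makes up the difference: step (I)
destroys one crossing for every large arc ending in the first region, and step (II) creates one for
every small arc ending in the second. It keeps both sets of endpoints and the order in which the
large arcs end. Hence it preserves the exposed endpoints before `i`, and a matching and its image
have the same exposed endpoints, which carries the induction.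

Every exchange of the algorithm is legible in its outcome: undoing the moves in reverse order, the
current arcs show which rule was applied. So the map is injective, and a bijection by finiteness.
-/

namespace MatchingFoata

/-! ### Precomposition with a transposition -/

section Swap

variable {α β : Type*} [DecidableEq α] {s : Finset α} {f g : α → β} {a b c p : α}

lemma comp_swap_apply (f : α → β) (a b p : α) :
    (f ∘ Equiv.swap a b) p = if p = a then f b else if p = b then f a else f p := by
  simp only [Function.comp, Equiv.swap_apply_def]
  split_ifs <;> rfl

lemma comp_swap_left : (f ∘ Equiv.swap a b) a = f b := by simp

lemma comp_swap_right : (f ∘ Equiv.swap a b) b = f a := by simp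

lemma comp_swap_of_ne (ha : p ≠ a) (hb : p ≠ b) : (f ∘ Equiv.swap a b) p = f p := by
  simp [Equiv.swap_apply_of_ne_of_ne ha hb]

lemma comp_swap_comp_swap (f : α → β) (a b : α) : (f ∘ Equiv.swap a b) ∘ Equiv.swap a b = f := by
  ext p; simp

/-- The function `f` with its values at `a`, `b`, `c` moved to `b`, `c`, `a`. -/
def rotate (f : α → β) (a b c : α) : α → β := (f ∘ Equiv.swap a b) ∘ Equiv.swap a c

lemma rotate_left (hac : a ≠ c) (hbc : b ≠ c) : rotate f a b c a = f c := by
  rw [rotate, comp_swap_left, comp_swap_of_ne hac.symm hbc.symm]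

lemma rotate_middle (hab : a ≠ b) (hbc : b ≠ c) : rotate f a b c b = f a := by
  rw [rotate, comp_swap_of_ne hab.symm hbc, comp_swap_right]

lemma rotate_right : rotate f a b c c = f b := by
  rw [rotate, comp_swap_right, comp_swap_left]

lemma rotate_of_ne (ha : p ≠ a) (hb : p ≠ b) (hc : p ≠ c) : rotate f a b c p = f p := by
  rw [rotate, comp_swap_of_ne ha hc, comp_swap_of_ne ha hb]

lemma swap_mem (ha : a ∈ s) (hb : b ∈ s) (hp : p ∈ s) : Equiv.swap a b p ∈ s := by
  rw [Equiv.swap_apply_def]; split_ifs <;> assumption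

lemma injOn_comp_swap (hf : Set.InjOn f s) (ha : a ∈ s) (hb : b ∈ s) :
    Set.InjOn (f ∘ Equiv.swap a b) s :=
  hf.comp (Equiv.injective _).injOn fun _ hp => swap_mem ha hb hp

lemma image_comp_swap [DecidableEq β] (f : α → β) (ha : a ∈ s) (hb : b ∈ s) :
    s.image (f ∘ Equiv.swap a b) = s.image f := by
  ext x
  simp only [Finset.mem_image, Function.comp]
  constructor
  · rintro ⟨p, hp, rfl⟩; exact ⟨_, swap_mem ha hb hp, rfl⟩
  · rintro ⟨p, hp, rfl⟩; exact ⟨_, swap_mem ha hb hp, by simp⟩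

lemma eqOn_comp_swap (ha : a ∈ s) (hb : b ∈ s) (h : Set.EqOn f g s) :
    Set.EqOn (f ∘ Equiv.swap a b) (g ∘ Equiv.swap a b) s :=
  fun _ hp => h (swap_mem ha hb hp)

lemma eqOn_of_comp_swap (ha : a ∈ s) (hb : b ∈ s)
    (h : Set.EqOn (f ∘ Equiv.swap a b) (g ∘ Equiv.swap a b) s) : Set.EqOn f g s := by
  simpa only [comp_swap_comp_swap] using eqOn_comp_swap ha hb h

end Swap

/-! ### Arc sets as functions from right-hand to left-hand endpoints -/

/-- The arc set with right-hand endpoints `R` in which the arc ending at `j` starts at `f j`. Every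
matching is of this form, and exchanging right-hand endpoints becomes precomposition of `f` with a
transposition. -/
def mkArcs (R : Finset ℕ) (f : ℕ → ℕ) : Finset (ℕ × ℕ) := R.image fun j => (f j, j)

section mkArcs

variable {R : Finset ℕ} {f g : ℕ → ℕ}

lemma mem_mkArcs {e : ℕ × ℕ} : e ∈ mkArcs R f ↔ e.2 ∈ R ∧ e.1 = f e.2 := by
  obtain ⟨x, y⟩ := e
  simp only [mkArcs, Finset.mem_image, Prod.mk.injEq]
  constructor
  · rintro ⟨j, hj, rfl, rfl⟩; exact ⟨hj, rfl⟩
  · rintro ⟨hj, rfl⟩; exact ⟨y, hj, rfl, rfl⟩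

@[simp] lemma pair_mem_mkArcs {x y : ℕ} : (x, y) ∈ mkArcs R f ↔ y ∈ R ∧ x = f y := mem_mkArcs

lemma exists_mem_mkArcs {p : ℕ × ℕ → Prop} :
    (∃ e ∈ mkArcs R f, p e) ↔ ∃ j ∈ R, p (f j, j) := by
  simp [mkArcs]

lemma forall_mem_mkArcs {p : ℕ × ℕ → Prop} :
    (∀ e ∈ mkArcs R f, p e) ↔ ∀ j ∈ R, p (f j, j) := by
  simp [mkArcs]

lemma mkArcs_congr (h : Set.EqOn f g R) : mkArcs R f = mkArcs R g :=
  Finset.image_congr fun j hj => by simp [h hj]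

lemma mkArcs_inj : mkArcs R f = mkArcs R g ↔ Set.EqOn f g R := by
  refine ⟨fun h j hj => ?_, mkArcs_congr⟩
  have : (f j, j) ∈ mkArcs R g := h ▸ pair_mem_mkArcs.2 ⟨hj, rfl⟩
  exact (pair_mem_mkArcs.1 this).2

@[simp] lemma rightEnds_mkArcs : rightEnds (mkArcs R f) = R := by
  ext j; simp [rightEnds, mkArcs]

lemma leftOf_eq {A : Finset (ℕ × ℕ)} (hA : Set.InjOn Prod.snd (A : Set (ℕ × ℕ))) {e : ℕ × ℕ}
    (he : e ∈ A) : leftOf A e.2 = e.1 := by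
  have : A.filter (fun e' => e'.2 = e.2) = {e} := by
    ext e'
    simp only [Finset.mem_filter, Finset.mem_singleton]
    exact ⟨fun ⟨he', h⟩ => hA he' he h, fun h => by subst h; exact ⟨he, rfl⟩⟩
  simp [leftOf, this]

lemma injOn_snd_mkArcs : Set.InjOn Prod.snd (mkArcs R f : Set (ℕ × ℕ)) := by
  intro e he e' he' h
  exact Prod.ext (by rw [(mem_mkArcs.1 he).2, (mem_mkArcs.1 he').2, h]) h

@[simp] lemma leftOf_mkArcs {j : ℕ} (hj : j ∈ R) : leftOf (mkArcs R f) j = f j :=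
  leftOf_eq injOn_snd_mkArcs (e := (f j, j)) (pair_mem_mkArcs.2 ⟨hj, rfl⟩)

lemma eq_mkArcs {A : Finset (ℕ × ℕ)} (hA : Set.InjOn Prod.snd (A : Set (ℕ × ℕ))) :
    A = mkArcs (rightEnds A) (leftOf A) := by
  ext e
  rw [mem_mkArcs]
  constructor
  · intro he; exact ⟨Finset.mem_image_of_mem _ he, (leftOf_eq hA he).symm⟩
  · rintro ⟨hright, hleft⟩
    obtain ⟨e', he', heq⟩ := Finset.mem_image.1 hright
    have : e = e' := Prod.ext (by rw [hleft, ← heq, leftOf_eq hA he']) heq.symm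
    exact this ▸ he'

lemma filter_mkArcs_ne (v : ℕ) :
    (mkArcs R f).filter (fun e => e.2 ≠ v) = mkArcs (R.erase v) f := by
  ext ⟨x, y⟩
  simp only [Finset.mem_filter, pair_mem_mkArcs, Finset.mem_erase]
  tauto

lemma swapArcs_mkArcs {a b : ℕ} (ha : a ∈ R) (hb : b ∈ R) (hab : a ≠ b) :
    swapArcs (mkArcs R f) a b = mkArcs R (f ∘ Equiv.swap a b) := by
  ext ⟨x, y⟩
  simp only [swapArcs, leftOf_mkArcs ha, leftOf_mkArcs hb, Finset.mem_union, Finset.mem_sdiff,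
    pair_mem_mkArcs, Finset.mem_insert, Finset.mem_singleton, Prod.mk.injEq, Function.comp]
  by_cases hya : y = a
  · subst hya; simp [ha, hab]
  · by_cases hyb : y = b
    · subst hyb; simp [hb, hya]
    · simp [hya, hyb, Equiv.swap_apply_of_ne_of_ne hya hyb]

lemma rotateArcs_mkArcs {a b c : ℕ} (ha : a ∈ R) (hb : b ∈ R) (hc : c ∈ R) (hab : a ≠ b)
    (hac : a ≠ c) (hbc : b ≠ c) :
    rotateArcs (mkArcs R f) a b c = mkArcs R (rotate f a b c) := by
  ext ⟨x, y⟩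
  simp only [rotateArcs, leftOf_mkArcs ha, leftOf_mkArcs hb, leftOf_mkArcs hc, Finset.mem_union,
    Finset.mem_sdiff, pair_mem_mkArcs, Finset.mem_insert, Finset.mem_singleton, Prod.mk.injEq]
  by_cases hya : y = a
  · subst hya; simp [rotate_left hac hbc, ha, hab, hac]
  · by_cases hyb : y = b
    · subst hyb; simp [rotate_middle hab hbc, hb, hya, hbc]
    · by_cases hyc : y = c
      · subst hyc; simp [rotate_right, hc, hya, hyb]
      · simp [rotate_of_ne hya hyb hyc, hya, hyb, hyc]

lemma largeEndsAfter_mkArcs (i j : ℕ) :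
    largeEndsAfter i (mkArcs R f) j = R.filter fun p => f p < i ∧ j < p := by
  ext p
  simp only [largeEndsAfter, Finset.mem_image, Finset.mem_filter, Prod.exists, pair_mem_mkArcs]
  constructor
  · rintro ⟨x, y, ⟨⟨hy, rfl⟩, hlarge, hjy⟩, rfl⟩; exact ⟨hy, hlarge, hjy⟩
  · rintro ⟨hp, hlarge, hjp⟩; exact ⟨_, _, ⟨⟨hp, rfl⟩, hlarge, hjp⟩, rfl⟩

end mkArcs

/-! ### The number of crossings -/

/-- The indicator of a crossing between the arcs ending at `p` and `q`, the first being the one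
that starts first. -/
def crossInd (f : ℕ → ℕ) (p q : ℕ) : ℕ := if f p < f q ∧ f q < p ∧ p < q then 1 else 0

/-- The number of crossings of `mkArcs R f`. -/
def crossNum (R : Finset ℕ) (f : ℕ → ℕ) : ℕ := ∑ p ∈ R, ∑ q ∈ R, crossInd f p q

section Crossings

variable {R : Finset ℕ} {f g : ℕ → ℕ} {a b p : ℕ}

lemma arcCr2_mkArcs (R : Finset ℕ) (f : ℕ → ℕ) : arcCr2 (mkArcs R f) = crossNum R f := by
  have hinj : Set.InjOn (fun j => (f j, j)) (R : Set ℕ) := fun _ _ _ _ h => congrArg Prod.snd h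
  rw [arcCr2, Finset.card_filter, Finset.sum_product, mkArcs, Finset.sum_image hinj]
  refine Finset.sum_congr rfl fun p _ => ?_
  rw [Finset.sum_image hinj]
  rfl

lemma crossNum_congr (h : Set.EqOn f g R) : crossNum R f = crossNum R g :=
  Finset.sum_congr rfl fun p hp => Finset.sum_congr rfl fun q hq => by
    simp only [crossInd, h hp, h hq]

lemma crossNum_insert_insert (hab : a ≠ b) (ha : a ∉ R) (hb : b ∉ R) :
    crossNum (insert a (insert b R)) f = crossNum R f + (crossInd f a b + crossInd f b a) +
      ∑ p ∈ R, ((crossInd f p a + crossInd f a p) + (crossInd f p b + crossInd f b p)) := by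
  have ha' : a ∉ insert b R := by simp [hab, ha]
  have hself : ∀ p, crossInd f p p = 0 := fun p => by simp [crossInd]
  simp only [crossNum, Finset.sum_insert ha', Finset.sum_insert hb, Finset.sum_add_distrib, hself]
  ring

lemma crossInd_add_comp_swap (hpa : p ≠ a) (hpb : p ≠ b) (hab : a < b)
    (hnest : f b < f a) (hlt : f a < a)
    (hbetween : a < p → p < b → f p < f b ∨ f a < f p) :
    (crossInd (f ∘ Equiv.swap a b) p a + crossInd (f ∘ Equiv.swap a b) a p) +
      (crossInd (f ∘ Equiv.swap a b) p b + crossInd (f ∘ Equiv.swap a b) b p) =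
    (crossInd f p a + crossInd f a p) + (crossInd f p b + crossInd f b p) := by
  simp only [crossInd, comp_swap_left, comp_swap_right, comp_swap_of_ne hpa hpb]
  rcases lt_or_gt_of_ne hpa with ha | ha <;> rcases lt_or_gt_of_ne hpb with hb | hb <;>
    simp only [ha, hb, ha.not_gt, hb.not_gt, and_true, and_false, if_false, add_zero, zero_add]
  · ring
  · split_ifs <;> omega
  · split_ifs <;> omega
  · split_ifs <;> omega

lemma crossNum_swap_of_nested (ha : a ∈ R) (hb : b ∈ R) (hab : a < b)
    (hnest : f b < f a) (hlt : f a < a)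
    (hbetween : ∀ p ∈ R, a < p → p < b → f p < f b ∨ f a < f p) :
    crossNum R (f ∘ Equiv.swap a b) = crossNum R f + 1 := by
  obtain ⟨Q, rfl, haQ, hbQ⟩ : ∃ Q, R = insert a (insert b Q) ∧ a ∉ Q ∧ b ∉ Q := by
    refine ⟨(R.erase a).erase b, ?_, by simp, by simp⟩
    rw [Finset.insert_erase (by simp [hb, hab.ne']), Finset.insert_erase ha]
  have hne : ∀ p ∈ Q, p ≠ a ∧ p ≠ b := fun p hp =>
    ⟨ne_of_mem_of_not_mem hp haQ, ne_of_mem_of_not_mem hp hbQ⟩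
  have hQ : crossNum Q (f ∘ Equiv.swap a b) = crossNum Q f :=
    crossNum_congr fun p hp => comp_swap_of_ne (hne p hp).1 (hne p hp).2
  have hpair : crossInd (f ∘ Equiv.swap a b) a b + crossInd (f ∘ Equiv.swap a b) b a = 1 ∧
      crossInd f a b + crossInd f b a = 0 := by
    simp only [crossInd, comp_swap_left, comp_swap_right]
    split_ifs <;> omega
  have hthird := Finset.sum_congr rfl fun p (hp : p ∈ Q) => by
    have hpR : p ∈ insert a (insert b Q) := by simp [hp]
    exact crossInd_add_comp_swap (hne p hp).1 (hne p hp).2 hab hnest hlt (hbetween p hpR)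
  rw [crossNum_insert_insert hab.ne haQ hbQ, crossNum_insert_insert hab.ne haQ hbQ, hQ, hthird,
    hpair.1, hpair.2]
  omega

lemma crossNum_swap_of_crossing (ha : a ∈ R) (hb : b ∈ R) (hab : a < b)
    (hcross : f a < f b) (hlt : f b < a)
    (hbetween : ∀ p ∈ R, a < p → p < b → f p < f a ∨ f b < f p) :
    crossNum R f = crossNum R (f ∘ Equiv.swap a b) + 1 := by
  have := crossNum_swap_of_nested (f := f ∘ Equiv.swap a b) ha hb hab
    (by simpa only [comp_swap_left, comp_swap_right]) (by simpa only [comp_swap_left])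
    fun p hp hap hpb => by
      simpa only [comp_swap_left, comp_swap_right, comp_swap_of_ne hap.ne' hpb.ne]
        using hbetween p hp hap hpb
  rwa [comp_swap_comp_swap] at this

end Crossings

/-! ### Matchings and rearrangements of their arcs -/

/-- `mkArcs R f` is a matching: no vertex is used twice and the arc ending at `p` starts to the
left of `p`. -/
structure IsMatching (R : Finset ℕ) (f : ℕ → ℕ) : Prop where
  injOn : Set.InjOn f R
  lt : ∀ p ∈ R, f p < p
  notMem : ∀ p ∈ R, f p ∉ R

/-- The matching `g` has the same left-hand and the same right-hand endpoints as `f`, and its large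
arcs (those that start to the left of `i`) end in the same relative order as in `f`. -/
structure IsRearrangement (i : ℕ) (R : Finset ℕ) (f g : ℕ → ℕ) : Prop where
  isMatching : IsMatching R g
  image_eq : R.image g = R.image f
  order : ∀ p ∈ R, ∀ p' ∈ R, ∀ q ∈ R, ∀ q' ∈ R, f p = g q → f p' = g q' → f p < i → f p' < i →
    p < p' → q < q'

section Rearrangement

variable {i : ℕ} {R : Finset ℕ} {f g h : ℕ → ℕ} {a b : ℕ}

lemma IsMatching.comp_swap (hf : IsMatching R f) (ha : a ∈ R) (hb : b ∈ R) (hab : f a < b)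
    (hba : f b < a) : IsMatching R (f ∘ Equiv.swap a b) where
  injOn := injOn_comp_swap hf.injOn ha hb
  lt p hp := by
    rw [comp_swap_apply]
    split_ifs with hpa hpb
    · exact hpa ▸ hba
    · exact hpb ▸ hab
    · exact hf.lt p hp
  notMem p hp := hf.notMem _ (swap_mem ha hb hp)

namespace IsRearrangement

lemma refl (hf : IsMatching R f) : IsRearrangement i R f f where
  isMatching := hf
  image_eq := rfl
  order p hp p' hp' q hq q' hq' e e' _ _ hlt := by
    rwa [← hf.injOn hp hq e, ← hf.injOn hp' hq' e']

lemma exists_right (hfg : IsRearrangement i R f g) {p : ℕ} (hp : p ∈ R) : ∃ q ∈ R, g q = f p :=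
  Finset.mem_image.1 (hfg.image_eq ▸ Finset.mem_image_of_mem f hp)

lemma exists_left (hfg : IsRearrangement i R f g) {p : ℕ} (hp : p ∈ R) : ∃ q ∈ R, f q = g p :=
  Finset.mem_image.1 (hfg.image_eq ▸ Finset.mem_image_of_mem g hp)

lemma symm (hfg : IsRearrangement i R f g) (hf : IsMatching R f) : IsRearrangement i R g f where
  isMatching := hf
  image_eq := hfg.image_eq.symm
  order p hp p' hp' q hq q' hq' e e' hi hi' hlt := by
    by_contra! hle
    rcases hle.eq_or_lt with rfl | hlt'
    · exact hlt.ne (hfg.isMatching.injOn hp hp' (e.trans e'.symm))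
    · exact lt_asymm hlt
        (hfg.order q' hq' q hq p' hp' p hp e'.symm e.symm (e' ▸ hi') (e ▸ hi) hlt')

lemma trans (hfg : IsRearrangement i R f g) (hgh : IsRearrangement i R g h) :
    IsRearrangement i R f h where
  isMatching := hgh.isMatching
  image_eq := hgh.image_eq.trans hfg.image_eq
  order p hp p' hp' q hq q' hq' e e' hi hi' hlt := by
    obtain ⟨m, hm, em⟩ := hfg.exists_right hp
    obtain ⟨m', hm', em'⟩ := hfg.exists_right hp'
    exact hgh.order m hm m' hm' q hq q' hq' (em.trans e) (em'.trans e') (em ▸ hi) (em' ▸ hi')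
      (hfg.order p hp p' hp' m hm m' hm' em.symm em'.symm hi hi' hlt)

lemma forall_ne (hfg : IsRearrangement i R f g) {x : ℕ} (hx : ∀ p ∈ R, f p ≠ x) :
    ∀ p ∈ R, g p ≠ x := by
  intro p hp
  obtain ⟨q, hq, e⟩ := hfg.exists_left hp
  exact e ▸ hx q hq

lemma comp_swap (hf : IsMatching R f) (ha : a ∈ R) (hb : b ∈ R) (hab : f a < b) (hba : f b < a)
    (hsmall : i ≤ f a)
    (hbetween : f b < i → ∀ p ∈ R, (a < p ∧ p < b) ∨ (b < p ∧ p < a) → i ≤ f p) :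
    IsRearrangement i R f (f ∘ Equiv.swap a b) where
  isMatching := hf.comp_swap ha hb hab hba
  image_eq := image_comp_swap f ha hb
  order p hp p' hp' q hq q' hq' e e' hi hi' hlt := by
    have large_move : ∀ p ∈ R, ∀ q ∈ R, f p = (f ∘ Equiv.swap a b) q → f p < i →
        p ≠ a ∧ q = if p = b then a else p := by
      intro p hp q hq e hi
      have hpa : p ≠ a := by rintro rfl; omega
      have hpq : p = Equiv.swap a b q := hf.injOn hp (swap_mem ha hb hq) e
      have hqp : q = Equiv.swap a b p := by simp [hpq]
      exact ⟨hpa, by rw [hqp, Equiv.swap_apply_def, if_neg hpa]⟩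
    obtain ⟨hpa, rfl⟩ := large_move p hp q hq e hi
    obtain ⟨hpa', rfl⟩ := large_move p' hp' q' hq' e' hi'
    split_ifs with hpb hpb' hpb'
    · omega
    · subst hpb
      have := fun h => hbetween hi p' hp' (Or.inr h)
      omega
    · subst hpb'
      have := fun h => hbetween hi' p hp (Or.inl h)
      omega
    · exact hlt

end IsRearrangement

end Rearrangement

/-! ### One round of the first algorithm -/

/-- `b` is `i` or a right-hand endpoint to the right of `i`: the vertex where the first algorithm
stops and the second one starts. -/
structure Barrier (i b : ℕ) (R : Finset ℕ) : Prop where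
  notMem : i ∉ R
  le : i ≤ b
  mem : b = i ∨ b ∈ R

/-- The left-hand endpoint `x > b` adjoins `b`: there is no right-hand endpoint between them. -/
def Adjoins (b : ℕ) (R : Finset ℕ) (x : ℕ) : Prop := b < x ∧ ∀ r ∈ R, b < r → x ≤ r

/-- The left-hand endpoint `x > b` is high: there is a right-hand endpoint between `b` and `x`. -/
def High (b : ℕ) (R : Finset ℕ) (x : ℕ) : Prop := b < x ∧ ∃ r ∈ R, b < r ∧ r < x

/-- The first large arc to the right of `j` ends at `m`. -/
def IsNextLarge (i : ℕ) (R : Finset ℕ) (f : ℕ → ℕ) (j m : ℕ) : Prop :=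
  m ∈ R ∧ j < m ∧ f m < i ∧ ∀ p ∈ R, j < p → p < m → i ≤ f p

/-- Among the arcs ending to the right of `j` and starting to the left of `b`, the one that ends
first is large, if there are any. -/
def FirstLarge (i b : ℕ) (R : Finset ℕ) (f : ℕ → ℕ) (j : ℕ) : Prop :=
  ∀ p ∈ R, j < p → f p < b → ∃ p' ∈ R, j < p' ∧ p' ≤ p ∧ f p' < i

/-- Among the arcs ending to the right of `j` and starting to the left of `b`, the one that ends
first is small and ends at `m`. -/
def FirstLow (i b : ℕ) (R : Finset ℕ) (f : ℕ → ℕ) (j m : ℕ) : Prop :=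
  m ∈ R ∧ j < m ∧ i < f m ∧ f m < b ∧ ∀ p ∈ R, j < p → p < m → b < f p

/-- `j` is the last element of `R` before `cur`, and lies to the right of `b`. -/
structure IsPrev (R : Finset ℕ) (b cur j : ℕ) : Prop where
  mem : j ∈ R
  gt : b < j
  lt : j < cur
  le_of_gt : ∀ p ∈ R, j < p → cur ≤ p

/-- One round of the first algorithm as a relation between left-end functions: the pointers are at
`j` and `j'`, and the first pointer ends up at the last argument. The existence of a right-hand
endpoint between the two left-hand endpoints, on which the algorithm branches, amounts to `f j'` not
adjoining `b`, because `f j` always adjoins `b`. -/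
inductive StepI (i b : ℕ) (R : Finset ℕ) : (ℕ → ℕ) → ℕ → ℕ → (ℕ → ℕ) → ℕ → Prop
  | large {f : ℕ → ℕ} {j j' : ℕ} : f j' < i → StepI i b R f j j' (f ∘ Equiv.swap j j') j'
  | adjoins {f : ℕ → ℕ} {j j' : ℕ} : Adjoins b R (f j') → StepI i b R f j j' f j'
  | high {f : ℕ → ℕ} {j j' : ℕ} : High b R (f j') → StepI i b R f j j' f j
  | low {f : ℕ → ℕ} {j j' m : ℕ} : i < f j' → f j' < b → IsNextLarge i R f j m →
      StepI i b R f j j' (rotate f j j' m) j'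

/-- The invariant of the first algorithm: `j` is the first pointer and the vertices from `cur` on
have been processed. -/
structure InvariantI (i b : ℕ) (R : Finset ℕ) (f : ℕ → ℕ) (j cur : ℕ) : Prop where
  barrier : Barrier i b R
  isMatching : IsMatching R f
  ne : ∀ p ∈ R, f p ≠ i
  mem : j ∈ R
  lt_cur : b < cur
  cur_le : cur ≤ j
  adjoins : Adjoins b R (f j)
  high : ∀ p ∈ R, cur ≤ p → p < j → High b R (f p)
  firstLarge : FirstLarge i b R f j
  exists_large_of_low : ∀ p ∈ R, p < cur → i < f p → f p < b → ∃ p' ∈ R, p < p' ∧ f p' < i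

section StepI

variable {i b x y m m' j j' k cur p : ℕ} {R : Finset ℕ} {f f' g g' : ℕ → ℕ}

lemma Barrier.left_ne (hb : Barrier i b R) (hf : IsMatching R f) (hi : ∀ p ∈ R, f p ≠ i)
    (hp : p ∈ R) : f p ≠ b := by
  rcases hb.mem with rfl | hbR
  · exact hi p hp
  · exact ne_of_mem_of_not_mem hbR (hf.notMem p hp) |>.symm

lemma Adjoins.not_high (hx : Adjoins b R x) : ¬ High b R x := by
  rintro ⟨_, r, hr, hbr, hrx⟩
  exact (hx.2 r hr hbr).not_gt hrx

lemma not_high_of_le (hx : x ≤ b) : ¬ High b R x := fun h => hx.not_gt h.1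

lemma adjoins_or_high (hx : b < x) : Adjoins b R x ∨ High b R x := by
  by_cases hr : ∃ r ∈ R, b < r ∧ r < x
  · exact Or.inr ⟨hx, hr⟩
  · push Not at hr
    exact Or.inl ⟨hx, hr⟩

lemma Adjoins.lt_high (hx : Adjoins b R x) (hy : High b R y) : x < y := by
  obtain ⟨_, r, hr, hbr, hry⟩ := hy
  exact (hx.2 r hr hbr).trans_lt hry

lemma high_comp_swap_iff (hx : ¬ High b R (f x)) (hy : ¬ High b R (f y)) :
    High b R ((f ∘ Equiv.swap x y) p) ↔ High b R (f p) := by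
  rw [comp_swap_apply]
  split_ifs with hpx hpy
  · subst hpx; simp only [hx, hy]
  · subst hpy; simp only [hx, hy]
  · rfl

lemma largeEndsAfter_nonempty (hp : p ∈ R) (hjp : j < p) (hlarge : f p < i) :
    (largeEndsAfter i (mkArcs R f) j).Nonempty :=
  ⟨p, by simp [largeEndsAfter_mkArcs, hp, hjp, hlarge]⟩

lemma isNextLarge_min' (h : (largeEndsAfter i (mkArcs R f) j).Nonempty) :
    IsNextLarge i R f j ((largeEndsAfter i (mkArcs R f) j).min' h) := by
  have mem_iff : ∀ p, p ∈ largeEndsAfter i (mkArcs R f) j ↔ p ∈ R ∧ f p < i ∧ j < p := fun p => by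
    rw [largeEndsAfter_mkArcs, Finset.mem_filter]
  obtain ⟨hm, hlarge, hjm⟩ := (mem_iff _).1 (Finset.min'_mem _ h)
  refine ⟨hm, hjm, hlarge, fun p hp hjp hpm => ?_⟩
  by_contra! hlarge'
  exact (Finset.min'_le _ p ((mem_iff p).2 ⟨hp, hlarge', hjp⟩)).not_gt hpm

lemma FirstLarge.congr (h : FirstLarge i b R g j) (e : Set.EqOn g g' R) :
    FirstLarge i b R g' j := by
  intro p hp hjp hpb
  obtain ⟨p', hp', hjp', hle, hlarge⟩ := h p hp hjp (by rwa [e hp])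
  exact ⟨p', hp', hjp', hle, by rwa [← e hp']⟩

lemma FirstLow.congr (h : FirstLow i b R g j m) (e : Set.EqOn g g' R) : FirstLow i b R g' j m := by
  obtain ⟨hm, hjm, him, hmb, hbetween⟩ := h
  exact ⟨hm, hjm, e hm ▸ him, e hm ▸ hmb, fun p hp hjp hpm => e hp ▸ hbetween p hp hjp hpm⟩

lemma FirstLarge.not_firstLow (h : FirstLarge i b R g j) : ¬ FirstLow i b R g j m := by
  rintro ⟨hm, hjm, him, hmb, hbetween⟩
  obtain ⟨p, hp, hjp, hpm, hlarge⟩ := h m hm hjm hmb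
  rcases eq_or_lt_of_le hpm with rfl | hpm
  · exact lt_asymm him hlarge
  · exact absurd (hbetween p hp hjp hpm) (hlarge.trans (him.trans hmb)).not_gt

lemma FirstLarge.lt_left_of_isNextLarge (h : FirstLarge i b R g j) (hne : ∀ p ∈ R, g p ≠ b)
    (hm : IsNextLarge i R g j m) : ∀ p ∈ R, j < p → p < m → b < g p := by
  intro p hp hjp hpm
  by_contra! hpb
  obtain ⟨p', hp', hjp', hle, hlarge⟩ := h p hp hjp (hpb.lt_of_ne (hne p hp))
  exact (hm.2.2.2 p' hp' hjp' (hle.trans_lt hpm)).not_gt hlarge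

lemma FirstLow.unique (h : FirstLow i b R g j m) (h' : FirstLow i b R g j m') : m = m' := by
  obtain ⟨hm, hjm, -, hmb, hbetween⟩ := h
  obtain ⟨hm', hjm', -, hmb', hbetween'⟩ := h'
  rcases lt_trichotomy m m' with hlt | heq | hgt
  · exact absurd (hbetween' m hm hjm hlt) hmb.not_gt
  · exact heq
  · exact absurd (hbetween m' hm' hjm' hgt) hmb'.not_gt

namespace InvariantI

lemma ne_barrier (hI : InvariantI i b R f j cur) (hp : p ∈ R) : f p ≠ b :=
  hI.barrier.left_ne hI.isMatching hI.ne hp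

lemma le_left (hI : InvariantI i b R f j cur) : i ≤ f j :=
  hI.barrier.le.trans hI.adjoins.1.le

lemma left_lt (hI : InvariantI i b R f j cur) (hp : p ∈ R) (hbp : b < p) : f j < p :=
  lt_of_le_of_ne (hI.adjoins.2 p hp hbp) fun e => hI.isMatching.notMem j hI.mem (e ▸ hp)

lemma prev_lt (hI : InvariantI i b R f j cur) (hj' : IsPrev R b cur j') : j' < j :=
  hj'.lt.trans_le hI.cur_le

lemma left_prev_lt (hI : InvariantI i b R f j cur) (hj' : IsPrev R b cur j') : f j' < j :=
  (hI.isMatching.lt j' hj'.mem).trans (hI.prev_lt hj')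

lemma high_between (hI : InvariantI i b R f j cur) (hj' : IsPrev R b cur j') :
    ∀ p ∈ R, j' < p → p < j → High b R (f p) :=
  fun p hp hgt => hI.high p hp (hj'.le_of_gt p hp hgt)

lemma exists_large (hI : InvariantI i b R f j cur) (hj' : IsPrev R b cur j') (hsmall : i < f j')
    (hlow : f j' < b) : ∃ p ∈ R, j < p ∧ f p < i := by
  obtain ⟨p, hp, hgt, hlarge⟩ := hI.exists_large_of_low j' hj'.mem hj'.lt hsmall hlow
  refine ⟨p, hp, ?_, hlarge⟩
  by_contra! hpj
  have hpb := hlarge.trans_le hI.barrier.le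
  rcases hpj.eq_or_lt with rfl | hpj
  · exact hpb.not_gt hI.adjoins.1
  · exact hpb.not_gt (hI.high_between hj' p hp hgt hpj).1

lemma lt_left_of_isNextLarge (hI : InvariantI i b R f j cur) (hm : IsNextLarge i R f j m) :
    ∀ p ∈ R, j < p → p < m → b < f p :=
  hI.firstLarge.lt_left_of_isNextLarge (fun _ => hI.ne_barrier) hm

lemma isRearrangement_swap (hI : InvariantI i b R f j cur) (hj' : IsPrev R b cur j') :
    IsRearrangement i R f (f ∘ Equiv.swap j j') := by
  have hjj := hI.prev_lt hj'
  refine .comp_swap hI.isMatching hI.mem hj'.mem (hI.left_lt hj'.mem hj'.gt) (hI.left_prev_lt hj')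
    hI.le_left fun _ p hp hbetween => ?_
  exact hI.barrier.le.trans (hI.high_between hj' p hp (by omega) (by omega)).1.le

lemma isRearrangement_rotate (hI : InvariantI i b R f j cur) (hj' : IsPrev R b cur j')
    (hsmall : i < f j') (hm : IsNextLarge i R f j m) :
    IsRearrangement i R f (rotate f j j' m) := by
  obtain ⟨hmR, hjm, hlarge, hbetween⟩ := hm
  have hjj := hI.prev_lt hj'
  have hlt := hI.left_prev_lt hj'
  have hswap_m : (f ∘ Equiv.swap j j') m = f m := comp_swap_of_ne hjm.ne' (by omega)
  refine (hI.isRearrangement_swap hj').trans (.comp_swap (hI.isRearrangement_swap hj').isMatching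
    hI.mem hmR ?_ ?_ ?_ fun _ p hp hjpm => ?_)
  · rw [comp_swap_left]; omega
  · rw [hswap_m]; omega
  · rw [comp_swap_left]; exact hsmall.le
  · rw [comp_swap_of_ne (by omega) (by omega)]
    exact hbetween p hp (by omega) (by omega)

lemma crossNum_swap (hI : InvariantI i b R f j cur) (hj' : IsPrev R b cur j') (hlow : f j' < b) :
    crossNum R f = crossNum R (f ∘ Equiv.swap j j') + 1 := by
  rw [Equiv.swap_comm]
  exact crossNum_swap_of_crossing hj'.mem hI.mem (hI.prev_lt hj')
    (hlow.trans hI.adjoins.1) (hI.left_lt hj'.mem hj'.gt) fun p hp hgt hlt =>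
      Or.inr (hI.adjoins.lt_high (hI.high_between hj' p hp hgt hlt))

lemma crossNum_rotate (hI : InvariantI i b R f j cur) (hj' : IsPrev R b cur j')
    (hsmall : i < f j') (hlow : f j' < b) (hm : IsNextLarge i R f j m) :
    crossNum R (rotate f j j' m) = crossNum R f := by
  have hjj := hI.prev_lt hj'
  have hbetween := hI.lt_left_of_isNextLarge hm
  obtain ⟨hmR, hjm, hlarge, -⟩ := hm
  have hswap_m : (f ∘ Equiv.swap j j') m = f m := comp_swap_of_ne hjm.ne' (by omega)
  rw [hI.crossNum_swap hj' hlow, rotate]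
  refine crossNum_swap_of_nested hI.mem hmR hjm ?_ ?_
    fun p hp hjp hpm => ?_
  · rw [hswap_m, comp_swap_left]; exact hlarge.trans hsmall
  · rw [comp_swap_left]; exact hI.left_prev_lt hj'
  · rw [comp_swap_left, comp_swap_of_ne (p := p) (by omega) (by omega)]
    exact Or.inr (hlow.trans (hbetween p hp hjp hpm))

lemma move_of_large (hI : InvariantI i b R f j cur) (hj' : IsPrev R b cur j')
    (hfg : IsRearrangement i R f g) (hadj : Adjoins b R (g j')) (hlarge : g j < i)
    (hbetween : ∀ p ∈ R, j' < p → p < j → g p = f p) : InvariantI i b R g j' j' where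
  barrier := hI.barrier
  isMatching := hfg.isMatching
  ne := hfg.forall_ne hI.ne
  mem := hj'.mem
  lt_cur := hj'.gt
  cur_le := le_rfl
  adjoins := hadj
  high p _ hle hlt := absurd hlt hle.not_gt
  firstLarge p hp hgt hpb := by
    refine ⟨j, hI.mem, hI.prev_lt hj', ?_, hlarge⟩
    by_contra! hpj
    rw [hbetween p hp hgt hpj] at hpb
    exact lt_asymm hpb (hI.high_between hj' p hp hgt hpj).1
  exists_large_of_low p _ hlt _ _ := ⟨j, hI.mem, hlt.trans (hI.prev_lt hj'), hlarge⟩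

lemma move_of_adjoins (hI : InvariantI i b R f j cur) (hj' : IsPrev R b cur j')
    (hadj : Adjoins b R (f j')) : InvariantI i b R f j' j' where
  barrier := hI.barrier
  isMatching := hI.isMatching
  ne := hI.ne
  mem := hj'.mem
  lt_cur := hj'.gt
  cur_le := le_rfl
  adjoins := hadj
  high p _ hle hlt := absurd hlt hle.not_gt
  firstLarge p hp hgt hpb := by
    rcases lt_trichotomy p j with hpj | rfl | hjp
    · exact absurd (hI.high_between hj' p hp hgt hpj).1 hpb.not_gt
    · exact absurd hI.adjoins.1 hpb.not_gt
    · obtain ⟨p', hp', hjp', hle, hlarge⟩ := hI.firstLarge p hp hjp hpb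
      exact ⟨p', hp', (hI.prev_lt hj').trans hjp', hle, hlarge⟩
  exists_large_of_low p hp hlt := hI.exists_large_of_low p hp (hlt.trans hj'.lt)

lemma stay_of_high (hI : InvariantI i b R f j cur) (hj' : IsPrev R b cur j')
    (hhigh : High b R (f j')) : InvariantI i b R f j j' where
  barrier := hI.barrier
  isMatching := hI.isMatching
  ne := hI.ne
  mem := hI.mem
  lt_cur := hj'.gt
  cur_le := (hI.prev_lt hj').le
  adjoins := hI.adjoins
  high p hp hle hlt := by
    rcases hle.eq_or_lt with rfl | hgt
    · exact hhigh
    · exact hI.high_between hj' p hp hgt hlt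
  firstLarge := hI.firstLarge
  exists_large_of_low p hp hlt := hI.exists_large_of_low p hp (hlt.trans hj'.lt)

end InvariantI

namespace StepI

lemma isRearrangement (hs : StepI i b R f j j' g k) (hI : InvariantI i b R f j cur)
    (hj' : IsPrev R b cur j') : IsRearrangement i R f g := by
  cases hs with
  | large _ => exact hI.isRearrangement_swap hj'
  | adjoins _ | high _ => exact .refl hI.isMatching
  | low hsmall _ hm => exact hI.isRearrangement_rotate hj' hsmall hm

lemma invariantI (hs : StepI i b R f j j' g k) (hI : InvariantI i b R f j cur)
    (hj' : IsPrev R b cur j') : InvariantI i b R g k j' := by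
  have hjj := hI.prev_lt hj'
  have hre := hs.isRearrangement hI hj'
  cases hs with
  | large hlarge =>
    refine hI.move_of_large hj' hre ?_ ?_ fun p _ hgt hlt => comp_swap_of_ne hlt.ne hgt.ne'
    · rw [comp_swap_right]; exact hI.adjoins
    · rwa [comp_swap_left]
  | adjoins hadj => exact hI.move_of_adjoins hj' hadj
  | high hhigh => exact hI.stay_of_high hj' hhigh
  | @low m _ _ hm =>
    obtain ⟨-, hjm, hlarge, -⟩ := hm
    have hjm' : j' ≠ m := by omega
    refine hI.move_of_large hj' hre ?_ ?_ fun p _ hgt hlt =>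
      rotate_of_ne hlt.ne hgt.ne' (hlt.trans hjm).ne
    · rw [rotate_middle hjj.ne' hjm']; exact hI.adjoins
    · rwa [rotate_left hjm.ne hjm']

lemma apply_of_lt (hs : StepI i b R f j j' g k) (hjj : j' < j) (hp : p < j') : g p = f p := by
  cases hs with
  | large _ => exact comp_swap_of_ne (by omega) (by omega)
  | adjoins _ | high _ => rfl
  | low _ _ hm => exact rotate_of_ne (by omega) (by omega) (by have := hm.2.1; omega)

lemma high_iff (hs : StepI i b R f j j' g k) (hI : InvariantI i b R f j cur)
    (hj' : IsPrev R b cur j') : High b R (g p) ↔ High b R (f p) := by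
  have hib := hI.barrier.le
  have hj_not := hI.adjoins.not_high
  cases hs with
  | large hlarge => exact high_comp_swap_iff hj_not (not_high_of_le (by omega))
  | adjoins _ | high _ => rfl
  | @low m _ hlow hm =>
    obtain ⟨-, hjm, hlarge, -⟩ := hm
    have hjj := hI.prev_lt hj'
    have hj'_not : ¬ High b R (f j') := not_high_of_le hlow.le
    have hm_not : ¬ High b R (f m) := not_high_of_le (by omega)
    rw [rotate, high_comp_swap_iff, high_comp_swap_iff hj_not hj'_not]
    · rwa [comp_swap_left]
    · rwa [comp_swap_of_ne hjm.ne' (by omega)]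

lemma crossNum_eq (hs : StepI i b R f j j' g k) (hI : InvariantI i b R f j cur)
    (hj' : IsPrev R b cur j') : crossNum R f = crossNum R g + if f j' < i then 1 else 0 := by
  have hib := hI.barrier.le
  cases hs with
  | large hlarge =>
    rw [if_pos hlarge]
    exact hI.crossNum_swap hj' (hlarge.trans_le hib)
  | adjoins hadj => rw [if_neg (hib.trans hadj.1.le).not_gt, add_zero]
  | high hhigh => rw [if_neg (hib.trans hhigh.1.le).not_gt, add_zero]
  | low hsmall hlow hm =>
    rw [if_neg hsmall.not_gt, add_zero, hI.crossNum_rotate hj' hsmall hlow hm]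

end StepI

lemma exists_stepI_of_low (hI : InvariantI i b R f j cur) (hj' : IsPrev R b cur j')
    (hsmall : i < f j') (hlow : f j' < b) :
    ∃ g k, StepI i b R f j j' g k ∧ stepI i (mkArcs R f, j) j' = (mkArcs R g, k) := by
  have hjj := hI.prev_lt hj'
  obtain ⟨p, hp, hjp, hlarge⟩ := hI.exists_large hj' hsmall hlow
  have hne := largeEndsAfter_nonempty hp hjp hlarge
  have hm := isNextLarge_min' hne
  refine ⟨_, _, .low hsmall hlow hm, ?_⟩
  have hlt : f j' < f j := hlow.trans hI.adjoins.1
  have hbR : b ∈ R := hI.barrier.mem.resolve_left (hsmall.trans hlow).ne'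
  have hbetween : ∃ r ∈ R, min (f j) (f j') < r ∧ r < max (f j) (f j') :=
    ⟨b, hbR, by rwa [min_eq_right hlt.le], by rw [max_eq_left hlt.le]; exact hI.adjoins.1⟩
  simp only [stepI, leftOf_mkArcs hj'.mem, leftOf_mkArcs hI.mem, rightEnds_mkArcs,
    if_neg hsmall.not_gt, hbetween, not_true, if_false, if_neg hlt.not_gt, dif_pos hne]
  rw [rotateArcs_mkArcs hI.mem hj'.mem hm.1 hjj.ne' hm.2.1.ne (hjj.trans hm.2.1).ne]

lemma exists_stepI (hI : InvariantI i b R f j cur) (hj' : IsPrev R b cur j') :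
    ∃ g k, StepI i b R f j j' g k ∧ stepI i (mkArcs R f, j) j' = (mkArcs R g, k) := by
  have := hI.le_left
  obtain ⟨hbj, hadj⟩ := hI.adjoins
  by_cases hlarge : f j' < i
  · refine ⟨_, _, .large hlarge, ?_⟩
    simp [stepI, hj'.mem, hlarge, swapArcs_mkArcs hI.mem hj'.mem (hI.prev_lt hj').ne']
  have hsmall : i < f j' := lt_of_le_of_ne (not_lt.1 hlarge) (hI.ne j' hj'.mem).symm
  rcases lt_or_gt_of_ne (hI.ne_barrier hj'.mem) with hlow | hgt
  · exact exists_stepI_of_low hI hj' hsmall hlow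
  rcases adjoins_or_high (R := R) hgt with hadj' | hhigh
  · refine ⟨_, _, .adjoins hadj', ?_⟩
    have hempty : ¬ ∃ r ∈ R, min (f j) (f j') < r ∧ r < max (f j) (f j') := by
      rintro ⟨r, hr, hmin, hmax⟩
      have hj := hadj r hr (by omega)
      have hj' := hadj'.2 r hr (by omega)
      omega
    simp only [stepI, leftOf_mkArcs hj'.mem, leftOf_mkArcs hI.mem, rightEnds_mkArcs,
      if_neg hlarge, hempty, not_false_eq_true, if_true]
  · refine ⟨_, _, .high hhigh, ?_⟩
    have hlt := hI.adjoins.lt_high hhigh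
    have hbetween : ∃ r ∈ R, min (f j) (f j') < r ∧ r < max (f j) (f j') := by
      obtain ⟨_, r, hr, hbr, hrj'⟩ := hhigh
      have hjr := hI.left_lt hr hbr
      exact ⟨r, hr, by omega, by omega⟩
    simp only [stepI, leftOf_mkArcs hj'.mem, leftOf_mkArcs hI.mem, rightEnds_mkArcs,
      if_neg hlarge, hbetween, not_true, if_false, if_pos hlt]

namespace StepI

lemma eq_or_eq (hs : StepI i b R f j j' g k) : (k = j ∧ g = f) ∨ k = j' := by
  cases hs with
  | high _ => exact Or.inl ⟨rfl, rfl⟩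
  | large _ | adjoins _ | low _ _ _ => exact Or.inr rfl

lemma preimage_cases (hs : StepI i b R f j j' g j') (hI : InvariantI i b R f j cur)
    (hj' : IsPrev R b cur j') :
    (b < g j ∧ f = g) ∨
    (g j < i ∧ f = g ∘ Equiv.swap j j' ∧ FirstLarge i b R g j) ∨
    (g j < i ∧ ∃ m, FirstLow i b R g j m ∧ f = (g ∘ Equiv.swap j m) ∘ Equiv.swap j j') := by
  have hjj := hI.prev_lt hj'
  cases hs with
  | large hlarge =>
    refine Or.inr (Or.inl ⟨by rwa [comp_swap_left], (comp_swap_comp_swap _ _ _).symm, ?_⟩)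
    intro p hp hjp hpb
    rw [comp_swap_of_ne hjp.ne' (by omega)] at hpb
    obtain ⟨p', hp', hjp', hle, hlarge'⟩ := hI.firstLarge p hp hjp hpb
    exact ⟨p', hp', hjp', hle, by rwa [comp_swap_of_ne hjp'.ne' (by omega)]⟩
  | adjoins _ | high _ => exact Or.inl ⟨hI.adjoins.1, rfl⟩
  | @low m hsmall hlow hm =>
    have hbetween := hI.lt_left_of_isNextLarge hm
    obtain ⟨hmR, hjm, hlarge, -⟩ := hm
    refine Or.inr (Or.inr ⟨?_, m, ⟨hmR, hjm, ?_, ?_, fun p hp hjp hpm => ?_⟩, ?_⟩)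
    · rwa [rotate_left hjm.ne (by omega)]
    · rwa [rotate_right]
    · rwa [rotate_right]
    · rw [rotate_of_ne hjp.ne' (by omega) hpm.ne]
      exact hbetween p hp hjp hpm
    · rw [rotate, comp_swap_comp_swap, comp_swap_comp_swap]

-- The old pointer is recovered as the first vertex after `x` whose arc is not high.
lemma pointer_le (hs : StepI i b R f j x g x) (hs' : StepI i b R f' j' x g' x)
    (hI : InvariantI i b R f j cur) (hI' : InvariantI i b R f' j' cur) (hx : IsPrev R b cur x)
    (e : Set.EqOn g g' R) : j ≤ j' := by
  by_contra! hlt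
  have hhigh := (hs.high_iff hI hx).2 (hI.high_between hx j' hI'.mem (hI'.prev_lt hx) hlt)
  rw [e hI'.mem, hs'.high_iff hI' hx] at hhigh
  exact hI'.adjoins.not_high hhigh

lemma injective (hs : StepI i b R f j x g k) (hs' : StepI i b R f' j' x g' k)
    (hI : InvariantI i b R f j cur) (hI' : InvariantI i b R f' j' cur) (hx : IsPrev R b cur x)
    (e : Set.EqOn g g' R) : Set.EqOn f f' R ∧ j = j' := by
  have hjx := hI.prev_lt hx
  have hjx' := hI'.prev_lt hx
  rcases hs.eq_or_eq with ⟨rfl, rfl⟩ | rfl <;> rcases hs'.eq_or_eq with ⟨hk, hg⟩ | hk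
  · exact ⟨hg ▸ e, hk⟩
  · omega
  · omega
  obtain rfl : j = j' :=
    (hs.pointer_le hs' hI hI' hx e).antisymm (hs'.pointer_le hs hI' hI hx e.symm)
  refine ⟨?_, rfl⟩
  have hj := e hI.mem
  have hib := hI.barrier.le
  rcases hs.preimage_cases hI hx with ⟨hb, rfl⟩ | ⟨hi, rfl, hfirst⟩ | ⟨hi, m, hfirst, rfl⟩ <;>
  rcases hs'.preimage_cases hI' hx with ⟨hb', rfl⟩ | ⟨hi', rfl, hfirst'⟩ | ⟨hi', m', hfirst', rfl⟩
  · exact e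
  · omega
  · omega
  · omega
  · exact eqOn_comp_swap hI.mem hx.mem e
  · exact absurd hfirst' (hfirst.congr e).not_firstLow
  · omega
  · exact absurd (hfirst.congr e) hfirst'.not_firstLow
  · obtain rfl := (hfirst.congr e).unique hfirst'
    exact eqOn_comp_swap hI.mem hx.mem (eqOn_comp_swap hI.mem hfirst.1 e)

end StepI

end StepI

/-! ### Runs of the first algorithm -/

/-- `l` lists the elements of `R` strictly between `b` and `cur` in decreasing order. -/
structure IsDescEnum (R : Finset ℕ) (b cur : ℕ) (l : List ℕ) : Prop where
  pairwise : l.Pairwise (· > ·)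
  mem_iff : ∀ {p}, p ∈ l ↔ p ∈ R ∧ b < p ∧ p < cur

/-- The rounds of the first algorithm along a list of positions of the second pointer, as a relation
between left-end functions together with positions of the first pointer. -/
inductive FoldI (i b : ℕ) (R : Finset ℕ) : (ℕ → ℕ) → ℕ → List ℕ → (ℕ → ℕ) → ℕ → Prop
  | nil {f : ℕ → ℕ} {j : ℕ} : FoldI i b R f j [] f j
  | cons {f g h : ℕ → ℕ} {j j' k m : ℕ} {l : List ℕ} : StepI i b R f j j' g k →
      FoldI i b R g k l h m → FoldI i b R f j (j' :: l) h m

namespace IsDescEnum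

variable {R : Finset ℕ} {b cur x : ℕ} {l l' : List ℕ}

lemma nodup (h : IsDescEnum R b cur l) : l.Nodup := h.pairwise.imp fun hgt => hgt.ne'

lemma isPrev (h : IsDescEnum R b cur (x :: l)) : IsPrev R b cur x := by
  obtain ⟨hx, hbx, hlt⟩ := h.mem_iff.1 List.mem_cons_self
  refine ⟨hx, hbx, hlt, fun p hp hxp => ?_⟩
  by_contra! hpcur
  rcases List.mem_cons.1 (h.mem_iff.2 ⟨hp, hbx.trans hxp, hpcur⟩) with rfl | hpl
  · exact lt_irrefl _ hxp
  · exact lt_asymm hxp ((List.pairwise_cons.1 h.pairwise).1 p hpl)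

lemma tail (h : IsDescEnum R b cur (x :: l)) : IsDescEnum R b x l := by
  obtain ⟨hhead, hpairwise⟩ := List.pairwise_cons.1 h.pairwise
  refine ⟨hpairwise, fun {p} => ⟨fun hp => ?_, fun ⟨hp, hbp, hpx⟩ => ?_⟩⟩
  · obtain ⟨hpR, hbp, -⟩ := h.mem_iff.1 (List.mem_cons_of_mem x hp)
    exact ⟨hpR, hbp, hhead p hp⟩
  · exact (List.mem_cons.1 (h.mem_iff.2 ⟨hp, hbp, hpx.trans h.isPrev.lt⟩)).resolve_left hpx.ne

lemma le_of_nil (h : IsDescEnum R b cur []) {p : ℕ} (hp : p ∈ R) (hbp : b < p) : cur ≤ p := by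
  by_contra! hlt
  exact List.not_mem_nil (h.mem_iff.2 ⟨hp, hbp, hlt⟩)

protected lemma sort (R : Finset ℕ) (b cur : ℕ) :
    IsDescEnum R b cur ((R.filter fun p => b < p ∧ p < cur).sort (· ≥ ·)) :=
  ⟨(Finset.sortedGT_sort _).pairwise, by simp⟩

lemma unique (h : IsDescEnum R b cur l) (h' : IsDescEnum R b cur l') : l = l' :=
  ((List.perm_ext_iff_of_nodup h.nodup h'.nodup).2 fun p => by rw [h.mem_iff, h'.mem_iff])
    |>.eq_of_pairwise (fun _ _ _ _ hgt hlt => absurd hgt (lt_asymm hlt)) h.pairwise h'.pairwise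

lemma countP_eq (h : IsDescEnum R b cur l) (P : ℕ → Prop) [DecidablePred P] :
    l.countP (P ·) = (R.filter fun p => (b < p ∧ p < cur) ∧ P p).card := by
  rw [List.countP_eq_length_filter, ← List.toFinset_card_of_nodup (h.nodup.filter _)]
  congr 1
  ext p
  simp [h.mem_iff, and_assoc]

lemma append {q : ℕ} (h : IsDescEnum R b cur l) (h' : IsDescEnum R cur q l') (hcur : cur ∈ R)
    (hlt : b < cur) (hcurq : cur < q) : IsDescEnum R b q (l' ++ cur :: l) := by
  constructor
  · rw [List.pairwise_append, List.pairwise_cons]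
    refine ⟨h'.pairwise, ⟨fun p hp => (h.mem_iff.1 hp).2.2, h.pairwise⟩, fun p hp p' hp' => ?_⟩
    have hp := (h'.mem_iff.1 hp).2.1
    rcases List.mem_cons.1 hp' with rfl | hp'
    · exact hp
    · exact (h.mem_iff.1 hp').2.2.trans hp
  · intro p
    rw [List.mem_append, List.mem_cons, h.mem_iff, h'.mem_iff]
    rcases lt_trichotomy p cur with hp | rfl | hp
    · simp [hp, hp.ne, hp.not_gt, hp.trans hcurq]
    · simp [hcur, hlt, hcurq]
    · simp [hp, hp.ne', hp.not_gt, hlt.trans hp]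

end IsDescEnum

section FoldI

variable {i b : ℕ} {R : Finset ℕ} {f f' g g' : ℕ → ℕ} {j j' k cur p : ℕ} {l : List ℕ}

lemma exists_foldI (hI : InvariantI i b R f j cur) (hl : IsDescEnum R b cur l) :
    ∃ g k, FoldI i b R f j l g k ∧ l.foldl (stepI i) (mkArcs R f, j) = (mkArcs R g, k) := by
  induction l generalizing f j cur with
  | nil => exact ⟨f, j, .nil, rfl⟩
  | cons x l ih =>
    obtain ⟨g, k, hs, hstep⟩ := exists_stepI hI hl.isPrev
    obtain ⟨h, m, hr, hfold⟩ := ih (hs.invariantI hI hl.isPrev) hl.tail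
    exact ⟨h, m, .cons hs hr, by rw [List.foldl_cons, hstep, hfold]⟩

lemma InvariantI.isLeast (hI : InvariantI i b R g k cur) (hcur : ∀ p ∈ R, b < p → cur ≤ p) :
    IsLeast {p | p ∈ R ∧ b < p} k := by
  refine ⟨⟨hI.mem, hI.lt_cur.trans_le hI.cur_le⟩, fun p ⟨hp, hbp⟩ => ?_⟩
  induction p using Nat.strong_induction_on with
  | _ p ih =>
    by_contra! hpk
    obtain ⟨_, r, hr, hbr, hrp⟩ := hI.high p hp (hcur p hp hbp) hpk
    have hrp := hrp.trans (hI.isMatching.lt p hp)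
    exact (ih r hrp ⟨hr, hbr⟩ hr hbr).not_gt (hrp.trans hpk)

namespace FoldI

lemma invariantI (hr : FoldI i b R f j l g k) (hI : InvariantI i b R f j cur)
    (hl : IsDescEnum R b cur l) :
    ∃ cur, InvariantI i b R g k cur ∧ ∀ p ∈ R, b < p → cur ≤ p := by
  induction hr generalizing cur with
  | nil => exact ⟨cur, hI, fun p => hl.le_of_nil⟩
  | cons hs _ ih => exact ih (hs.invariantI hI hl.isPrev) hl.tail

lemma isLeast (hr : FoldI i b R f j l g k) (hI : InvariantI i b R f j cur)
    (hl : IsDescEnum R b cur l) : IsLeast {p | p ∈ R ∧ b < p} k := by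
  obtain ⟨cur, hI', hcur⟩ := hr.invariantI hI hl
  exact hI'.isLeast hcur

lemma isRearrangement (hr : FoldI i b R f j l g k) (hI : InvariantI i b R f j cur)
    (hl : IsDescEnum R b cur l) : IsRearrangement i R f g := by
  induction hr generalizing cur with
  | nil => exact .refl hI.isMatching
  | cons hs _ ih =>
    exact (hs.isRearrangement hI hl.isPrev).trans (ih (hs.invariantI hI hl.isPrev) hl.tail)

lemma apply_of_le (hr : FoldI i b R f j l g k) (hI : InvariantI i b R f j cur)
    (hl : IsDescEnum R b cur l) (hp : p ≤ b) : g p = f p := by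
  induction hr generalizing cur with
  | nil => rfl
  | cons hs _ ih =>
    rw [ih (hs.invariantI hI hl.isPrev) hl.tail,
      hs.apply_of_lt (hI.prev_lt hl.isPrev) (hp.trans_lt hl.isPrev.gt)]

lemma high_iff (hr : FoldI i b R f j l g k) (hI : InvariantI i b R f j cur)
    (hl : IsDescEnum R b cur l) : High b R (g p) ↔ High b R (f p) := by
  induction hr generalizing cur with
  | nil => rfl
  | cons hs _ ih =>
    rw [ih (hs.invariantI hI hl.isPrev) hl.tail, hs.high_iff hI hl.isPrev]

lemma crossNum_eq (hr : FoldI i b R f j l g k) (hI : InvariantI i b R f j cur)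
    (hl : IsDescEnum R b cur l) : crossNum R f = crossNum R g + l.countP (f · < i) := by
  induction hr generalizing cur with
  | nil => simp
  | @cons f g h j x k _ l hs _ ih =>
    have hcount : l.countP (g · < i) = l.countP (f · < i) := List.countP_congr fun p hp => by
      rw [hs.apply_of_lt (hI.prev_lt hl.isPrev) (hl.tail.mem_iff.1 hp).2.2]
    rw [hs.crossNum_eq hI hl.isPrev, ih (hs.invariantI hI hl.isPrev) hl.tail, hcount,
      List.countP_cons]
    simp only [decide_eq_true_eq]
    ring

lemma injective (hr : FoldI i b R f j l g k) (hr' : FoldI i b R f' j' l g' k)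
    (hI : InvariantI i b R f j cur) (hI' : InvariantI i b R f' j' cur) (hl : IsDescEnum R b cur l)
    (e : Set.EqOn g g' R) : Set.EqOn f f' R ∧ j = j' := by
  induction hr generalizing cur f' j' with
  | nil => cases hr'; exact ⟨e, rfl⟩
  | cons hs _ ih =>
    cases hr' with
    | cons hs' hr' =>
      obtain ⟨e', rfl⟩ := ih hr' (hs.invariantI hI hl.isPrev) (hs'.invariantI hI' hl.isPrev)
        hl.tail e
      exact hs.injective hs' hI hI' hl.isPrev e'

lemma append_of_lt {q m : ℕ} {t : List ℕ} (hr : FoldI i b R f q l g k) (hq : Adjoins b R (f q))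
    (ht : ∀ p ∈ t, b < f p) : FoldI i b R f m (t ++ q :: l) g k := by
  induction t generalizing m with
  | nil => exact .cons (.adjoins hq) hr
  | cons x t ih =>
    have ht' : ∀ p ∈ t, b < f p := fun p hp => ht p (List.mem_cons_of_mem x hp)
    rcases adjoins_or_high (R := R) (ht x List.mem_cons_self) with hadj | hhigh
    · exact .cons (.adjoins hadj) (ih ht')
    · exact .cons (.high hhigh) (ih ht')

end FoldI

end FoldI

/-! ### The second algorithm -/

/-- The rounds of the second algorithm along a list of positions of the second pointer, as a
relation between left-end functions; the first pointer starts at the second argument. -/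
inductive FoldII (i : ℕ) : (ℕ → ℕ) → ℕ → List ℕ → (ℕ → ℕ) → Prop
  | nil {f : ℕ → ℕ} {j : ℕ} : FoldII i f j [] f
  | large {f g : ℕ → ℕ} {j j' : ℕ} {l : List ℕ} : f j' < i → FoldII i f j' l g →
      FoldII i f j (j' :: l) g
  | small {f g : ℕ → ℕ} {j j' : ℕ} {l : List ℕ} : i < f j' →
      FoldII i (f ∘ Equiv.swap j j') j' l g → FoldII i f j (j' :: l) g

/-- The borrowing step at the vertex `b`, as a relation between left-end functions. -/
inductive Borrow (i b : ℕ) (R : Finset ℕ) : (ℕ → ℕ) → (ℕ → ℕ) → Prop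
  | large {g : ℕ → ℕ} : g b < i → Borrow i b R g g
  | small {g : ℕ → ℕ} {m : ℕ} : i < g b → IsNextLarge i R g b m →
      Borrow i b R g (g ∘ Equiv.swap b m)

/-- The second algorithm, with its borrowing step, on the right-hand endpoints in `(i, b]`, as a
relation between left-end functions. -/
inductive RunII (i b : ℕ) (R : Finset ℕ) : (ℕ → ℕ) → (ℕ → ℕ) → Prop
  | skip {g : ℕ → ℕ} : b = i → RunII i b R g g
  | run {g h a : ℕ → ℕ} {l : List ℕ} : i < b → b ∈ R → IsDescEnum R i b l → Borrow i b R g h →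
      FoldII i h b l a → RunII i b R g a

/-- The arc ending at `p` is large, or some other right-hand endpoint lies below it. -/
def LargeOrCovers (i : ℕ) (R : Finset ℕ) (g : ℕ → ℕ) (p : ℕ) : Prop :=
  g p < i ∨ ∃ r ∈ R, g p < r ∧ r < p

/-- The properties of the result of the first algorithm on which the second one relies. -/
structure Ready (i b : ℕ) (R : Finset ℕ) (g : ℕ → ℕ) : Prop where
  barrier : Barrier i b R
  isMatching : IsMatching R g
  ne : ∀ p ∈ R, g p ≠ i
  firstLarge : FirstLarge i b R g b
  exists_large : b ∈ R → i < g b → ∃ p ∈ R, b < p ∧ g p < i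
  lt_left_next : ∀ c, IsLeast {p | p ∈ R ∧ b < p} c → b < g c

section FoldII

variable {i j p x : ℕ} {R : Finset ℕ} {f f' g g' : ℕ → ℕ} {l : List ℕ}

lemma IsMatching.isRearrangement_swap_of_isPrev (hf : IsMatching R f) (hj : j ∈ R)
    (hlarge : f j < i) (hx : IsPrev R i j x) (hsmall : i < f x) :
    IsRearrangement i R f (f ∘ Equiv.swap j x) := by
  obtain ⟨hxR, hix, hxj, hprev⟩ := hx
  rw [Equiv.swap_comm]
  refine .comp_swap hf hxR hj ((hf.lt x hxR).trans hxj) (hlarge.trans hix) hsmall.le ?_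
  intro _ p hp hbetween
  have := hprev p hp
  omega

lemma exists_foldII (hf : IsMatching R f) (hne : ∀ p ∈ R, f p ≠ i) (hj : j ∈ R) (hlarge : f j < i)
    (hl : IsDescEnum R i j l) :
    ∃ g, FoldII i f j l g ∧ (l.foldl (stepII i) (mkArcs R f, j)).1 = mkArcs R g := by
  induction l generalizing f j with
  | nil => exact ⟨f, .nil, rfl⟩
  | cons x l ih =>
    have hx := hl.isPrev
    rcases lt_or_gt_of_ne (hne x hx.mem) with hlarge' | hsmall
    · obtain ⟨g, hr, hfold⟩ := ih hf hne hx.mem hlarge' hl.tail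
      exact ⟨g, .large hlarge' hr, by simpa [stepII, hx.mem, hlarge'] using hfold⟩
    · have hre := hf.isRearrangement_swap_of_isPrev hj hlarge hx hsmall
      obtain ⟨g, hr, hfold⟩ := ih hre.isMatching (hre.forall_ne hne) hx.mem
        (by rwa [comp_swap_right]) hl.tail
      exact ⟨g, .small hsmall hr, by
        simpa [stepII, hx.mem, hsmall.not_gt, swapArcs_mkArcs hj hx.mem hx.lt.ne'] using hfold⟩

namespace FoldII

lemma isRearrangement (hr : FoldII i f j l g) (hf : IsMatching R f) (hj : j ∈ R)
    (hlarge : f j < i) (hl : IsDescEnum R i j l) : IsRearrangement i R f g := by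
  induction hr with
  | nil => exact .refl hf
  | large hlarge' _ ih => exact ih hf hl.isPrev.mem hlarge' hl.tail
  | small hsmall _ ih =>
    have hre := hf.isRearrangement_swap_of_isPrev hj hlarge hl.isPrev hsmall
    exact hre.trans (ih hre.isMatching hl.isPrev.mem (by rwa [comp_swap_right]) hl.tail)

lemma apply_of_gt (hr : FoldII i f j l g) (hl : IsDescEnum R i j l) (hp : j < p) :
    g p = f p := by
  induction hr with
  | nil => rfl
  | large _ _ ih => exact ih hl.tail (hl.isPrev.lt.trans hp)
  | small _ _ ih =>
    rw [ih hl.tail (hl.isPrev.lt.trans hp), comp_swap_of_ne hp.ne' (hl.isPrev.lt.trans hp).ne']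

lemma largeOrCovers (hr : FoldII i f j l g) (hf : IsMatching R f) (hj : j ∈ R)
    (hlarge : f j < i) (hl : IsDescEnum R i j l) :
    ∀ p ∈ R, i < p → p ≤ j → LargeOrCovers i R g p := by
  have eq_of_gt : ∀ {j x l}, IsDescEnum R i j (x :: l) → ∀ p ∈ R, p ≤ j → x < p → p = j :=
    fun hl p hp hle hgt => hle.antisymm (hl.isPrev.le_of_gt p hp hgt)
  induction hr with
  | nil =>
    intro p hp hip hpj
    obtain rfl := hpj.antisymm (hl.le_of_nil hp hip)
    exact Or.inl hlarge
  | @large f g j x l hlarge' hr ih =>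
    intro p hp hip hpj
    rcases le_or_gt p x with hpx | hxp
    · exact ih hf hl.isPrev.mem hlarge' hl.tail p hp hip hpx
    · obtain rfl := eq_of_gt hl p hp hpj hxp
      exact Or.inl (by rwa [hr.apply_of_gt hl.tail hxp])
  | @small f g j x l hsmall hr ih =>
    intro p hp hip hpj
    have hx := hl.isPrev
    have hre := hf.isRearrangement_swap_of_isPrev hj hlarge hx hsmall
    rcases le_or_gt p x with hpx | hxp
    · exact ih hre.isMatching hx.mem (by rwa [comp_swap_right]) hl.tail p hp hip hpx
    · obtain rfl := eq_of_gt hl p hp hpj hxp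
      refine Or.inr ⟨x, hx.mem, ?_, hxp⟩
      rw [hr.apply_of_gt hl.tail hxp, comp_swap_left]
      exact hf.lt x hx.mem

lemma crossNum_eq (hr : FoldII i f j l g) (hf : IsMatching R f) (hj : j ∈ R) (hlarge : f j < i)
    (hl : IsDescEnum R i j l) : crossNum R g = crossNum R f + l.countP (i < f ·) := by
  induction hr with
  | nil => simp
  | large hlarge' _ ih =>
    rw [ih hf hl.isPrev.mem hlarge' hl.tail, List.countP_cons]
    simp [hlarge'.not_gt]
  | @small f g j x l hsmall _ ih =>
    have hx := hl.isPrev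
    have hre := hf.isRearrangement_swap_of_isPrev hj hlarge hx hsmall
    have hswap : crossNum R (f ∘ Equiv.swap j x) = crossNum R f + 1 := by
      rw [Equiv.swap_comm]
      exact crossNum_swap_of_nested hx.mem hj hx.lt (hlarge.trans hsmall)
        (hf.lt x hx.mem) fun p hp hxp hpj => absurd hpj (hx.le_of_gt p hp hxp).not_gt
    have hcount : l.countP (i < (f ∘ Equiv.swap j x) ·) = l.countP (i < f ·) :=
      List.countP_congr fun p hp => by
        have hpx := (hl.tail.mem_iff.1 hp).2.2
        rw [comp_swap_of_ne (hpx.trans hx.lt).ne hpx.ne]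
    rw [ih hre.isMatching hx.mem (by rwa [comp_swap_right]) hl.tail, hswap, hcount,
      List.countP_cons]
    simp only [hsmall, decide_true, if_true]
    ring

lemma injective (hr : FoldII i f j l g) (hr' : FoldII i f' j l g') (hj : j ∈ R)
    (hlarge : f j < i) (hlarge' : f' j < i) (hl : IsDescEnum R i j l) (e : Set.EqOn g g' R) :
    Set.EqOn f f' R := by
  induction hr generalizing f' with
  | nil => cases hr'; exact e
  | @large f g j x l hx _ ih =>
    cases hr' with
    | large hx' hr' => exact ih hr' hl.isPrev.mem hx hx' hl.tail e
    | small hx' hr' =>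
      have := ih hr' hl.isPrev.mem hx (by rwa [comp_swap_right]) hl.tail e hj
      rw [comp_swap_left] at this
      omega
  | @small f g j x l hx _ ih =>
    cases hr' with
    | large hx' hr' =>
      have := ih hr' hl.isPrev.mem (by rwa [comp_swap_right]) hx' hl.tail e hj
      rw [comp_swap_left] at this
      omega
    | small hx' hr' =>
      exact eqOn_of_comp_swap hj hl.isPrev.mem (ih hr' hl.isPrev.mem (by rwa [comp_swap_right])
        (by rwa [comp_swap_right]) hl.tail e)

end FoldII

end FoldII

section RunII

variable {i b p : ℕ} {R : Finset ℕ} {a a' g g' h h' : ℕ → ℕ}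

lemma Ready.ne_barrier (hg : Ready i b R g) (hp : p ∈ R) : g p ≠ b :=
  hg.barrier.left_ne hg.isMatching hg.ne hp

lemma exists_borrow (hg : Ready i b R g) (hb : b ∈ R) :
    ∃ h, Borrow i b R g h ∧ borrow i (mkArcs R g) b = mkArcs R h := by
  rcases lt_or_gt_of_ne (hg.ne b hb) with hlarge | hsmall
  · exact ⟨g, .large hlarge, by simp [borrow, hb, hlarge.not_gt]⟩
  · obtain ⟨p, hp, hbp, hlarge⟩ := hg.exists_large hb hsmall
    have hne := largeEndsAfter_nonempty hp hbp hlarge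
    have hm := isNextLarge_min' hne
    refine ⟨_, .small hsmall hm, ?_⟩
    rw [borrow, leftOf_mkArcs hb, if_pos hsmall, dif_pos hne, swapArcs_mkArcs hb hm.1 hm.2.1.ne]

namespace Borrow

lemma isRearrangement (hbor : Borrow i b R g h) (hg : Ready i b R g) (hb : b ∈ R) :
    IsRearrangement i R g h := by
  cases hbor with
  | large _ => exact .refl hg.isMatching
  | small hsmall hm =>
    obtain ⟨hmR, hbm, hlarge, hbetween⟩ := hm
    have hlt := hg.isMatching.lt b hb
    refine .comp_swap hg.isMatching hb hmR (by omega) (by omega) hsmall.le fun _ p hp hpos => ?_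
    exact hbetween p hp (by omega) (by omega)

lemma apply_barrier_lt (hbor : Borrow i b R g h) : h b < i := by
  cases hbor with
  | large hlarge => exact hlarge
  | small _ hm => rw [comp_swap_left]; exact hm.2.2.1

lemma apply_of_lt (hbor : Borrow i b R g h) (hp : p < b) : h p = g p := by
  cases hbor with
  | large _ => rfl
  | small _ hm => exact comp_swap_of_ne hp.ne (hp.trans hm.2.1).ne

lemma barrier_lt_iff (hbor : Borrow i b R g h) (hg : Ready i b R g) (hb : b ∈ R) (hp : b < p) :
    b < h p ↔ b < g p := by
  cases hbor with
  | large _ => rfl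
  | @small m _ hm =>
    rcases eq_or_ne p m with rfl | hpm
    · have hlt := hg.isMatching.lt b hb
      have := hg.barrier.le
      have hlarge := hm.2.2.1
      rw [comp_swap_right]
      omega
    · rw [comp_swap_of_ne hp.ne' hpm]

lemma crossNum_eq (hbor : Borrow i b R g h) (hg : Ready i b R g) (hb : b ∈ R) :
    crossNum R h = crossNum R g + if i < g b then 1 else 0 := by
  cases hbor with
  | large hlarge => rw [if_neg hlarge.not_gt, add_zero]
  | small hsmall hm =>
    have hlt := hg.isMatching.lt b hb
    have hbetween := hg.firstLarge.lt_left_of_isNextLarge (fun _ => hg.ne_barrier) hm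
    rw [if_pos hsmall]
    exact crossNum_swap_of_nested hb hm.1 hm.2.1 (hm.2.2.1.trans hsmall) hlt
      fun p hp hbp hpm => Or.inr (hlt.trans (hbetween p hp hbp hpm))

lemma preimage_cases (hbor : Borrow i b R g h) (hg : Ready i b R g) (hb : b ∈ R) :
    (g = h ∧ FirstLarge i b R h b) ∨ ∃ m, FirstLow i b R h b m ∧ g = h ∘ Equiv.swap b m := by
  cases hbor with
  | large _ => exact Or.inl ⟨rfl, hg.firstLarge⟩
  | @small m hsmall hm =>
    have hbetween := hg.firstLarge.lt_left_of_isNextLarge (fun _ => hg.ne_barrier) hm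
    refine Or.inr ⟨m, ⟨hm.1, hm.2.1, ?_, ?_, fun p hp hbp hpm => ?_⟩,
      (comp_swap_comp_swap _ _ _).symm⟩
    · rwa [comp_swap_right]
    · rw [comp_swap_right]; exact hg.isMatching.lt b hb
    · rw [comp_swap_of_ne hbp.ne' hpm.ne]
      exact hbetween p hp hbp hpm

lemma injective (hbor : Borrow i b R g h) (hbor' : Borrow i b R g' h') (hg : Ready i b R g)
    (hg' : Ready i b R g') (hb : b ∈ R) (e : Set.EqOn h h' R) : Set.EqOn g g' R := by
  rcases hbor.preimage_cases hg hb with ⟨rfl, hfirst⟩ | ⟨m, hfirst, rfl⟩ <;>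
  rcases hbor'.preimage_cases hg' hb with ⟨rfl, hfirst'⟩ | ⟨m', hfirst', rfl⟩
  · exact e
  · exact absurd hfirst' (hfirst.congr e).not_firstLow
  · exact absurd (hfirst.congr e) hfirst'.not_firstLow
  · obtain rfl := (hfirst.congr e).unique hfirst'
    exact eqOn_comp_swap hb hfirst.1 e

end Borrow

lemma card_filter_le_eq_add {P : ℕ → Prop} [DecidablePred P] (hib : i < b) (hb : b ∈ R) :
    (R.filter fun p => (i < p ∧ p ≤ b) ∧ P p).card =
      (R.filter fun p => (i < p ∧ p < b) ∧ P p).card + if P b then 1 else 0 := by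
  have hsplit : (R.filter fun p => (i < p ∧ p ≤ b) ∧ P p) =
      (R.filter fun p => (i < p ∧ p < b) ∧ P p) ∪ ({b} : Finset ℕ).filter P := by
    ext p
    simp only [Finset.mem_filter, Finset.mem_union, Finset.mem_singleton, le_iff_lt_or_eq]
    constructor
    · tauto
    · rintro (h | ⟨rfl, hP⟩)
      · tauto
      · exact ⟨hb, ⟨hib, Or.inr rfl⟩, hP⟩
  rw [hsplit, Finset.card_union_of_disjoint, Finset.filter_singleton]
  · split_ifs <;> simp
  · rw [Finset.disjoint_left]
    intro p hp hpb
    simp only [Finset.mem_filter, Finset.mem_singleton] at hp hpb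
    omega

namespace RunII

lemma isRearrangement (hr : RunII i b R g a) (hg : Ready i b R g) : IsRearrangement i R g a := by
  cases hr with
  | skip _ => exact .refl hg.isMatching
  | run _ hb hl hbor hfold =>
    have hre := hbor.isRearrangement hg hb
    exact hre.trans (hfold.isRearrangement hre.isMatching hb hbor.apply_barrier_lt hl)

lemma barrier_lt_iff (hr : RunII i b R g a) (hg : Ready i b R g) (hp : b < p) :
    b < a p ↔ b < g p := by
  cases hr with
  | skip _ => rfl
  | run _ hb hl hbor hfold => rw [hfold.apply_of_gt hl hp, hbor.barrier_lt_iff hg hb hp]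

lemma largeOrCovers (hr : RunII i b R g a) (hg : Ready i b R g) (hp : p ∈ R) (hip : i < p)
    (hpb : p ≤ b) :
    LargeOrCovers i R a p := by
  cases hr with
  | skip h => omega
  | run _ hb hl hbor hfold =>
    exact hfold.largeOrCovers (hbor.isRearrangement hg hb).isMatching hb hbor.apply_barrier_lt hl
      p hp hip hpb

lemma crossNum_eq (hr : RunII i b R g a) (hg : Ready i b R g) :
    crossNum R a = crossNum R g + (R.filter fun p => (i < p ∧ p ≤ b) ∧ i < g p).card := by
  cases hr with
  | skip hbi =>
    rw [Finset.filter_false_of_mem fun p _ => by omega, Finset.card_empty, add_zero]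
  | @run h _ l hib hb hl hbor hfold =>
    have hcount : l.countP (i < h ·) = l.countP (i < g ·) := List.countP_congr fun p hp => by
      rw [hbor.apply_of_lt (hl.mem_iff.1 hp).2.2]
    rw [hfold.crossNum_eq (hbor.isRearrangement hg hb).isMatching hb hbor.apply_barrier_lt hl,
      hbor.crossNum_eq hg hb, hcount, hl.countP_eq fun p => i < g p,
      card_filter_le_eq_add (P := fun p => i < g p) hib hb]
    ring

lemma injective (hr : RunII i b R g a) (hr' : RunII i b R g' a') (hg : Ready i b R g)
    (hg' : Ready i b R g') (e : Set.EqOn a a' R) : Set.EqOn g g' R := by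
  cases hr with
  | skip hbi =>
    cases hr' with
    | skip _ => exact e
    | run hib' => omega
  | run hib hb hl hbor hfold =>
    cases hr' with
    | skip hbi' => omega
    | run _ _ hl' hbor' hfold' =>
      obtain rfl := hl.unique hl'
      exact hbor.injective hbor' hg hg' hb (hfold.injective hfold' hb hbor.apply_barrier_lt
        hbor'.apply_barrier_lt hl e)

end RunII

end RunII

/-! ### Both algorithms together -/

/-- The situation in which the first algorithm starts at `q`, the right-hand endpoint of the
critical small arc. -/
structure Critical (i b : ℕ) (R : Finset ℕ) (f : ℕ → ℕ) (q : ℕ) : Prop where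
  mem : q ∈ R
  gt : b < q
  adjoins : Adjoins b R (f q)
  lt_left_of_gt : ∀ p ∈ R, q < p → b < f p
  exists_large : ∃ p ∈ R, b < p ∧ f p < i ∧ ∀ p' ∈ R, p < p' → b < f p'

/-- The first algorithm on the right-hand endpoints to the right of `b`, as a relation between
left-end functions. -/
inductive RunI (i b : ℕ) (R : Finset ℕ) : (ℕ → ℕ) → (ℕ → ℕ) → Prop
  | skip {f : ℕ → ℕ} : (b = i ∨ f b < i) → (∀ p ∈ R, b < p → b < f p) → RunI i b R f f
  | run {f g : ℕ → ℕ} {q k : ℕ} {l : List ℕ} : Critical i b R f q → IsDescEnum R b q l →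
      FoldI i b R f q l g k → RunI i b R f g

/-- The effect of both algorithms, where `b` is the last right-hand endpoint in the second region
(or `i` if that region is empty). -/
def Run (i b : ℕ) (R : Finset ℕ) (f a : ℕ → ℕ) : Prop :=
  Barrier i b R ∧ ∃ g, RunI i b R f g ∧ RunII i b R g a

section Run

variable {i b b' j q k : ℕ} {R : Finset ℕ} {f f' g g' a a' : ℕ → ℕ} {l : List ℕ}

lemma IsRearrangement.exists_large (hre : IsRearrangement i R f g) (hf : IsMatching R f)
    (heq : ∀ p ≤ b, g p = f p) (hlarge : ∃ p ∈ R, b < p ∧ f p < i) :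
    ∃ p ∈ R, b < p ∧ g p < i := by
  obtain ⟨p, hp, hbp, hlarge⟩ := hlarge
  obtain ⟨q, hq, e⟩ := hre.exists_right hp
  refine ⟨q, hq, ?_, e ▸ hlarge⟩
  by_contra! hqb
  exact (hqb.trans_lt hbp).ne (hf.injOn hq hp ((heq q hqb).symm.trans e))

namespace Critical

lemma invariantI (hq : Critical i b R f q) (hb : Barrier i b R) (hf : IsMatching R f)
    (hne : ∀ p ∈ R, f p ≠ i) : InvariantI i b R f q q where
  barrier := hb
  isMatching := hf
  ne := hne
  mem := hq.mem
  lt_cur := hq.gt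
  cur_le := le_rfl
  adjoins := hq.adjoins
  high p _ hle hlt := absurd hlt hle.not_gt
  firstLarge p hp hqp hpb := absurd hpb (hq.lt_left_of_gt p hp hqp).not_gt
  exists_large_of_low p hp _ _ hpb := by
    obtain ⟨m, hm, -, hlarge, hafter⟩ := hq.exists_large
    refine ⟨m, hm, ?_, hlarge⟩
    by_contra! hmp
    rcases hmp.eq_or_lt with rfl | hmp
    · omega
    · exact hpb.not_gt (hafter p hp hmp)

lemma exists_large_after (hq : Critical i b R f q) (hb : Barrier i b R) (hf : IsMatching R f)
    (hne : ∀ p ∈ R, f p ≠ i) (hl : IsDescEnum R b q l) (hr : FoldI i b R f q l g k) :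
    ∃ p ∈ R, b < p ∧ g p < i := by
  have hI := hq.invariantI hb hf hne
  obtain ⟨m, hm, hbm, hlarge, -⟩ := hq.exists_large
  exact (hr.isRearrangement hI hl).exists_large hf (fun _ => hr.apply_of_le hI hl)
    ⟨m, hm, hbm, hlarge⟩

lemma ready (hq : Critical i b R f q) (hb : Barrier i b R) (hf : IsMatching R f)
    (hne : ∀ p ∈ R, f p ≠ i) (hl : IsDescEnum R b q l) (hr : FoldI i b R f q l g k) :
    Ready i b R g := by
  have hI := hq.invariantI hb hf hne
  obtain ⟨⟨hkR, hbk⟩, hk⟩ := hr.isLeast hI hl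
  obtain ⟨cur, hI', -⟩ := hr.invariantI hI hl
  refine ⟨hb, hI'.isMatching, hI'.ne, fun p hp hbp hpb => ?_,
    fun _ _ => hq.exists_large_after hb hf hne hl hr, fun c hc => ?_⟩
  · rcases (hk ⟨hp, hbp⟩).eq_or_lt with rfl | hkp
    · exact absurd hpb hI'.adjoins.1.not_gt
    · obtain ⟨p', hp', hkp', hle, hlarge⟩ := hI'.firstLarge p hp hkp hpb
      exact ⟨p', hp', hbk.trans hkp', hle, hlarge⟩
  · obtain rfl := hc.unique ⟨⟨hkR, hbk⟩, hk⟩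
    exact hI'.adjoins.1

lemma exists_last (hj : Critical i b R f j) :
    ∃ q, j ≤ q ∧ Critical i b R f q ∧ ∀ p ∈ R, q < p → High b R (f p) := by
  classical
  obtain ⟨q, hmax⟩ := Finset.exists_maximal
    (s := R.filter fun p => b < p ∧ Adjoins b R (f p)) ⟨j, by simp [hj.mem, hj.gt, hj.adjoins]⟩
  obtain ⟨hqR, hbq, hadj⟩ : q ∈ R ∧ b < q ∧ Adjoins b R (f q) := by simpa using hmax.1
  have le_q : ∀ p ∈ R, b < p → Adjoins b R (f p) → p ≤ q := fun p hp hbp hadj' =>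
    not_lt.1 fun hlt => hmax.not_gt (by simp [hp, hbp, hadj']) hlt
  have hjq := le_q j hj.mem hj.gt hj.adjoins
  have hafter : ∀ p ∈ R, q < p → b < f p := fun p hp hqp =>
    hj.lt_left_of_gt p hp (hjq.trans_lt hqp)
  refine ⟨q, hjq, ⟨hqR, hbq, hadj, hafter, hj.exists_large⟩, fun p hp hqp => ?_⟩
  exact (adjoins_or_high (hafter p hp hqp)).resolve_left fun hadj' =>
    (le_q p hp (hbq.trans hqp) hadj').not_gt hqp

/-- The run of the first algorithm may be started further to the right, as the arcs added in this
way start after `b` and are not moved. -/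
lemma exists_foldI_last (hj : Critical i b R f j) (hl : IsDescEnum R b j l)
    (hr : FoldI i b R f j l g k) :
    ∃ q l', Critical i b R f q ∧ IsDescEnum R b q l' ∧ FoldI i b R f q l' g k ∧
      ∀ p ∈ R, q < p → High b R (f p) := by
  obtain ⟨q, hjq, hq, hhigh⟩ := hj.exists_last
  rcases hjq.eq_or_lt with rfl | hlt
  · exact ⟨j, l, hq, hl, hr, hhigh⟩
  · have ht := IsDescEnum.sort R j q
    refine ⟨q, _, hq, hl.append ht hj.mem hj.gt hlt, hr.append_of_lt hj.adjoins fun p hp => ?_,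
      hhigh⟩
    obtain ⟨hpR, hjp, -⟩ := ht.mem_iff.1 hp
    exact hj.lt_left_of_gt p hpR hjp

end Critical

namespace RunI

lemma ready (hr : RunI i b R f g) (hb : Barrier i b R) (hf : IsMatching R f)
    (hne : ∀ p ∈ R, f p ≠ i) : Ready i b R g := by
  cases hr with
  | skip hlarge hafter =>
    refine ⟨hb, hf, hne, fun p hp hbp hpb => absurd hpb (hafter p hp hbp).not_gt,
      fun hbR hsmall => ?_, fun c hc => hafter c hc.1.1 hc.1.2⟩
    rcases hlarge with rfl | hlarge
    · exact absurd hbR hb.notMem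
    · exact absurd hlarge hsmall.not_gt
  | run hq hl hr => exact hq.ready hb hf hne hl hr

lemma isRearrangement (hr : RunI i b R f g) (hb : Barrier i b R) (hf : IsMatching R f)
    (hne : ∀ p ∈ R, f p ≠ i) : IsRearrangement i R f g := by
  cases hr with
  | skip _ _ => exact .refl hf
  | run hq hl hr => exact hr.isRearrangement (hq.invariantI hb hf hne) hl

lemma apply_of_le (hr : RunI i b R f g) (hb : Barrier i b R) (hf : IsMatching R f)
    (hne : ∀ p ∈ R, f p ≠ i) {p : ℕ} (hp : p ≤ b) : g p = f p := by
  cases hr with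
  | skip _ _ => rfl
  | run hq hl hr => exact hr.apply_of_le (hq.invariantI hb hf hne) hl hp

lemma crossNum_eq (hr : RunI i b R f g) (hb : Barrier i b R) (hf : IsMatching R f)
    (hne : ∀ p ∈ R, f p ≠ i) :
    crossNum R f = crossNum R g + (R.filter fun p => b < p ∧ f p < i).card := by
  have hib := hb.le
  cases hr with
  | skip _ hafter =>
    rw [Finset.filter_false_of_mem, Finset.card_empty, add_zero]
    rintro p hp ⟨hbp, hlarge⟩
    exact absurd (hafter p hp hbp) (hlarge.trans_le hib).not_gt
  | run hq hl hr =>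
    rw [hr.crossNum_eq (hq.invariantI hb hf hne) hl, hl.countP_eq fun p => f p < i]
    congr 2
    refine Finset.filter_congr fun p hp => ⟨fun h => ⟨h.1.1, h.2⟩, fun ⟨hbp, hlarge⟩ =>
      ⟨⟨hbp, ?_⟩, hlarge⟩⟩
    by_contra! hqp
    have hpb := hlarge.trans_le hib
    rcases hqp.eq_or_lt with rfl | hqp
    · exact hpb.not_gt hq.adjoins.1
    · exact hpb.not_gt (hq.lt_left_of_gt p hp hqp)

lemma injective (hr : RunI i b R f g) (hr' : RunI i b R f' g') (hb : Barrier i b R)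
    (hf : IsMatching R f) (hne : ∀ p ∈ R, f p ≠ i) (hf' : IsMatching R f')
    (hne' : ∀ p ∈ R, f' p ≠ i) (e : Set.EqOn g g' R) : Set.EqOn f f' R := by
  have hib := hb.le
  cases hr with
  | skip _ hafter =>
    cases hr' with
    | skip _ _ => exact e
    | run hq' hl' hr' =>
      obtain ⟨p, hp, hbp, hlarge⟩ := hq'.exists_large_after hb hf' hne' hl' hr'
      have := hafter p hp hbp
      have := e hp
      omega
  | run hq hl hr =>
    cases hr' with
    | skip _ hafter =>
      obtain ⟨p, hp, hbp, hlarge⟩ := hq.exists_large_after hb hf hne hl hr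
      have := hafter p hp hbp
      have := e hp
      omega
    | run hq' hl' hr' =>
      obtain ⟨q, l, hq, hl, hr, hhigh⟩ := hq.exists_foldI_last hl hr
      obtain ⟨q', l', hq', hl', hr', hhigh'⟩ := hq'.exists_foldI_last hl' hr'
      have hI := hq.invariantI hb hf hne
      have hI' := hq'.invariantI hb hf' hne'
      have high_iff : ∀ p ∈ R, High b R (f p) ↔ High b R (f' p) := fun p hp => by
        rw [← hr.high_iff hI hl, ← hr'.high_iff hI' hl', e hp]
      obtain rfl : q = q' := by
        rcases lt_trichotomy q q' with h | h | h
        · exact absurd ((high_iff q' hq'.mem).1 (hhigh q' hq'.mem h)) hq'.adjoins.not_high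
        · exact h
        · exact absurd ((high_iff q hq.mem).2 (hhigh' q hq.mem h)) hq.adjoins.not_high
      obtain rfl := hl.unique hl'
      obtain rfl := (hr.isLeast hI hl).unique (hr'.isLeast hI' hl)
      exact (hr.injective hr' hI hI' hl e).1

end RunI

namespace Run

lemma isRearrangement (hr : Run i b R f a) (hf : IsMatching R f) (hne : ∀ p ∈ R, f p ≠ i) :
    IsRearrangement i R f a := by
  obtain ⟨hb, g, hI, hII⟩ := hr
  exact (hI.isRearrangement hb hf hne).trans (hII.isRearrangement (hI.ready hb hf hne))

lemma crossNum_add (hr : Run i b R f a) (hf : IsMatching R f) (hne : ∀ p ∈ R, f p ≠ i) :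
    crossNum R a + (R.filter fun p => i < p ∧ f p < i).card =
      crossNum R f + (R.filter fun p => i < p ∧ p ≤ b).card := by
  obtain ⟨hb, g, hI, hII⟩ := hr
  have hib := hb.le
  have hsmall : (R.filter fun p => (i < p ∧ p ≤ b) ∧ i < g p) =
      (R.filter fun p => i < p ∧ p ≤ b).filter fun p => ¬ f p < i := by
    rw [Finset.filter_filter]
    refine Finset.filter_congr fun p hp => and_congr_right fun hpos => ?_
    rw [hI.apply_of_le hb hf hne hpos.2]
    have := hne p hp
    omega
  have hlarge : (R.filter fun p => i < p ∧ f p < i).card =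
      (R.filter fun p => b < p ∧ f p < i).card +
        ((R.filter fun p => i < p ∧ p ≤ b).filter fun p => f p < i).card := by
    rw [Finset.filter_filter, ← Finset.card_union_of_disjoint, ← Finset.filter_or]
    · congr 1
      exact Finset.filter_congr fun p _ => by omega
    · rw [Finset.disjoint_filter]
      intro p _
      omega
  rw [hII.crossNum_eq (hI.ready hb hf hne), hI.crossNum_eq hb hf hne, hsmall, hlarge,
    ← Finset.card_filter_add_card_filter_not (s := R.filter fun p => i < p ∧ p ≤ b)
      fun p => f p < i]
  ring

lemma bound_le (hr : Run i b R f a) (hr' : Run i b' R f' a') (hf : IsMatching R f)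
    (hne : ∀ p ∈ R, f p ≠ i) (hf' : IsMatching R f') (hne' : ∀ p ∈ R, f' p ≠ i)
    (e : Set.EqOn a a' R) : b' ≤ b := by
  obtain ⟨hb, g, hI, hII⟩ := hr
  obtain ⟨hb', g', hI', hII'⟩ := hr'
  have hready := hI.ready hb hf hne
  have hib := hb.le
  by_contra! hlt
  have hb'R : b' ∈ R := hb'.mem.resolve_left (by omega)
  obtain ⟨c, hc⟩ : ∃ c, IsLeast {p | p ∈ R ∧ b < p} c :=
    ⟨_, Nat.sInf_mem (s := {p | p ∈ R ∧ b < p}) ⟨b', hb'R, hlt⟩, fun p hp => Nat.sInf_le hp⟩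
  obtain ⟨⟨hcR, hbc⟩, hmin⟩ := hc
  have hac := (hII.barrier_lt_iff hready hbc).2 (hready.lt_left_next c ⟨⟨hcR, hbc⟩, hmin⟩)
  rw [e hcR] at hac
  rcases hII'.largeOrCovers (hI'.ready hb' hf' hne') hcR (by omega) (hmin ⟨hb'R, hlt⟩) with
    hlarge | ⟨r, hr, har, hrc⟩
  · omega
  · exact (hmin ⟨hr, hac.trans har⟩).not_gt hrc

lemma injective (hr : Run i b R f a) (hr' : Run i b' R f' a') (hf : IsMatching R f)
    (hne : ∀ p ∈ R, f p ≠ i) (hf' : IsMatching R f') (hne' : ∀ p ∈ R, f' p ≠ i)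
    (e : Set.EqOn a a' R) : Set.EqOn f f' R := by
  obtain rfl : b = b' :=
    (hr'.bound_le hr hf' hne' hf hne e.symm).antisymm (hr.bound_le hr' hf hne hf' hne' e)
  obtain ⟨hb, g, hI, hII⟩ := hr
  obtain ⟨-, g', hI', hII'⟩ := hr'
  exact hI.injective hI' hb hf hne hf' hne'
    (hII.injective hII' (hI.ready hb hf hne) (hI'.ready hb hf' hne') e)

end Run

end Run

/-! ### The regions of a matching -/

/-- The critical large arc of `mkArcs R f` ends at `m`. -/
def IsLastLarge (i : ℕ) (R : Finset ℕ) (f : ℕ → ℕ) (m : ℕ) : Prop :=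
  IsGreatest {p | p ∈ R ∧ i < p ∧ f p < i} m

/-- If the critical large arc of `mkArcs R f` ends at `m`, then the critical small arc ends
at `q`. -/
structure IsFirstCrossing (i : ℕ) (R : Finset ℕ) (f : ℕ → ℕ) (m q : ℕ) : Prop where
  mem : q ∈ R
  small : i < f q
  left_lt : f q < m
  gt : m < q
  le : ∀ p ∈ R, i < f p → f p < m → m < p → f q ≤ f p

section Regions

variable {i m p q : ℕ} {R : Finset ℕ} {f : ℕ → ℕ}

lemma exists_isLastLarge (h : ∃ p ∈ R, i < p ∧ f p < i) : ∃ m, IsLastLarge i R f m := by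
  obtain ⟨p, hp, hpos⟩ := h
  have hne : (R.filter fun p => i < p ∧ f p < i).Nonempty := ⟨p, by simp [hp, hpos]⟩
  exact ⟨_, by simpa [IsLastLarge] using Finset.isGreatest_max' _ hne⟩

lemma IsLastLarge.lt_left (hm : IsLastLarge i R f m) (hne : ∀ p ∈ R, f p ≠ i) (hp : p ∈ R)
    (hmp : m < p) : i < f p := by
  by_contra! hle
  exact hmp.not_ge (hm.2 ⟨hp, hm.1.2.1.trans hmp, hle.lt_of_ne (hne p hp)⟩)

lemma exists_isFirstCrossing (h : ∃ q ∈ R, i < f q ∧ f q < m ∧ m < q) :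
    ∃ q, IsFirstCrossing i R f m q := by
  obtain ⟨p, hp, hpos⟩ := h
  obtain ⟨q, hq, hmin⟩ := Finset.exists_min_image (R.filter fun q => i < f q ∧ f q < m ∧ m < q) f
    ⟨p, by simp [hp, hpos]⟩
  obtain ⟨hqR, hsmall, hleft, hmq⟩ := Finset.mem_filter.1 hq
  exact ⟨q, hqR, hsmall, hleft, hmq, fun p hp hip hpm hmp => hmin p (by simp [hp, hip, hpm, hmp])⟩

lemma IsFirstCrossing.unique (hf : Set.InjOn f R) (hq : IsFirstCrossing i R f m q)
    (hp : IsFirstCrossing i R f m p) : q = p :=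
  hf hq.mem hp.mem ((hq.le p hp.mem hp.small hp.left_lt hp.gt).antisymm
    (hp.le q hq.mem hq.small hq.left_lt hq.gt))

lemma region_mkArcs : region i (mkArcs R f) = R.filter fun p => i < p := by
  rw [region, rightEnds_mkArcs]

lemma isCriticalLarge_mkArcs :
    IsCriticalLarge i (mkArcs R f) (f m, m) ↔ IsLastLarge i R f m := by
  simp only [IsCriticalLarge, region_mkArcs, forall_mem_mkArcs, Finset.mem_filter,
    pair_mem_mkArcs, and_true, IsLastLarge, IsGreatest, upperBounds, Set.mem_ofPred_eq]
  constructor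
  · rintro ⟨-, hlarge, ⟨hm, him⟩, hmax⟩
    exact ⟨⟨hm, him, hlarge⟩, fun p ⟨hp, hip, hlarge⟩ => hmax p hp hlarge ⟨hp, hip⟩⟩
  · rintro ⟨⟨hm, him, hlarge⟩, hmax⟩
    exact ⟨hm, hlarge, ⟨hm, him⟩, fun p _ hlarge ⟨hp, hip⟩ => hmax ⟨hp, hip, hlarge⟩⟩

lemma isCriticalSmall_mkArcs :
    IsCriticalSmall i (mkArcs R f) (f q, q) ↔
      ∃ m, IsLastLarge i R f m ∧ IsFirstCrossing i R f m q := by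
  simp only [IsCriticalSmall, forall_mem_mkArcs, exists_mem_mkArcs, Crosses,
    isCriticalLarge_mkArcs, pair_mem_mkArcs, and_true]
  constructor
  · rintro ⟨m, -, hm, hq, hsmall, ⟨-, hleft, hmq⟩, hmin⟩
    exact ⟨m, hm, hq, hsmall, hleft, hmq, fun p hp hip hpm hmp =>
      hmin p hp hip ⟨hm.1.2.2.trans hip, hpm, hmp⟩⟩
  · rintro ⟨m, hm, hq⟩
    exact ⟨m, hm.1.1, hm, hq.mem, hq.small, ⟨hm.1.2.2.trans hq.small, hq.left_lt, hq.gt⟩,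
      fun p hp hip ⟨_, hpm, hmp⟩ => hq.le p hp hip hpm hmp⟩

lemma mem_region1_mkArcs : p ∈ region1 i (mkArcs R f) ↔ (p ∈ R ∧ i < p) ∧
    ∃ q ∈ R, (∃ m, IsLastLarge i R f m ∧ IsFirstCrossing i R f m q) ∧ f q < p ∧ p ≤ q := by
  simp only [region1, region_mkArcs, exists_mem_mkArcs, isCriticalSmall_mkArcs, Finset.mem_filter]

lemma mem_region2_mkArcs : p ∈ region2 i (mkArcs R f) ↔ (p ∈ R ∧ i < p) ∧
    ((∃ q ∈ R, (∃ m, IsLastLarge i R f m ∧ IsFirstCrossing i R f m q) ∧ p < f q) ∨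
      (¬ ∃ q ∈ R, ∃ m, IsLastLarge i R f m ∧ IsFirstCrossing i R f m q) ∧
        ∃ m ∈ R, IsLastLarge i R f m ∧ p ≤ m) := by
  simp only [region2, region_mkArcs, exists_mem_mkArcs, isCriticalSmall_mkArcs,
    isCriticalLarge_mkArcs, Finset.mem_filter]

lemma region1_mkArcs_of_not_exists
    (h : ¬ ∃ m q, IsLastLarge i R f m ∧ IsFirstCrossing i R f m q) :
    region1 i (mkArcs R f) = ∅ := by
  refine Finset.eq_empty_of_forall_notMem fun p hp => ?_
  obtain ⟨-, q, -, ⟨m, hm, hq⟩, -⟩ := mem_region1_mkArcs.1 hp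
  exact h ⟨m, q, hm, hq⟩

lemma region2_mkArcs_of_not_exists_large (h : ¬ ∃ m, IsLastLarge i R f m) :
    region2 i (mkArcs R f) = ∅ := by
  refine Finset.eq_empty_of_forall_notMem fun p hp => ?_
  obtain ⟨-, ⟨q, -, ⟨m, hm, -⟩, -⟩ | ⟨-, m, -, hm, -⟩⟩ := mem_region2_mkArcs.1 hp <;>
    exact h ⟨m, hm⟩

lemma region2_mkArcs_of_not_exists_small (hm : IsLastLarge i R f m)
    (h : ¬ ∃ q, IsFirstCrossing i R f m q) :
    region2 i (mkArcs R f) = R.filter fun p => i < p ∧ p ≤ m := by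
  ext p
  rw [mem_region2_mkArcs, Finset.mem_filter, and_assoc]
  refine and_congr_right fun _ => and_congr_right fun _ => ⟨?_, fun hpm => Or.inr ⟨?_, m, hm.1.1,
    hm, hpm⟩⟩
  · rintro (⟨q, -, ⟨m', hm', hq⟩, -⟩ | ⟨-, m', -, hm', hle⟩)
    · exact absurd ⟨q, hm.unique hm' ▸ hq⟩ h
    · exact hm.unique hm' ▸ hle
  · rintro ⟨q, -, m', hm', hq⟩
    exact h ⟨q, hm.unique hm' ▸ hq⟩

lemma region1_mkArcs (hf : Set.InjOn f R) (hm : IsLastLarge i R f m)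
    (hq : IsFirstCrossing i R f m q) :
    region1 i (mkArcs R f) = R.filter fun p => f q < p ∧ p ≤ q := by
  ext p
  rw [mem_region1_mkArcs, Finset.mem_filter, and_assoc]
  refine and_congr_right fun _ => ⟨?_, fun hp => ⟨hq.small.trans hp.1, q, hq.mem, ⟨m, hm, hq⟩, hp⟩⟩
  rintro ⟨-, q', -, ⟨m', hm', hq'⟩, hp⟩
  obtain rfl := hm.unique hm'
  exact hq.unique hf hq' ▸ hp

lemma region2_mkArcs (hf : Set.InjOn f R) (hm : IsLastLarge i R f m)
    (hq : IsFirstCrossing i R f m q) :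
    region2 i (mkArcs R f) = R.filter fun p => i < p ∧ p < f q := by
  ext p
  rw [mem_region2_mkArcs, Finset.mem_filter, and_assoc]
  refine and_congr_right fun _ => and_congr_right fun _ => ⟨?_, fun hp =>
    Or.inl ⟨q, hq.mem, ⟨m, hm, hq⟩, hp⟩⟩
  rintro (⟨q', -, ⟨m', hm', hq'⟩, hp⟩ | ⟨hnone, -⟩)
  · obtain rfl := hm.unique hm'
    exact hq.unique hf hq' ▸ hp
  · exact absurd ⟨q, hq.mem, m, hm, hq⟩ hnone

lemma exists_barrier (hi : i ∉ R) {x : ℕ} (hx : i < x) :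
    ∃ b, Barrier i b R ∧ b < x ∧ ∀ p ∈ R, i < p → (p ≤ b ↔ p < x) := by
  obtain ⟨b, hb⟩ := (insert i (R.filter fun p => i < p ∧ p < x)).exists_maximal
    (Finset.insert_nonempty _ _)
  have hmax : ∀ p ∈ R, i < p → p < x → p ≤ b := fun p hp hip hpx =>
    not_lt.1 fun hlt => hb.not_gt (by simp [hp, hip, hpx]) hlt
  rcases Finset.mem_insert.1 hb.1 with rfl | hbR
  · exact ⟨b, ⟨hi, le_rfl, Or.inl rfl⟩, hx, fun p hp hip => ⟨fun hle => hle.trans_lt hx,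
      hmax p hp hip⟩⟩
  · obtain ⟨hbR, hib, hbx⟩ := Finset.mem_filter.1 hbR
    exact ⟨b, ⟨hi, hib.le, Or.inr hbR⟩, hbx, fun p hp hip => ⟨fun hle => hle.trans_lt hbx,
      hmax p hp hip⟩⟩

end Regions

section ExistsRun

variable {i b m q : ℕ} {R : Finset ℕ} {f g : ℕ → ℕ}

lemma sort_filter_le (hq : q ∈ R) (hbq : b < q) :
    (R.filter fun p => b < p ∧ p ≤ q).sort (· ≥ ·) =
      q :: (R.filter fun p => b < p ∧ p < q).sort (· ≥ ·) := by
  have hsplit : (R.filter fun p => b < p ∧ p ≤ q) =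
      Finset.cons q (R.filter fun p => b < p ∧ p < q) (by simp) := by
    ext p
    simp only [Finset.mem_filter, Finset.mem_cons]
    constructor
    · rintro ⟨hp, hbp, hpq⟩
      exact hpq.eq_or_lt.imp id fun hlt => ⟨hp, hbp, hlt⟩
    · rintro (rfl | ⟨hp, hbp, hpq⟩)
      · exact ⟨hq, hbq, le_rfl⟩
      · exact ⟨hp, hbp, hpq.le⟩
  rw [hsplit, Finset.sort_cons]
  simp +contextual [le_of_lt]

lemma Critical.exists_runI (hq : Critical i b R f q) (hb : Barrier i b R) (hf : IsMatching R f)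
    (hne : ∀ p ∈ R, f p ≠ i) :
    ∃ g, RunI i b R f g ∧
      algorithmI i (R.filter fun p => b < p ∧ p ≤ q) (mkArcs R f) = mkArcs R g := by
  have hl := IsDescEnum.sort R b q
  obtain ⟨g, k, hr, e⟩ := exists_foldI (hq.invariantI hb hf hne) hl
  exact ⟨g, .run hq hl hr, by simp only [algorithmI, sort_filter_le hq.mem hq.gt, e]⟩

lemma Ready.exists_runII (hg : Ready i b R g) :
    ∃ a, RunII i b R g a ∧
      algorithmII i (R.filter fun p => i < p ∧ p ≤ b) (mkArcs R g) = mkArcs R a := by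
  rcases hg.barrier.mem with rfl | hb
  · refine ⟨g, .skip rfl, ?_⟩
    rw [Finset.filter_false_of_mem fun p _ h => h.1.not_ge h.2, algorithmII, Finset.sort_empty]
  · have hib : i < b := hg.barrier.le.lt_of_ne fun e => hg.barrier.notMem (e ▸ hb)
    have hl := IsDescEnum.sort R i b
    obtain ⟨h, hbor, hborrow⟩ := exists_borrow hg hb
    have hre := hbor.isRearrangement hg hb
    obtain ⟨a, hfold, e⟩ :=
      exists_foldII hre.isMatching (hre.forall_ne hg.ne) hb hbor.apply_barrier_lt hl
    exact ⟨a, .run hib hb hl hbor hfold, by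
      simp only [algorithmII, sort_filter_le hb hib, hborrow, e]⟩

lemma IsFirstCrossing.critical (hq : IsFirstCrossing i R f m q) (hm : IsLastLarge i R f m)
    (hne : ∀ p ∈ R, f p ≠ i) (hib : i ≤ b) (hbq : b < f q)
    (hb : ∀ p ∈ R, i < p → (p ≤ b ↔ p < f q)) : Critical i b R f q := by
  have hqm := hq.left_lt
  have hmq := hq.gt
  have lt_left : ∀ p ∈ R, m < p → b < f p := fun p hp hmp => by
    have hip := hm.lt_left hne hp hmp
    by_contra! hpb
    exact (hq.le p hp hip (by omega) hmp).not_gt (by omega)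
  refine ⟨hq.mem, by omega, ⟨hbq, fun r hr hbr => ?_⟩, fun p hp hqp => lt_left p hp (by omega),
    m, hm.1.1, by omega, hm.1.2.2, lt_left⟩
  have := hb r hr (by omega)
  omega

lemma exists_runI (hf : IsMatching R f) (hi : i ∉ R) (hne : ∀ p ∈ R, f p ≠ i) :
    ∃ b g, Barrier i b R ∧ RunI i b R f g ∧
      region2 i (mkArcs R f) = (R.filter fun p => i < p ∧ p ≤ b) ∧
      algorithmI i (region1 i (mkArcs R f)) (mkArcs R f) = mkArcs R g := by
  have algorithmI_empty : algorithmI i ∅ (mkArcs R f) = mkArcs R f := by simp [algorithmI]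
  by_cases hlarge : ∃ m, IsLastLarge i R f m
  · obtain ⟨m, hm⟩ := hlarge
    by_cases hsmall : ∃ q, IsFirstCrossing i R f m q
    · obtain ⟨q, hq⟩ := hsmall
      obtain ⟨b, hb, hbq, hle⟩ := exists_barrier hi hq.small
      obtain ⟨g, hr, e⟩ := (hq.critical hm hne hb.le hbq hle).exists_runI hb hf hne
      refine ⟨b, g, hb, hr, ?_, ?_⟩
      · rw [region2_mkArcs hf.injOn hm hq]
        exact Finset.filter_congr fun p hp => and_congr_right fun hip => (hle p hp hip).symm
      · rw [region1_mkArcs hf.injOn hm hq, ← e]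
        congr 1
        refine Finset.filter_congr fun p hp => and_congr_left fun _ => ?_
        have hne' : f q ≠ p := fun h => hf.notMem q hq.mem (h ▸ hp)
        have := hle p hp
        have := hb.le
        omega
    · have hnone : ¬ ∃ m q, IsLastLarge i R f m ∧ IsFirstCrossing i R f m q :=
        fun ⟨m', q, hm', hq⟩ => hsmall ⟨q, hm.unique hm' ▸ hq⟩
      refine ⟨m, f, ⟨hi, hm.1.2.1.le, Or.inr hm.1.1⟩, .skip (Or.inr hm.1.2.2) fun p hp hmp => ?_,
        region2_mkArcs_of_not_exists_small hm hsmall,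
        by rw [region1_mkArcs_of_not_exists hnone, algorithmI_empty]⟩
      by_contra! hle
      exact hsmall (exists_isFirstCrossing ⟨p, hp, hm.lt_left hne hp hmp,
        hle.lt_of_ne fun h => hf.notMem p hp (h ▸ hm.1.1), hmp⟩)
  · refine ⟨i, f, ⟨hi, le_rfl, Or.inl rfl⟩, .skip (Or.inl rfl) fun p hp hip => ?_, ?_, ?_⟩
    · by_contra! hle
      exact hlarge (exists_isLastLarge ⟨p, hp, hip, hle.lt_of_ne (hne p hp)⟩)
    · rw [region2_mkArcs_of_not_exists_large hlarge,
        Finset.filter_false_of_mem fun p _ h => h.1.not_ge h.2]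
    · rw [region1_mkArcs_of_not_exists fun ⟨m, _, hm, _⟩ => hlarge ⟨m, hm⟩, algorithmI_empty]

lemma exists_run (hf : IsMatching R f) (hi : i ∉ R) (hne : ∀ p ∈ R, f p ≠ i) :
    ∃ b a, Run i b R f a ∧
      algorithmII i (region2 i (mkArcs R f)) (algorithmI i (region1 i (mkArcs R f)) (mkArcs R f)) =
        mkArcs R a := by
  obtain ⟨b, g, hb, hI, hregion, hg⟩ := exists_runI hf hi hne
  obtain ⟨a, hII, ha⟩ := (hI.ready hb hf hne).exists_runII
  exact ⟨b, a, ⟨hb, g, hI, hII⟩, by rw [hregion, hg, ha]⟩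

end ExistsRun

/-! ### Exposed arcs -/

/-- The left-hand endpoints of the arcs of `mkArcs R f` that are not nested in another arc. -/
def exposed (R : Finset ℕ) (f : ℕ → ℕ) : Finset ℕ :=
  (R.filter fun p => ∀ p' ∈ R, f p' < f p → p' < p).image f

/-- The elements of `R` between `i` and the first element of `E` to the right of `i`. When `E` is
the set of exposed left-hand endpoints, they are the right-hand endpoints of the second region. -/
def freeEnds (i : ℕ) (R E : Finset ℕ) : Finset ℕ :=
  R.filter fun r => i < r ∧ ∀ l ∈ E, i < l → r ≤ l

section Exposed

variable {i b p r t v x : ℕ} {R : Finset ℕ} {f g a : ℕ → ℕ}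

lemma mem_exposed :
    x ∈ exposed R f ↔ ∃ p ∈ R, (∀ p' ∈ R, f p' < f p → p' < p) ∧ f p = x := by
  simp [exposed, and_assoc]

lemma exists_isGreatest_left_lt (hr : r ∈ R) (hlt : f r < r) :
    ∃ t, IsGreatest {s | s ∈ R ∧ f s < r} t := by
  have hne : (R.filter fun s => f s < r).Nonempty := ⟨r, by simp [hr, hlt]⟩
  exact ⟨_, by simpa using Finset.isGreatest_max' _ hne⟩

lemma mem_exposed_of_isGreatest (ht : IsGreatest {s | s ∈ R ∧ f s < r} t) :
    f t ∈ exposed R f := by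
  refine mem_exposed.2 ⟨t, ht.1.1, fun p hp hlt => ?_, rfl⟩
  exact (ht.2 ⟨hp, hlt.trans ht.1.2⟩).lt_of_ne fun h => (h ▸ hlt).false

lemma forall_mem_exposed_le_iff (ht : IsGreatest {s | s ∈ R ∧ f s < r} t) :
    (∀ l ∈ exposed R f, x < l → r ≤ l) ↔ f t ≤ x := by
  constructor
  · intro h
    by_contra! hxt
    exact (h _ (mem_exposed_of_isGreatest ht) hxt).not_gt ht.1.2
  · intro htx l hl hxl
    obtain ⟨s, hs, hexp, rfl⟩ := mem_exposed.1 hl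
    by_contra! hsr
    exact (hexp t ht.1.1 (htx.trans_lt hxl)).not_ge (ht.2 ⟨hs, hsr⟩)

lemma exposed_insert (hv : ∀ p ∈ R, p < v) (hinj : Set.InjOn f (insert v R : Finset ℕ)) :
    exposed (insert v R) f = insert (f v) ((exposed R f).filter fun x => x < f v) := by
  ext x
  simp only [mem_exposed, Finset.mem_insert, Finset.mem_filter]
  constructor
  · rintro ⟨p, rfl | hp, hexp, rfl⟩
    · exact Or.inl rfl
    · refine Or.inr ⟨⟨p, hp, fun p' hp' => hexp p' (Or.inr hp'), rfl⟩, ?_⟩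
      by_contra! hle
      have hne : f v ≠ f p := fun e => (hv p hp).ne' (hinj (by simp) (by simp [hp]) e)
      exact (hv p hp).not_gt (hexp v (Or.inl rfl) (hle.lt_of_ne hne))
  · rintro (rfl | ⟨⟨p, hp, hexp, rfl⟩, hlt⟩)
    · refine ⟨v, Or.inl rfl, ?_, rfl⟩
      rintro p (rfl | hp) h
      · exact h.false.elim
      · exact hv p hp
    · refine ⟨p, Or.inr hp, ?_, rfl⟩
      rintro p' (rfl | hp') h
      · exact absurd h hlt.not_gt
      · exact hexp p' hp' h

namespace IsRearrangement

lemma mem_exposed_of_lt (h : IsRearrangement i R f g) (hx : x < i) (hexp : x ∈ exposed R f) :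
    x ∈ exposed R g := by
  obtain ⟨p, hp, hnest, rfl⟩ := mem_exposed.1 hexp
  obtain ⟨q, hq, e⟩ := h.exists_right hp
  refine mem_exposed.2 ⟨q, hq, fun q' hq' hlt => ?_, e⟩
  obtain ⟨p', hp', e'⟩ := h.exists_left hq'
  have hlt' : f p' < f p := by rwa [e', ← e]
  exact h.order p' hp' p hp q' hq' q hq e' e.symm (hlt'.trans hx) hx (hnest p' hp' hlt')

lemma exposed_filter_lt (h : IsRearrangement i R f g) (hf : IsMatching R f) :
    (exposed R g).filter (fun x => x < i) = (exposed R f).filter fun x => x < i := by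
  ext x
  simp only [Finset.mem_filter]
  exact and_congr_left fun hx => ⟨(h.symm hf).mem_exposed_of_lt hx, h.mem_exposed_of_lt hx⟩

end IsRearrangement

lemma RunI.le_of_mem_exposed (hr : RunI i b R f g) (hb : Barrier i b R) (hx : x ∈ exposed R f)
    (hix : i < x) : b ≤ x := by
  obtain ⟨s, hs, hexp, rfl⟩ := mem_exposed.1 hx
  cases hr with
  | skip hlarge hafter =>
    rcases hlarge with rfl | hlarge
    · exact hix.le
    · by_contra! hsb
      have hbR : b ∈ R := hb.mem.resolve_left (hix.trans hsb).ne'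
      exact hsb.not_gt (hafter s hs (hexp b hbR (hlarge.trans hix)))
  | run hq _ _ =>
    obtain ⟨m, hm, -, hlarge, hafter⟩ := hq.exists_large
    exact (hafter s hs (hexp m hm (hlarge.trans hix))).le

lemma RunI.lt_left_of_isGreatest (hr : RunI i b R f g) (hf : IsMatching R f) (hp : p ∈ R)
    (hbp : b < p) (ht : IsGreatest {s | s ∈ R ∧ f s < p} t) : b < f t := by
  cases hr with
  | skip _ hafter => exact hafter t ht.1.1 (hbp.trans_le (ht.2 ⟨hp, hf.lt p hp⟩))
  | @run _ q _ _ hq _ _ =>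
    have hqp : f q < p := (hq.adjoins.2 p hp hbp).lt_of_ne fun e => hf.notMem q hq.mem (e ▸ hp)
    rcases (ht.2 ⟨hq.mem, hqp⟩).eq_or_lt with rfl | hqt
    · exact hq.adjoins.1
    · exact hq.lt_left_of_gt t ht.1.1 hqt

lemma Run.filter_eq_freeEnds (hr : Run i b R f a) (hf : IsMatching R f) :
    (R.filter fun p => i < p ∧ p ≤ b) = freeEnds i R (exposed R f) := by
  obtain ⟨hb, g, hI, -⟩ := hr
  refine Finset.filter_congr fun p hp => and_congr_right fun _ => ?_
  obtain ⟨t, ht⟩ := exists_isGreatest_left_lt hp (hf.lt p hp)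
  rw [forall_mem_exposed_le_iff ht]
  constructor
  · intro hpb
    by_contra! hit
    exact (hI.le_of_mem_exposed hb (mem_exposed_of_isGreatest ht) hit).not_gt
      (ht.1.2.trans_le hpb)
  · intro hti
    by_contra! hbp
    exact (hI.lt_left_of_isGreatest hf hp hbp ht).not_ge (hti.trans hb.le)

end Exposed

/-! ### The p-major index -/

/-- The number of adjacent pairs in a list along which `f` increases. -/
def asc (f : ℕ → ℕ) : List ℕ → ℕ
  | a :: b :: l => (if f a < f b then 1 else 0) + asc f (b :: l)
  | _ => 0

/-- The right-hand endpoints of the arcs over `r`, in increasing order. Their labels form the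
sequence `σ(r)`. -/
def arcsOver (R : Finset ℕ) (f : ℕ → ℕ) (r : ℕ) : List ℕ :=
  (R.filter fun s => f s < r ∧ r ≤ s).sort (· ≤ ·)

/-- The p-major index of `mkArcs R f`. -/
def majNum (R : Finset ℕ) (f : ℕ → ℕ) : ℕ := ∑ r ∈ R, asc f (arcsOver R f r)

section ArcsOver

variable {r s t v x : ℕ} {R : Finset ℕ} {f : ℕ → ℕ} {l : List ℕ}

lemma asc_append_pair (f : ℕ → ℕ) (l : List ℕ) (t v : ℕ) :
    asc f (l ++ [t] ++ [v]) = asc f (l ++ [t]) + if f t < f v then 1 else 0 := by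
  induction l with
  | nil => simp [asc]
  | cons a l ih =>
    cases l with
    | nil => simp [asc]
    | cons b l =>
      simp only [List.cons_append, asc] at ih ⊢
      omega

lemma mem_arcsOver : s ∈ arcsOver R f r ↔ s ∈ R ∧ f s < r ∧ r ≤ s := by
  simp [arcsOver]

lemma pairwise_arcsOver (R : Finset ℕ) (f : ℕ → ℕ) (r : ℕ) : (arcsOver R f r).Pairwise (· < ·) :=
  (Finset.sortedLT_sort _).pairwise

lemma eq_arcsOver (h : l.Pairwise (· < ·)) (hl : ∀ s, s ∈ l ↔ s ∈ R ∧ f s < r ∧ r ≤ s) :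
    l = arcsOver R f r := by
  have hnodup : ∀ {l : List ℕ}, l.Pairwise (· < ·) → l.Nodup := fun h => h.imp LT.lt.ne
  have hperm : l.Perm (arcsOver R f r) :=
    (List.perm_ext_iff_of_nodup (hnodup h) (hnodup (pairwise_arcsOver R f r))).2 fun s => by
      rw [hl, mem_arcsOver]
  exact hperm.eq_of_pairwise (fun _ _ _ _ hlt hgt => absurd hlt hgt.not_gt) h
    (pairwise_arcsOver R f r)

lemma arcsOver_max (hv : v ∈ R) (hlt : f v < v) (hmax : ∀ p ∈ R, p ≤ v) :
    arcsOver R f v = [v] := by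
  refine (eq_arcsOver (by simp) fun s => ?_).symm
  rw [List.mem_singleton]
  constructor
  · rintro rfl; exact ⟨hv, hlt, le_rfl⟩
  · rintro ⟨hs, -, hle⟩; exact (hmax s hs).antisymm hle

lemma arcsOver_insert_of_le (h : r ≤ f v) : arcsOver (insert v R) f r = arcsOver R f r := by
  rw [arcsOver, Finset.filter_insert, if_neg fun h' => h.not_gt h'.1, arcsOver]

lemma arcsOver_insert_of_lt (hv : ∀ p ∈ R, p < v) (h : f v < r) (hrv : r ≤ v) :
    arcsOver (insert v R) f r = arcsOver R f r ++ [v] := by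
  refine (eq_arcsOver ?_ fun s => ?_).symm
  · rw [List.pairwise_append]
    refine ⟨pairwise_arcsOver R f r, by simp, fun s hs s' hs' => ?_⟩
    exact List.mem_singleton.1 hs' ▸ hv s (mem_arcsOver.1 hs).1
  · rw [List.mem_append, mem_arcsOver, List.mem_singleton, Finset.mem_insert]
    constructor
    · rintro (⟨hs, hpos⟩ | rfl)
      · exact ⟨Or.inr hs, hpos⟩
      · exact ⟨Or.inl rfl, h, hrv⟩
    · rintro ⟨rfl | hs, hpos⟩
      · exact Or.inr rfl
      · exact Or.inl ⟨hs, hpos⟩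

lemma arcsOver_eq_cons_filter (hlt : ∀ p ∈ R, f p < p) (hx : IsPrev R 0 r x) :
    arcsOver R f x = x :: (arcsOver R f r).filter fun s => f s < x := by
  refine (eq_arcsOver ?_ fun s => ?_).symm
  · refine List.pairwise_cons.2 ⟨fun s hs => ?_, (pairwise_arcsOver R f r).filter _⟩
    exact hx.lt.trans_le (mem_arcsOver.1 (List.mem_filter.1 hs).1).2.2
  · rw [List.mem_cons, List.mem_filter, mem_arcsOver, decide_eq_true_eq]
    constructor
    · rintro (rfl | ⟨⟨hs, -, hrs⟩, hleft⟩)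
      · exact ⟨hx.mem, hlt s hx.mem, le_rfl⟩
      · exact ⟨hs, hleft, hx.lt.le.trans hrs⟩
    · rintro ⟨hs, hleft, hxs⟩
      exact hxs.eq_or_lt.imp Eq.symm fun hxs =>
        ⟨⟨hs, hleft.trans hx.lt, hx.le_of_gt s hs hxs⟩, hleft⟩

lemma exists_arcsOver_eq_append (hr : r ∈ R) (hlt : f r < r) :
    ∃ l t, arcsOver R f r = l ++ [t] ∧ IsGreatest {s | s ∈ R ∧ f s < r} t := by
  obtain h | ⟨l, t, h⟩ := List.eq_nil_or_concat (arcsOver R f r)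
  · exact absurd (h ▸ mem_arcsOver.2 ⟨hr, hlt, le_rfl⟩) List.not_mem_nil
  · rw [List.concat_eq_append] at h
    obtain ⟨ht, htr, hrt⟩ := mem_arcsOver.1 (show t ∈ arcsOver R f r by simp [h])
    refine ⟨l, t, h, ⟨ht, htr⟩, fun s ⟨hs, hsr⟩ => ?_⟩
    by_contra! hts
    have hsl : s ∈ l ++ [t] := h ▸ mem_arcsOver.2 ⟨hs, hsr, (hrt.trans_lt hts).le⟩
    have hpairwise := List.pairwise_append.1 (h ▸ pairwise_arcsOver R f r)
    rcases List.mem_append.1 hsl with hsl | hst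
    · exact hts.not_gt (hpairwise.2.2 s hsl t List.mem_cons_self)
    · exact hts.ne' (List.mem_singleton.1 hst)

lemma asc_arcsOver_insert (hv : ∀ p ∈ R, p < v) (hinj : Set.InjOn f (insert v R : Finset ℕ))
    (hr : r ∈ R) (hlt : f r < r) :
    asc f (arcsOver (insert v R) f r) = asc f (arcsOver R f r) +
      if f v < r ∧ ∀ l ∈ exposed R f, f v < l → r ≤ l then 1 else 0 := by
  rcases lt_or_ge (f v) r with hvr | hrv
  · obtain ⟨l, t, h, ht⟩ := exists_arcsOver_eq_append hr hlt
    have hne : f t ≠ f v := fun e => (hv t ht.1.1).ne (hinj (by simp [ht.1.1]) (by simp) e)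
    rw [arcsOver_insert_of_lt hv hvr (hv r hr).le, h, asc_append_pair]
    simp only [forall_mem_exposed_le_iff ht, hvr, true_and, hne.le_iff_lt]
  · rw [arcsOver_insert_of_le hrv, if_neg fun h => h.1.not_ge hrv, add_zero]

lemma majNum_insert (hv : ∀ p ∈ R, p < v) (hinj : Set.InjOn f (insert v R : Finset ℕ))
    (hlt : ∀ p ∈ insert v R, f p < p) :
    majNum (insert v R) f = majNum R f + (freeEnds (f v) R (exposed R f)).card := by
  have hmax : asc f (arcsOver (insert v R) f v) = 0 := by
    rw [arcsOver_max (Finset.mem_insert_self v R) (hlt v (Finset.mem_insert_self v R)), asc]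
    · simp
    · exact Finset.forall_mem_insert _ _ _ |>.2 ⟨le_rfl, fun p hp => (hv p hp).le⟩
  rw [majNum, Finset.sum_insert fun h => (hv v h).false, hmax, zero_add, majNum, freeEnds,
    Finset.card_filter, ← Finset.sum_add_distrib]
  exact Finset.sum_congr rfl fun r hr =>
    asc_arcsOver_insert hv hinj hr (hlt r (Finset.mem_insert_of_mem hr))

end ArcsOver

section Labels

variable {r s t : ℕ} {R : Finset ℕ} {f : ℕ → ℕ} {l : List ℕ}

lemma label_mkArcs (e : ℕ × ℕ) : label (mkArcs R f) e = (R.filter fun p => e.1 ≤ f p).card := by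
  rw [label, mkArcs, Finset.filter_image, Finset.card_image_of_injective]
  exact fun _ _ h => congrArg Prod.snd h

lemma label_lt_label (hs : s ∈ R) (h : f s < f t) :
    label (mkArcs R f) (f t, t) < label (mkArcs R f) (f s, s) := by
  rw [label_mkArcs, label_mkArcs]
  refine Finset.card_lt_card (Finset.ssubset_iff_of_subset ?_ |>.2 ⟨s, ?_, ?_⟩)
  · exact Finset.monotone_filter_right R fun _ _ hle => h.le.trans hle
  · simp [hs]
  · simp [h]

lemma labelAt_mkArcs (hs : s ∈ R) : labelAt (mkArcs R f) s = label (mkArcs R f) (f s, s) := by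
  rw [labelAt, leftOf_mkArcs hs]

lemma labelAt_lt_labelAt_iff (hs : s ∈ R) (ht : t ∈ R) :
    labelAt (mkArcs R f) t < labelAt (mkArcs R f) s ↔ f s < f t := by
  rw [labelAt_mkArcs hs, labelAt_mkArcs ht]
  refine ⟨fun h => ?_, label_lt_label hs⟩
  by_contra! hle
  rcases hle.eq_or_lt with e | hlt
  · simp [label_mkArcs, e] at h
  · exact h.not_gt (label_lt_label ht hlt)

lemma labelAt_eq_labelAt_iff (hs : s ∈ R) (ht : t ∈ R) :
    labelAt (mkArcs R f) s = labelAt (mkArcs R f) t ↔ f s = f t := by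
  have := labelAt_lt_labelAt_iff (f := f) hs ht
  have := labelAt_lt_labelAt_iff (f := f) ht hs
  omega

lemma des_map_labelAt (hl : ∀ s ∈ l, s ∈ R) :
    des (l.map (labelAt (mkArcs R f))) = asc f l := by
  induction l with
  | nil => rfl
  | cons a l ih =>
    cases l with
    | nil => rfl
    | cons b l =>
      have ih := ih fun s hs => hl s (List.mem_cons_of_mem a hs)
      simp only [List.map_cons, des, asc] at ih ⊢
      rw [ih, if_congr (labelAt_lt_labelAt_iff (hl a (by simp)) (hl b (by simp))) rfl rfl]

lemma sigmaFrom_mkArcs (hlt : ∀ p ∈ R, f p < p) (hl : IsDescEnum R 0 r l) :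
    sigmaFrom (mkArcs R f) r ((arcsOver R f r).map (labelAt (mkArcs R f))) l =
      l.map fun r' => (arcsOver R f r').map (labelAt (mkArcs R f)) := by
  induction l generalizing r with
  | nil => rfl
  | cons x l ih =>
    have hdelete : (((arcsOver R f r).map (labelAt (mkArcs R f))).filter fun a =>
        ¬ ∃ e ∈ mkArcs R f, label (mkArcs R f) e = a ∧ x ≤ e.1 ∧ e.1 < r) =
        ((arcsOver R f r).filter fun s => f s < x).map (labelAt (mkArcs R f)) := by
      rw [List.filter_map]
      congr 1
      refine List.filter_congr fun s hs => ?_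
      obtain ⟨hs, hsr, -⟩ := mem_arcsOver.1 hs
      simp only [Function.comp, exists_mem_mkArcs, decide_eq_decide, not_exists, not_and]
      constructor
      · intro h
        by_contra! hxs
        exact h s hs (labelAt_mkArcs hs).symm hxs hsr
      · intro hsx t ht e hxt _
        rw [← labelAt_mkArcs ht, labelAt_eq_labelAt_iff ht hs] at e
        exact hsx.not_ge (e ▸ hxt)
    simp only [sigmaFrom, List.map_cons]
    rw [hdelete, ← List.map_cons, ← arcsOver_eq_cons_filter hlt hl.isPrev, ih hl.tail]

lemma sigmas_mkArcs (hlt : ∀ p ∈ R, f p < p) :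
    sigmas (mkArcs R f) =
      (R.sort (· ≥ ·)).map fun r => (arcsOver R f r).map (labelAt (mkArcs R f)) := by
  rw [sigmas, rightEnds_mkArcs]
  rcases R.eq_empty_or_nonempty with rfl | hR
  · simp
  · obtain ⟨r, hr⟩ : ∃ r, IsGreatest (R : Set ℕ) r := ⟨_, Finset.isGreatest_max' R hR⟩
    have hpos : ∀ p ∈ R, 0 < p := fun p hp => Nat.zero_lt_of_lt (hlt p hp)
    have hsort : R.sort (· ≥ ·) = r :: (R.filter fun p => 0 < p ∧ p < r).sort (· ≥ ·) := by
      rw [← sort_filter_le hr.1 (hpos r hr.1),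
        Finset.filter_true_of_mem fun p hp => ⟨hpos p hp, hr.2 hp⟩]
    have hmax := arcsOver_max hr.1 (hlt r hr.1) fun p hp => hr.2 hp
    have hrest := sigmaFrom_mkArcs hlt (IsDescEnum.sort R 0 r)
    rw [hmax] at hrest
    simp only [hsort, List.map_cons, List.map_nil, hmax] at hrest ⊢
    rw [hrest]

lemma arcPmaj_mkArcs (hlt : ∀ p ∈ R, f p < p) : arcPmaj (mkArcs R f) = majNum R f := by
  rw [arcPmaj, sigmas_mkArcs hlt, List.map_map, majNum, ← Finset.sort_toFinset R (· ≥ ·),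
    List.sum_toFinset _ (Finset.sort_nodup _ _), Finset.sort_toFinset]
  congr 1
  exact List.map_congr_left fun r _ => des_map_labelAt fun s hs => (mem_arcsOver.1 hs).1

end Labels

/-! ### The map on matchings -/

/-- The matching `g` is the image of the matching `f` under `phi`. The remaining fields are what
the induction on the last vertex carries along: the exposed arcs keep their left-hand endpoints,
and the crossings of `g` count the p-major index of `f`. -/
structure IsPhiImage (R : Finset ℕ) (f g : ℕ → ℕ) : Prop where
  phi_eq : phi (mkArcs R f) = mkArcs R g
  isMatching : IsMatching R g
  image_eq : R.image g = R.image f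
  exposed_eq : exposed R g = exposed R f
  crossNum_eq : crossNum R g = majNum R f

section Phi

variable {i b v : ℕ} {R : Finset ℕ} {f f' g g' a : ℕ → ℕ}

lemma eq_and_eqOn_of_insert_mkArcs_eq {x x' : ℕ} (hv : ∀ p ∈ R, p < v)
    (h : insert (x, v) (mkArcs R f) = insert (x', v) (mkArcs R g)) : x = x' ∧ Set.EqOn f g R := by
  have hx : (x, v) ∈ insert (x', v) (mkArcs R g) := h ▸ Finset.mem_insert_self _ _
  refine ⟨?_, fun p hp => ?_⟩
  · rcases Finset.mem_insert.1 hx with hx | hx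
    · exact congrArg Prod.fst hx
    · exact absurd (mem_mkArcs.1 hx).1 fun hvR => (hv v hvR).false
  · have hp' : (f p, p) ∈ insert (x', v) (mkArcs R g) :=
      h ▸ Finset.mem_insert_of_mem (mem_mkArcs.2 ⟨hp, rfl⟩)
    rcases Finset.mem_insert.1 hp' with e | hp'
    · exact absurd (congrArg Prod.snd e) (hv p hp).ne
    · exact (mem_mkArcs.1 hp').2

lemma exposed_congr (h : Set.EqOn f g R) : exposed R f = exposed R g := by
  ext x
  simp only [mem_exposed]
  refine exists_congr fun p => and_congr_right fun hp => ?_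
  rw [h hp]
  exact and_congr_left fun _ => forall₂_congr fun p' hp' => by rw [h hp']

lemma IsMatching.mono {R' : Finset ℕ} (hf : IsMatching R f) (h : R' ⊆ R) : IsMatching R' f where
  injOn := hf.injOn.mono h
  lt p hp := hf.lt p (h hp)
  notMem p hp hp' := hf.notMem p (h hp) (h hp')

lemma IsMatching.of_image_eq (hf : IsMatching R f) (himage : R.image g = R.image f)
    (hlt : ∀ p ∈ R, g p < p) : IsMatching R g where
  injOn := Finset.card_image_iff.1 (himage ▸ Finset.card_image_iff.2 hf.injOn)
  lt := hlt
  notMem p hp := by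
    obtain ⟨q, hq, e⟩ := Finset.mem_image.1 (himage ▸ Finset.mem_image_of_mem g hp)
    exact e ▸ hf.notMem q hq

lemma phi_mkArcs_insert (hv : ∀ p ∈ R, p < v) :
    phi (mkArcs (insert v R) f) = insert (f v, v) (algorithmII (f v)
      (region2 (f v) (phi (mkArcs R f)))
        (algorithmI (f v) (region1 (f v) (phi (mkArcs R f))) (phi (mkArcs R f)))) := by
  have hvR : v ∉ R := fun h => (hv v h).false
  have hne : (rightEnds (mkArcs (insert v R) f)).Nonempty := by simp
  have hmax : (rightEnds (mkArcs (insert v R) f)).max' hne = v := by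
    rw [Finset.max'_eq_iff, rightEnds_mkArcs]
    exact ⟨Finset.mem_insert_self v R,
      (Finset.forall_mem_insert _ _ _).2 ⟨le_rfl, fun p hp => (hv p hp).le⟩⟩
  rw [phi, dif_pos hne]
  simp only [hmax]
  rw [leftOf_mkArcs (Finset.mem_insert_self v R), filter_mkArcs_ne, Finset.erase_insert hvR]

lemma card_large_add_card_le (hf : IsMatching R f) :
    (R.filter fun p => i < p ∧ f p < i).card + (R.filter fun p => p ≤ i).card =
      ((R.image f).filter fun x => x < i).card := by
  have hdisj : Disjoint (R.filter fun p => i < p ∧ f p < i) (R.filter fun p => p ≤ i) :=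
    Finset.disjoint_filter.2 fun p _ hlarge => hlarge.1.not_ge
  rw [Finset.filter_image, Finset.card_image_of_injOn (hf.injOn.mono (Finset.filter_subset _ _)),
    ← Finset.card_union_of_disjoint hdisj, ← Finset.filter_or]
  refine congrArg Finset.card (Finset.filter_congr fun p hp => ?_)
  have := hf.lt p hp
  omega

lemma crossNum_insert_last (hv : ∀ p ∈ R, p < v) :
    crossNum (insert v R) f = crossNum R f + (R.filter fun p => f v < p ∧ f p < f v).card := by
  have hvR : v ∉ R := fun h => (hv v h).false
  have hrow : ∑ q ∈ R, crossInd f v q = 0 := Finset.sum_eq_zero fun q hq =>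
    if_neg fun h => h.2.2.not_gt (hv q hq)
  have hdiag : crossInd f v v = 0 := if_neg fun h => h.1.false
  rw [crossNum, Finset.sum_insert hvR, Finset.sum_insert hvR, hrow, hdiag, zero_add, zero_add,
    crossNum, Finset.card_filter, ← Finset.sum_add_distrib]
  refine Finset.sum_congr rfl fun p hp => ?_
  rw [Finset.sum_insert hvR, add_comm]
  have := hv p hp
  exact congrArg _ (if_congr (by omega) rfl rfl)

lemma Run.crossNum_add_card_large (hr : Run i b R f a) (hf : IsMatching R f)
    (hne : ∀ p ∈ R, f p ≠ i) :
    crossNum R a + (R.filter fun p => i < p ∧ a p < i).card =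
      crossNum R f + (freeEnds i R (exposed R f)).card := by
  have hre := hr.isRearrangement hf hne
  have hcard : (R.filter fun p => i < p ∧ a p < i).card =
      (R.filter fun p => i < p ∧ f p < i).card := by
    have hlargeEnds := card_large_add_card_le (i := i) hre.isMatching
    rw [hre.image_eq, ← card_large_add_card_le hf] at hlargeEnds
    exact Nat.add_right_cancel hlargeEnds
  rw [hcard, hr.crossNum_add hf hne, hr.filter_eq_freeEnds hf]

namespace IsPhiImage

lemma congr (hg : IsPhiImage R f g) (h : Set.EqOn g g' R) : IsPhiImage R f g' where
  phi_eq := hg.phi_eq.trans (mkArcs_congr h)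
  isMatching := hg.isMatching.of_image_eq (Finset.image_congr h).symm
    fun p hp => h hp ▸ hg.isMatching.lt p hp
  image_eq := (Finset.image_congr h).symm.trans hg.image_eq
  exposed_eq := (exposed_congr h).symm.trans hg.exposed_eq
  crossNum_eq := (crossNum_congr h).symm.trans hg.crossNum_eq

lemma forall_ne_last (hv : ∀ p ∈ R, p < v) (hf : IsMatching (insert v R) f)
    (hg : IsPhiImage R f g) : ∀ p ∈ R, g p ≠ f v := by
  intro p hp e
  obtain ⟨q, hq, e'⟩ := Finset.mem_image.1 (hg.image_eq ▸ Finset.mem_image_of_mem g hp)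
  exact (hv q hq).ne (hf.injOn (by simp [hq]) (by simp) (e'.trans e))

lemma exists_run (hv : ∀ p ∈ R, p < v) (hf : IsMatching (insert v R) f)
    (hg : IsPhiImage R f g) :
    ∃ b a, Run (f v) b R g a ∧
      phi (mkArcs (insert v R) f) = insert (f v, v) (mkArcs R a) := by
  have hi : f v ∉ R := fun h => hf.notMem v (by simp) (by simp [h])
  obtain ⟨b, a, hr, e⟩ := MatchingFoata.exists_run hg.isMatching hi (hg.forall_ne_last hv hf)
  exact ⟨b, a, hr, by rw [phi_mkArcs_insert hv, hg.phi_eq, e]⟩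

lemma insert_last (hv : ∀ p ∈ R, p < v) (hf : IsMatching (insert v R) f)
    (hg : IsPhiImage R f g) (hr : Run (f v) b R g a)
    (hphi : phi (mkArcs (insert v R) f) = insert (f v, v) (mkArcs R a))
    (hga : Set.EqOn g' a R) (hgv : g' v = f v) : IsPhiImage (insert v R) f g' := by
  have hne := hg.forall_ne_last hv hf
  have hre := hr.isRearrangement hg.isMatching hne
  have himage : (insert v R).image g' = (insert v R).image f := by
    rw [Finset.image_insert, Finset.image_insert, Finset.image_congr hga, hre.image_eq,
      hg.image_eq, hgv]
  have hlt : ∀ p ∈ insert v R, g' p < p := (Finset.forall_mem_insert _ _ _).2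
    ⟨hgv ▸ hf.lt v (Finset.mem_insert_self v R), fun p hp => hga hp ▸ hre.isMatching.lt p hp⟩
  have hmatching := hf.of_image_eq himage hlt
  refine ⟨?_, hmatching, himage, ?_, ?_⟩
  · rw [hphi, ← mkArcs_congr hga, ← hgv, mkArcs, mkArcs, Finset.image_insert]
  · rw [exposed_insert hv hmatching.injOn, exposed_insert hv hf.injOn, hgv, exposed_congr hga,
      hre.exposed_filter_lt hg.isMatching, hg.exposed_eq]
  · have hlarge : (R.filter fun p => f v < p ∧ g' p < f v) =
        R.filter fun p => f v < p ∧ a p < f v := Finset.filter_congr fun p hp => by rw [hga hp]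
    rw [crossNum_insert_last hv, hgv, hlarge, crossNum_congr hga,
      hr.crossNum_add_card_large hg.isMatching hne, hg.crossNum_eq, hg.exposed_eq,
      majNum_insert hv hf.injOn hf.lt]

end IsPhiImage

lemma exists_isPhiImage (hf : IsMatching R f) : ∃ g, IsPhiImage R f g := by
  induction R using Finset.induction_on_max with
  | empty =>
    refine ⟨f, ?_, hf, rfl, rfl, by simp [crossNum, majNum]⟩
    rw [phi, dif_neg (by simp)]
    simp [mkArcs]
  | insert v R hv ih =>
    obtain ⟨g, hg⟩ := ih (hf.mono (Finset.subset_insert v R))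
    obtain ⟨b, a, hr, hphi⟩ := hg.exists_run hv hf
    exact ⟨Function.update a v (f v), hg.insert_last hv hf hr hphi
      (fun p hp => Function.update_of_ne (hv p hp).ne _ _) (Function.update_self ..)⟩

lemma eqOn_of_phi_eq (hf : IsMatching R f) (hf' : IsMatching R f')
    (h : phi (mkArcs R f) = phi (mkArcs R f')) : Set.EqOn f f' R := by
  induction R using Finset.induction_on_max with
  | empty => simp
  | insert v R hv ih =>
    have hfR := hf.mono (Finset.subset_insert v R)
    have hfR' := hf'.mono (Finset.subset_insert v R)
    obtain ⟨g, hg⟩ := exists_isPhiImage hfR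
    obtain ⟨g', hg'⟩ := exists_isPhiImage hfR'
    obtain ⟨b, a, hr, hphi⟩ := hg.exists_run hv hf
    obtain ⟨b', a', hr', hphi'⟩ := hg'.exists_run hv hf'
    have hne := hg.forall_ne_last hv hf
    have hne' := hg'.forall_ne_last hv hf'
    obtain ⟨hlast, ha⟩ := eq_and_eqOn_of_insert_mkArcs_eq hv (hphi.symm.trans (h.trans hphi'))
    rw [← hlast] at hr' hne'
    have hgg : Set.EqOn g g' R := hr.injective hr' hg.isMatching hne hg'.isMatching hne' ha
    have hphiR : phi (mkArcs R f) = phi (mkArcs R f') := by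
      rw [hg.phi_eq, hg'.phi_eq, mkArcs_congr hgg]
    exact (Finset.forall_mem_insert v R fun p => f p = f' p).2
      ⟨hlast, fun p hp => ih hfR hfR' hphiR hp⟩

end Phi

/-! ### Splitting the vertices -/

/-- The vertices `y⁰` of the split arc set, for `y ∈ R`: `x⁰` is encoded as `2 * x` and `x¹` as
`2 * x + 1`. -/
def double (R : Finset ℕ) : Finset ℕ := R.image (2 * ·)

/-- The function whose arcs over `double R` are the arcs of `f` over `R` with split vertices. -/
def splitFun (f : ℕ → ℕ) (p : ℕ) : ℕ := 2 * f (p / 2) + 1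

section Split

variable {i p v y : ℕ} {R E : Finset ℕ} {f g h : ℕ → ℕ}

lemma splitFun_two_mul (f : ℕ → ℕ) (y : ℕ) : splitFun f (2 * y) = 2 * f y + 1 := by
  simp [splitFun]

lemma mem_double : p ∈ double R ↔ ∃ y ∈ R, 2 * y = p := by simp [double]

lemma two_mul_mem_double : 2 * y ∈ double R ↔ y ∈ R := by simp [double]

lemma forall_mem_double {Q : ℕ → Prop} : (∀ p ∈ double R, Q p) ↔ ∀ y ∈ R, Q (2 * y) := by
  simp [double]

lemma injective_two_mul : Function.Injective fun y : ℕ => 2 * y :=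
  mul_right_injective₀ two_ne_zero

lemma card_double (R : Finset ℕ) : (double R).card = R.card :=
  Finset.card_image_of_injective R injective_two_mul

lemma double_insert (v : ℕ) (R : Finset ℕ) : double (insert v R) = insert (2 * v) (double R) :=
  Finset.image_insert _ _ _

lemma image_splitFun_double (R : Finset ℕ) (f : ℕ → ℕ) :
    (double R).image (splitFun f) = (R.image f).image (2 * · + 1) := by
  simp only [double, Finset.image_image]
  exact Finset.image_congr fun y _ => splitFun_two_mul f y

lemma eqOn_splitFun_iff : Set.EqOn (splitFun f) (splitFun g) (double R) ↔ Set.EqOn f g R := by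
  simp only [Set.EqOn, Finset.mem_coe, forall_mem_double, splitFun_two_mul, add_left_inj,
    mul_right_inj' two_ne_zero]

lemma splitArcs_mkArcs (R : Finset ℕ) (f : ℕ → ℕ) :
    splitArcs (mkArcs R f) = mkArcs (double R) (splitFun f) := by
  simp only [splitArcs, mkArcs, double, Finset.image_image]
  exact Finset.image_congr fun y _ => by simp [splitFun_two_mul]

lemma mergeArcs_mkArcs_splitFun (R : Finset ℕ) (f : ℕ → ℕ) :
    mergeArcs (mkArcs (double R) (splitFun f)) = mkArcs R f := by
  simp only [mergeArcs, mkArcs, double, Finset.image_image]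
  refine Finset.image_congr fun y _ => Prod.ext ?_ (Nat.mul_div_cancel_left y two_pos)
  simp only [Function.comp_apply, splitFun_two_mul]
  omega

lemma isMatching_splitFun_iff :
    IsMatching (double R) (splitFun f) ↔ Set.InjOn f R ∧ ∀ p ∈ R, f p < p := by
  constructor
  · refine fun hf => ⟨fun y hy z hz e => ?_, fun y hy => ?_⟩
    · exact injective_two_mul (hf.injOn (two_mul_mem_double.2 hy) (two_mul_mem_double.2 hz)
        (by rw [splitFun_two_mul, splitFun_two_mul, e]))
    · have hlt := hf.lt _ (two_mul_mem_double.2 hy)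
      rw [splitFun_two_mul] at hlt
      omega
  · rintro ⟨hinj, hlt⟩
    refine ⟨fun p hp q hq e => ?_, forall_mem_double.2 fun y hy => ?_,
      forall_mem_double.2 fun y _ hmem => ?_⟩
    · obtain ⟨y, hy, rfl⟩ := mem_double.1 hp
      obtain ⟨z, hz, rfl⟩ := mem_double.1 hq
      rw [splitFun_two_mul, splitFun_two_mul] at e
      rw [hinj hy hz (by omega)]
    · have := hlt y hy
      rw [splitFun_two_mul]
      omega
    · obtain ⟨z, -, hz⟩ := mem_double.1 hmem
      rw [splitFun_two_mul] at hz
      omega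

lemma crossNum_double (R : Finset ℕ) (f : ℕ → ℕ) :
    crossNum (double R) (splitFun f) = crossNum R f := by
  simp only [crossNum, double, Finset.sum_image injective_two_mul.injOn, crossInd,
    splitFun_two_mul]
  exact Finset.sum_congr rfl fun p _ => Finset.sum_congr rfl fun q _ => if_congr (by omega) rfl rfl

lemma exposed_double (R : Finset ℕ) (f : ℕ → ℕ) :
    exposed (double R) (splitFun f) = (exposed R f).image (2 * · + 1) := by
  simp only [exposed, double, Finset.filter_image, Finset.forall_mem_image, Finset.image_image,
    Function.comp_def, splitFun_two_mul, add_lt_add_iff_right, Nat.mul_lt_mul_left two_pos]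

lemma freeEnds_double (i : ℕ) (R E : Finset ℕ) :
    freeEnds (2 * i + 1) (double R) (E.image (2 * · + 1)) = double (freeEnds i R E) := by
  simp only [freeEnds, double, Finset.filter_image, Finset.forall_mem_image]
  refine congrArg _ (Finset.filter_congr fun y _ => and_congr (by omega) ?_)
  exact forall₂_congr fun l _ => by omega

lemma majNum_double (hinj : Set.InjOn f R) (hlt : ∀ p ∈ R, f p < p) :
    majNum (double R) (splitFun f) = majNum R f := by
  induction R using Finset.induction_on_max with
  | empty => simp [majNum, double]
  | insert v R hv ih =>
    have hsplit := isMatching_splitFun_iff.2 ⟨hinj, hlt⟩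
    have hmax : ∀ p ∈ double R, p < 2 * v :=
      forall_mem_double.2 fun y hy => Nat.mul_lt_mul_of_pos_left (hv y hy) two_pos
    rw [double_insert] at hsplit ⊢
    rw [majNum_insert hv hinj hlt, majNum_insert hmax hsplit.injOn hsplit.lt, splitFun_two_mul,
      exposed_double, freeEnds_double, card_double,
      ih (hinj.mono (by simp)) fun p hp => hlt p (Finset.mem_insert_of_mem hp)]

lemma exists_eqOn_splitFun (himage : (double R).image g = (double R).image (splitFun f)) :
    ∃ h, Set.EqOn g (splitFun h) (double R) := by
  refine ⟨fun y => g (2 * y) / 2, forall_mem_double.2 fun y hy => ?_⟩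
  obtain ⟨p, -, e⟩ := Finset.mem_image.1
    (himage ▸ Finset.mem_image_of_mem g (two_mul_mem_double.2 hy))
  rw [splitFun_two_mul, ← e, splitFun]
  omega

lemma exists_isPhiImage_splitFun (hinj : Set.InjOn f R) (hlt : ∀ p ∈ R, f p < p) :
    ∃ h, IsPhiImage (double R) (splitFun f) (splitFun h) := by
  obtain ⟨g, hg⟩ := exists_isPhiImage (isMatching_splitFun_iff.2 ⟨hinj, hlt⟩)
  obtain ⟨h, hgh⟩ := exists_eqOn_splitFun hg.image_eq
  exact ⟨h, hg.congr hgh⟩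

lemma IsPhiImage.image_eq_of_splitFun (hh : IsPhiImage (double R) (splitFun f) (splitFun h)) :
    R.image h = R.image f := by
  have himage := hh.image_eq
  rw [image_splitFun_double, image_splitFun_double] at himage
  exact Finset.image_injective (fun a b e => by simpa using e) himage

end Split

/-! ### Partitions and their arcs -/

/-- The arc sets of partitions of `[n]`: every element of `[n]` is the left-hand endpoint of at
most one arc and the right-hand endpoint of at most one arc. -/
structure IsArcSet (n : ℕ) (A : Finset (ℕ × ℕ)) : Prop where
  mem : ∀ e ∈ A, e.1 ∈ Finset.Icc 1 n ∧ e.2 ∈ Finset.Icc 1 n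
  lt : ∀ e ∈ A, e.1 < e.2
  injOn_fst : Set.InjOn Prod.fst (A : Set (ℕ × ℕ))
  injOn_snd : Set.InjOn Prod.snd (A : Set (ℕ × ℕ))

/-- The elements `x` and `y` lie in a common block of `P`. -/
def SameBlock {n : ℕ} (P : Finpartition (Finset.Icc 1 n)) (x y : ℕ) : Prop :=
  ∃ B ∈ P.parts, x ∈ B ∧ y ∈ B

section Partitions

variable {n : ℕ} {P Q : Finpartition (Finset.Icc 1 n)} {B : Finset ℕ} {x y z : ℕ}

namespace SameBlock

lemma refl (hx : x ∈ Finset.Icc 1 n) : SameBlock P x x := by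
  obtain ⟨B, hB, hxB⟩ := P.exists_mem hx
  exact ⟨B, hB, hxB, hxB⟩

lemma symm (h : SameBlock P x y) : SameBlock P y x := by
  obtain ⟨B, hB, hx, hy⟩ := h
  exact ⟨B, hB, hy, hx⟩

lemma mem_left (h : SameBlock P x y) : x ∈ Finset.Icc 1 n := by
  obtain ⟨B, hB, hx, -⟩ := h
  exact P.subset hB hx

lemma iff_mem (hB : B ∈ P.parts) (hx : x ∈ B) : SameBlock P x y ↔ y ∈ B := by
  refine ⟨fun ⟨C, hC, hxC, hy⟩ => ?_, fun hy => ⟨B, hB, hx, hy⟩⟩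
  rwa [P.eq_of_mem_parts hB hC hx hxC]

lemma trans (h : SameBlock P x y) (h' : SameBlock P y z) : SameBlock P x z := by
  obtain ⟨B, hB, hx, hy⟩ := h
  exact ⟨B, hB, hx, (iff_mem hB hy).1 h'⟩

end SameBlock

lemma mem_arcs : (x, y) ∈ arcs P ↔
    x < y ∧ SameBlock P x y ∧ ∀ c, SameBlock P x c → ¬ (x < c ∧ c < y) := by
  simp only [arcs, Finset.mem_filter, Finset.mem_product]
  constructor
  · rintro ⟨-, hxy, B, hB, hx, hy, hbetween⟩
    exact ⟨hxy, ⟨B, hB, hx, hy⟩, fun c hc => hbetween c ((SameBlock.iff_mem hB hx).1 hc)⟩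
  · rintro ⟨hxy, hblock, hbetween⟩
    refine ⟨⟨hblock.mem_left, hblock.symm.mem_left⟩, hxy, ?_⟩
    obtain ⟨B, hB, hx, hy⟩ := hblock
    exact ⟨B, hB, hx, hy, fun c hc => hbetween c ((SameBlock.iff_mem hB hx).2 hc)⟩

lemma isArcSet_arcs (P : Finpartition (Finset.Icc 1 n)) : IsArcSet n (arcs P) where
  mem e he := by
    obtain ⟨-, h, -⟩ := mem_arcs.1 he
    exact ⟨h.mem_left, h.symm.mem_left⟩
  lt e he := (mem_arcs.1 he).1
  injOn_fst := by
    rintro ⟨x, y⟩ he ⟨_, y'⟩ he' rfl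
    obtain ⟨hlt, hblock, hbetween⟩ := mem_arcs.1 he
    obtain ⟨hlt', hblock', hbetween'⟩ := mem_arcs.1 he'
    have := hbetween y' hblock'
    have := hbetween' y hblock
    exact Prod.ext rfl (show y = y' by omega)
  injOn_snd := by
    rintro ⟨x, y⟩ he ⟨x', _⟩ he' rfl
    obtain ⟨hlt, hblock, hbetween⟩ := mem_arcs.1 he
    obtain ⟨hlt', hblock', hbetween'⟩ := mem_arcs.1 he'
    have := hbetween x' (hblock.trans hblock'.symm)
    have := hbetween' x (hblock'.trans hblock.symm)
    exact Prod.ext (show x = x' by omega) rfl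

namespace SameBlock

lemma exists_arc_right (h : SameBlock P x y) (hxy : x < y) : ∃ z, (x, z) ∈ arcs P ∧ z ≤ y := by
  obtain ⟨B, hB, hx, hy⟩ := h
  have hne : (B.filter (x < ·)).Nonempty := ⟨y, by simp [hy, hxy]⟩
  obtain ⟨z, hz⟩ : ∃ z, IsLeast {c | c ∈ B ∧ x < c} z :=
    ⟨_, by simpa using Finset.isLeast_min' _ hne⟩
  refine ⟨z, mem_arcs.2 ⟨hz.1.2, ⟨B, hB, hx, hz.1.1⟩, fun c hc hpos => ?_⟩, hz.2 ⟨hy, hxy⟩⟩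
  exact (hz.2 ⟨(iff_mem hB hx).1 hc, hpos.1⟩).not_gt hpos.2

lemma exists_arc_left (h : SameBlock P x y) (hxy : x < y) : ∃ z, (z, y) ∈ arcs P := by
  obtain ⟨B, hB, hx, hy⟩ := h
  have hne : (B.filter (· < y)).Nonempty := ⟨x, by simp [hx, hxy]⟩
  obtain ⟨z, hz⟩ : ∃ z, IsGreatest {c | c ∈ B ∧ c < y} z :=
    ⟨_, by simpa using Finset.isGreatest_max' _ hne⟩
  refine ⟨z, mem_arcs.2 ⟨hz.1.2, ⟨B, hB, hz.1.1, hy⟩, fun c hc hpos => ?_⟩⟩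
  exact (hz.2 ⟨(iff_mem hB hz.1.1).1 hc, hpos.2⟩).not_gt hpos.1

lemma of_arcs_subset_of_le (h : arcs P ⊆ arcs Q) (hs : SameBlock P x y) (hxy : x ≤ y) :
    SameBlock Q x y := by
  induction hd : y - x using Nat.strong_induction_on generalizing x with
  | _ d ih =>
    rcases hxy.eq_or_lt with rfl | hlt
    · exact refl hs.mem_left
    · obtain ⟨z, hz, hzy⟩ := hs.exists_arc_right hlt
      obtain ⟨hxz, hblock, -⟩ := mem_arcs.1 hz
      exact (mem_arcs.1 (h hz)).2.1.trans
        (ih (y - z) (by omega) (hblock.symm.trans hs) hzy rfl)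

lemma of_arcs_subset (h : arcs P ⊆ arcs Q) (hs : SameBlock P x y) : SameBlock Q x y :=
  (le_total x y).elim (hs.of_arcs_subset_of_le h) fun hyx =>
    (hs.symm.of_arcs_subset_of_le h hyx).symm

end SameBlock

lemma parts_subset_of_arcs_eq (h : arcs P = arcs Q) : P.parts ⊆ Q.parts := by
  intro B hB
  obtain ⟨x, hx⟩ := P.nonempty_of_mem_parts hB
  obtain ⟨C, hC, hxC⟩ := Q.exists_mem (P.subset hB hx)
  have hBC : B = C := by
    ext y
    rw [← SameBlock.iff_mem hB hx, ← SameBlock.iff_mem hC hxC]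
    exact ⟨.of_arcs_subset h.subset, .of_arcs_subset h.symm.subset⟩
  exact hBC ▸ hC

lemma arcs_injective : Function.Injective (arcs : Finpartition (Finset.Icc 1 n) → _) :=
  fun _ _ h =>
    Finpartition.ext ((parts_subset_of_arcs_eq h).antisymm (parts_subset_of_arcs_eq h.symm))

lemma minElems_eq (P : Finpartition (Finset.Icc 1 n)) :
    minElems P = Finset.Icc 1 n \ (arcs P).image Prod.snd := by
  rw [minElems, ← Finset.filter_notMem_eq_sdiff]
  refine Finset.filter_congr fun x hx => ⟨?_, fun h => ?_⟩
  · rintro ⟨B, hB, hxB, hmin⟩ hmem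
    obtain ⟨⟨w, _⟩, he, rfl⟩ := Finset.mem_image.1 hmem
    obtain ⟨hlt, hblock, -⟩ := mem_arcs.1 he
    exact hlt.not_ge (hmin w ((SameBlock.iff_mem hB hxB).1 hblock.symm))
  · obtain ⟨B, hB, hxB⟩ := P.exists_mem hx
    refine ⟨B, hB, hxB, fun y hy => ?_⟩
    by_contra! hlt
    obtain ⟨z, hz⟩ := SameBlock.exists_arc_left ⟨B, hB, hy, hxB⟩ hlt
    exact h (Finset.mem_image_of_mem Prod.snd hz)

lemma maxElems_eq (P : Finpartition (Finset.Icc 1 n)) :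
    maxElems P = Finset.Icc 1 n \ (arcs P).image Prod.fst := by
  rw [maxElems, ← Finset.filter_notMem_eq_sdiff]
  refine Finset.filter_congr fun x hx => ⟨?_, fun h => ?_⟩
  · rintro ⟨B, hB, hxB, hmax⟩ hmem
    obtain ⟨⟨_, w⟩, he, rfl⟩ := Finset.mem_image.1 hmem
    obtain ⟨hlt, hblock, -⟩ := mem_arcs.1 he
    exact hlt.not_ge (hmax w ((SameBlock.iff_mem hB hxB).1 hblock))
  · obtain ⟨B, hB, hxB⟩ := P.exists_mem hx
    refine ⟨B, hB, hxB, fun y hy => ?_⟩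
    by_contra! hlt
    obtain ⟨z, hz, -⟩ := SameBlock.exists_arc_right ⟨B, hB, hxB, hy⟩ hlt
    exact h (Finset.mem_image_of_mem Prod.fst hz)

end Partitions

section OfArcs

open Relation

variable {n x y : ℕ} {A : Finset (ℕ × ℕ)}

lemma sameBlock_ofArcs : SameBlock (ofArcs n A) x y ↔
    x ∈ Finset.Icc 1 n ∧ y ∈ Finset.Icc 1 n ∧ EqvGen (fun a b => (a, b) ∈ A) x y := by
  classical
  simp only [SameBlock, ofArcs, Finpartition.ofSetSetoid_parts, Finset.mem_image]
  constructor
  · rintro ⟨_, ⟨a, -, rfl⟩, hx, hy⟩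
    rw [Finset.mem_filter] at hx hy
    exact ⟨hx.1, hy.1, hx.2.symm.trans _ _ _ hy.2⟩
  · rintro ⟨hx, hy, h⟩
    exact ⟨_, ⟨x, hx, rfl⟩, Finset.mem_filter.2 ⟨hx, .refl _⟩, Finset.mem_filter.2 ⟨hy, h⟩⟩

lemma reflTransGen_or_reflTransGen_of_eqvGen {α : Type*} {r : α → α → Prop} {a b : α}
    (hr : Relator.RightUnique r) (hl : Relator.LeftUnique r) (h : EqvGen r a b) :
    ReflTransGen r a b ∨ ReflTransGen r b a := by
  induction h with
  | rel a b h => exact Or.inl (.single h)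
  | refl a => exact Or.inl .refl
  | symm a b _ ih => exact ih.symm
  | trans a b c _ _ ih ih' =>
    rcases ih with h | h <;> rcases ih' with h' | h'
    · exact Or.inl (h.trans h')
    · rw [← reflTransGen_swap] at h h'
      have hswap : Relator.RightUnique (Function.swap r) := fun _ _ _ hu hw => hl hu hw
      exact (ReflTransGen.total_of_right_unique hswap h h').symm.imp
        reflTransGen_swap.1 reflTransGen_swap.1
    · exact ReflTransGen.total_of_right_unique hr h h'
    · exact Or.inr (h'.trans h)

namespace IsArcSet

lemma le_of_reflTransGen (hA : IsArcSet n A) (h : ReflTransGen (fun a b => (a, b) ∈ A) x y) :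
    x ≤ y := by
  induction h with
  | refl => exact le_rfl
  | tail _ h ih => exact ih.trans (hA.lt _ h).le

lemma exists_mem_of_eqvGen (hA : IsArcSet n A) (h : EqvGen (fun a b => (a, b) ∈ A) x y)
    (hxy : x < y) : ∃ z, (x, z) ∈ A ∧ z ≤ y := by
  have hchain := reflTransGen_or_reflTransGen_of_eqvGen (r := fun a b => (a, b) ∈ A)
    (fun _ _ _ h h' => congrArg Prod.snd (hA.injOn_fst h h' rfl))
    (fun _ _ _ h h' => congrArg Prod.fst (hA.injOn_snd h h' rfl)) h
  rcases hchain with h | h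
  · obtain rfl | ⟨z, hxz, hzy⟩ := h.cases_head
    · exact absurd hxy (lt_irrefl x)
    · exact ⟨z, hxz, hA.le_of_reflTransGen hzy⟩
  · exact absurd (hA.le_of_reflTransGen h) hxy.not_ge

lemma arcs_ofArcs (hA : IsArcSet n A) : arcs (ofArcs n A) = A := by
  ext ⟨x, y⟩
  simp only [mem_arcs, sameBlock_ofArcs]
  constructor
  · rintro ⟨hxy, ⟨hx, -, h⟩, hbetween⟩
    obtain ⟨z, hxz, hzy⟩ := hA.exists_mem_of_eqvGen h hxy
    have hz := hbetween z ⟨hx, (hA.mem _ hxz).2, .rel _ _ hxz⟩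
    obtain rfl : z = y := hzy.eq_of_not_lt fun hlt => hz ⟨hA.lt _ hxz, hlt⟩
    exact hxz
  · intro hxy
    obtain ⟨hx, hy⟩ := hA.mem _ hxy
    refine ⟨hA.lt _ hxy, ⟨hx, hy, .rel _ _ hxy⟩, ?_⟩
    rintro c ⟨-, -, hc⟩ ⟨hxc, hcy⟩
    obtain ⟨z, hxz, hzc⟩ := hA.exists_mem_of_eqvGen hc hxc
    obtain rfl : y = z := congrArg Prod.snd (hA.injOn_fst hxy hxz rfl)
    exact hzc.not_gt hcy

end IsArcSet

end OfArcs

/-! ### The map on partitions -/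

/-- The algorithm carries the split arcs of `P` to the split arc set with the same right-hand
endpoints in which the arc ending at `y` starts at `h y`. -/
def IsFoataImage {n : ℕ} (P : Finpartition (Finset.Icc 1 n)) (h : ℕ → ℕ) : Prop :=
  IsPhiImage (double (rightEnds (arcs P))) (splitFun (leftOf (arcs P))) (splitFun h)

section Foata

variable {n : ℕ} {A : Finset (ℕ × ℕ)} {P Q : Finpartition (Finset.Icc 1 n)} {h : ℕ → ℕ}

lemma image_fst_mkArcs (R : Finset ℕ) (f : ℕ → ℕ) : (mkArcs R f).image Prod.fst = R.image f := by
  simp [mkArcs, Finset.image_image, Function.comp_def]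

namespace IsArcSet

lemma leftOf_mem (hA : IsArcSet n A) {y : ℕ} (hy : y ∈ rightEnds A) : (leftOf A y, y) ∈ A := by
  rw [eq_mkArcs hA.injOn_snd, pair_mem_mkArcs, ← eq_mkArcs hA.injOn_snd]
  exact ⟨hy, rfl⟩

lemma injOn_leftOf (hA : IsArcSet n A) : Set.InjOn (leftOf A) (rightEnds A) :=
  fun _ hy _ hz e => congrArg Prod.snd (hA.injOn_fst (hA.leftOf_mem hy) (hA.leftOf_mem hz) e)

lemma leftOf_lt (hA : IsArcSet n A) : ∀ y ∈ rightEnds A, leftOf A y < y :=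
  fun _ hy => hA.lt _ (hA.leftOf_mem hy)

lemma mkArcs_of_image_eq (hA : IsArcSet n A) (hinj : Set.InjOn h (rightEnds A))
    (hlt : ∀ y ∈ rightEnds A, h y < y) (himage : (rightEnds A).image h = A.image Prod.fst) :
    IsArcSet n (mkArcs (rightEnds A) h) where
  mem := forall_mem_mkArcs.2 fun y hy => by
    obtain ⟨e, he, hfst⟩ := Finset.mem_image.1 (himage ▸ Finset.mem_image_of_mem h hy)
    exact ⟨hfst ▸ (hA.mem e he).1, (hA.mem _ (hA.leftOf_mem hy)).2⟩
  lt := forall_mem_mkArcs.2 hlt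
  injOn_fst := by
    intro e he e' he' hfst
    obtain ⟨hy, hx⟩ := mem_mkArcs.1 he
    obtain ⟨hy', hx'⟩ := mem_mkArcs.1 he'
    exact Prod.ext hfst (hinj hy hy' (hx.symm.trans (hfst.trans hx')))
  injOn_snd := injOn_snd_mkArcs

end IsArcSet

lemma arcs_eq_mkArcs (P : Finpartition (Finset.Icc 1 n)) :
    arcs P = mkArcs (rightEnds (arcs P)) (leftOf (arcs P)) :=
  eq_mkArcs (isArcSet_arcs P).injOn_snd

lemma isMatching_splitFun_arcs (P : Finpartition (Finset.Icc 1 n)) :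
    IsMatching (double (rightEnds (arcs P))) (splitFun (leftOf (arcs P))) :=
  isMatching_splitFun_iff.2 ⟨(isArcSet_arcs P).injOn_leftOf, (isArcSet_arcs P).leftOf_lt⟩

lemma exists_isFoataImage (P : Finpartition (Finset.Icc 1 n)) : ∃ h, IsFoataImage P h :=
  exists_isPhiImage_splitFun (isArcSet_arcs P).injOn_leftOf (isArcSet_arcs P).leftOf_lt

namespace IsFoataImage

lemma foataArcs_eq (hh : IsFoataImage P h) : foataArcs P = mkArcs (rightEnds (arcs P)) h := by
  rw [foataArcs, arcs_eq_mkArcs P, splitArcs_mkArcs, hh.phi_eq, mergeArcs_mkArcs_splitFun,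
    rightEnds_mkArcs]

lemma image_eq (hh : IsFoataImage P h) :
    (rightEnds (arcs P)).image h = (arcs P).image Prod.fst := by
  rw [IsPhiImage.image_eq_of_splitFun hh, ← image_fst_mkArcs, ← arcs_eq_mkArcs]

lemma isArcSet_foataArcs (hh : IsFoataImage P h) : IsArcSet n (foataArcs P) := by
  obtain ⟨hinj, hlt⟩ := isMatching_splitFun_iff.1 hh.isMatching
  exact hh.foataArcs_eq ▸ (isArcSet_arcs P).mkArcs_of_image_eq hinj hlt hh.image_eq

lemma arcCr2_foataArcs (hh : IsFoataImage P h) : arcCr2 (foataArcs P) = pmaj P := by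
  have hA := isArcSet_arcs P
  rw [hh.foataArcs_eq, arcCr2_mkArcs, ← crossNum_double, hh.crossNum_eq,
    majNum_double hA.injOn_leftOf hA.leftOf_lt, ← arcPmaj_mkArcs hA.leftOf_lt, ← arcs_eq_mkArcs,
    pmaj]

end IsFoataImage

lemma isArcSet_foataArcs (P : Finpartition (Finset.Icc 1 n)) : IsArcSet n (foataArcs P) := by
  obtain ⟨h, hh⟩ := exists_isFoataImage P
  exact hh.isArcSet_foataArcs

lemma image_fst_foataArcs (P : Finpartition (Finset.Icc 1 n)) :
    (foataArcs P).image Prod.fst = (arcs P).image Prod.fst := by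
  obtain ⟨h, hh⟩ := exists_isFoataImage P
  rw [hh.foataArcs_eq, image_fst_mkArcs, hh.image_eq]

lemma rightEnds_foataArcs (P : Finpartition (Finset.Icc 1 n)) :
    rightEnds (foataArcs P) = rightEnds (arcs P) := by
  obtain ⟨h, hh⟩ := exists_isFoataImage P
  rw [hh.foataArcs_eq, rightEnds_mkArcs]

theorem arcs_foataMap (P : Finpartition (Finset.Icc 1 n)) : arcs (foataMap P) = foataArcs P :=
  (isArcSet_foataArcs P).arcs_ofArcs

theorem pmaj_eq_Cr2_foataMap (P : Finpartition (Finset.Icc 1 n)) : pmaj P = Cr2 (foataMap P) := by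
  obtain ⟨h, hh⟩ := exists_isFoataImage P
  rw [Cr2, arcs_foataMap, hh.arcCr2_foataArcs]

lemma minElems_foataMap (P : Finpartition (Finset.Icc 1 n)) :
    minElems (foataMap P) = minElems P := by
  rw [minElems_eq, minElems_eq, arcs_foataMap]
  exact congrArg _ (rightEnds_foataArcs P)

lemma maxElems_foataMap (P : Finpartition (Finset.Icc 1 n)) :
    maxElems (foataMap P) = maxElems P := by
  rw [maxElems_eq, maxElems_eq, arcs_foataMap, image_fst_foataArcs]

theorem foataMap_mem_partitionsWith {S T : Finset ℕ} (hP : P ∈ partitionsWith n S T) :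
    foataMap P ∈ partitionsWith n S T := by
  simpa only [partitionsWith, Finset.mem_filter, minElems_foataMap, maxElems_foataMap,
    Finset.mem_univ, true_and] using hP

lemma phi_splitFun_eq_of_foataArcs_eq (hR : rightEnds (arcs P) = rightEnds (arcs Q))
    (h : foataArcs P = foataArcs Q) :
    phi (mkArcs (double (rightEnds (arcs P))) (splitFun (leftOf (arcs P)))) =
      phi (mkArcs (double (rightEnds (arcs P))) (splitFun (leftOf (arcs Q)))) := by
  obtain ⟨f, hf⟩ := exists_isFoataImage P
  obtain ⟨g, hg⟩ := exists_isFoataImage Q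
  rw [hf.foataArcs_eq, hg.foataArcs_eq, ← hR, mkArcs_inj] at h
  have hphi := hg.phi_eq
  rw [← hR] at hphi
  rw [hf.phi_eq, hphi, mkArcs_congr (eqOn_splitFun_iff.2 h)]

theorem foataMap_injective (n : ℕ) :
    Function.Injective (foataMap : Finpartition (Finset.Icc 1 n) → _) := by
  intro P Q hPQ
  have harcs : foataArcs P = foataArcs Q := by rw [← arcs_foataMap, hPQ, arcs_foataMap]
  have hR : rightEnds (arcs P) = rightEnds (arcs Q) := by
    rw [← rightEnds_foataArcs, harcs, rightEnds_foataArcs]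
  have hleft : Set.EqOn (leftOf (arcs P)) (leftOf (arcs Q)) (rightEnds (arcs P)) :=
    eqOn_splitFun_iff.1 (eqOn_of_phi_eq (isMatching_splitFun_arcs P)
      (hR ▸ isMatching_splitFun_arcs Q) (phi_splitFun_eq_of_foataArcs_eq hR harcs))
  apply arcs_injective
  rw [arcs_eq_mkArcs P, mkArcs_congr hleft, hR, ← arcs_eq_mkArcs]

theorem bijOn_foataMap (n : ℕ) (S T : Finset ℕ) :
    Set.BijOn foataMap (partitionsWith n S T : Set (Finpartition (Finset.Icc 1 n)))
      (partitionsWith n S T) := by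
  have hmaps : Set.MapsTo foataMap (partitionsWith n S T : Set (Finpartition (Finset.Icc 1 n)))
      (partitionsWith n S T) := fun _ hM => foataMap_mem_partitionsWith hM
  have hinj := (foataMap_injective n).injOn (s := partitionsWith n S T)
  exact ⟨hmaps, hinj, Finset.surjOn_of_injOn_of_card_le _ hmaps hinj le_rfl⟩

lemma card_filter_eq_of_bijOn {α β : Type*} {s : Finset α} {t : Finset β} {e : α → β}
    (he : Set.BijOn e s t) {p : α → Prop} {q : β → Prop} [DecidablePred p] [DecidablePred q]
    (h : ∀ a ∈ s, p a ↔ q (e a)) : (s.filter p).card = (t.filter q).card := by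
  refine Finset.card_nbij e (fun a ha => ?_)
    (he.injOn.mono (Finset.filter_subset p s)) fun b hb => ?_
  · rw [Finset.mem_coe, Finset.mem_filter] at ha ⊢
    exact ⟨he.mapsTo ha.1, (h a ha.1).1 ha.2⟩
  · obtain ⟨hbt, hqb⟩ := Finset.mem_filter.1 hb
    obtain ⟨a, ha, rfl⟩ := he.surjOn hbt
    exact ⟨a, Finset.mem_filter.2 ⟨ha, (h a ha).2 hqb⟩, rfl⟩

end Foata

end MatchingFoata

theorem mainTheorem4 (n : ℕ) (S T : Finset ℕ) (hS : S ⊆ Finset.Icc 1 n)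
    (hT : T ⊆ Finset.Icc 1 n) (hST : S.card = T.card) :
    -- `φ` is well defined: the arcs produced by the algorithm are exactly the arcs of `φ(M)`
    (∀ M ∈ MatchingFoata.partitionsWith n S T,
      MatchingFoata.arcs (MatchingFoata.foataMap M) = MatchingFoata.foataArcs M) ∧
    -- `φ` is a bijection from `P_n(S, T)` to itself
    Set.BijOn MatchingFoata.foataMap
      (MatchingFoata.partitionsWith n S T : Set (Finpartition (Finset.Icc 1 n)))
      (MatchingFoata.partitionsWith n S T) ∧
    -- `φ` carries the p-major index to the number of 2-crossings
    (∀ M ∈ MatchingFoata.partitionsWith n S T,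
      MatchingFoata.pmaj M = MatchingFoata.Cr2 (MatchingFoata.foataMap M)) ∧
    -- hence the two statistics are equidistributed on `P_n(S, T)`
    (∀ k : ℕ,
      ((MatchingFoata.partitionsWith n S T).filter fun M => MatchingFoata.pmaj M = k).card =
      ((MatchingFoata.partitionsWith n S T).filter fun M => MatchingFoata.Cr2 M = k).card) := by
  have hbij := MatchingFoata.bijOn_foataMap n S T
  refine ⟨fun M _ => MatchingFoata.arcs_foataMap M, hbij,
    fun M _ => MatchingFoata.pmaj_eq_Cr2_foataMap M, fun k => ?_⟩
  exact MatchingFoata.card_filter_eq_of_bijOn hbij fun M _ => by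
    rw [MatchingFoata.pmaj_eq_Cr2_foataMap]
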